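/- Let $S$ be a normal integral scheme and let $A/S$ be an $n$-dimensional $\mathbb{G}_{a,S}$-algebra scheme, i.e. a scheme over $S$ with a structure of associative unitary (not necessarily commutative) algebra over the ring scheme $\mathbb{G}_{a,S}$, whose underlying $\mathbb{G}_{a,S}$-module is a vector bundle of rank $n$. Let $A^\vee$ be its linear dual; sections of $\mathrm{Sym}^d(A^\vee)$ are identified with the functions $A\to\mathbb{G}_{a,S}$ that are homogeneous of degree $d$, i.e. locally on $S$ linear combinations, with coefficients functions on the base, of products of $d$ linear forms on $A$. Let $d$ be the least integer $d\ge 0$ such that the morphism $A\to\bigwedge^{d+1}A$, $a\mapsto 1\wedge a\wedge a^2\wedge\dots\wedge a^d$, is zero, and assume $d\ge 2$ (equivalently, $n\ge 2$). Then there exists a unique section $\det=\det_{A/S}$ of $\mathrm{Sym}^d(A^\vee)$ over $S$ such that: 1. $\det\colon A\to\mathbb{G}_{a,S}$ is a morphism of multiplicative unitary monoid schemes, and 2. the morphism of schemes $A\to A$ defined by evaluating at $a\in A$ the polynomial $P(T)=\det(T-a)$ is zero. Moreover: 3. the group scheme of units of $A$ is the preimage of the multiplicative group $\mathbb{G}_{m,S}$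 under $\det$: for every $S$-scheme $T$, a point $a\in A(T)$ is a unit if and only if $\det(a)\in\Gamma(T,\mathcal{O}_T)^\times$; 4. the formation of $\det$ is compatible with flat extensions of normal integral schemes: for every flat morphism $S'\to S$ with $S'$ a normal integral scheme, the least integer attached in the same way to $A'=A\times_S S'$ is again $d$, and $\det_{A'/S'}$ (the unique section of $\mathrm{Sym}^d(A'^\vee)$ satisfying 1 and 2 for $A'$) is the pullback of $\det_{A/S}$. -/

import Mathlib

open AlgebraicGeometry CategoryTheory Polynomial

universe u

-- keep the category structure as the only source of the notation for morphisms
attribute [-instance] catToReflQuiver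

noncomputable section

/-- A scheme is normal if all its local rings are integrally closed domains. -/
def AlgebraicGeometry.Scheme.IsNormalScheme (S : Scheme.{u}) : Prop :=
  ∀ x : S, IsDomain (S.presheaf.stalk x) ∧ IsIntegrallyClosed (S.presheaf.stalk x)

/-- An algebra scheme over the ring scheme `𝔾ₐ` over `S` (associative, unitary, not necessarily
commutative), through its functor of points: an `S`-scheme `X` together with, for every `S`-scheme
`T`, a structure of `Γ(T, 𝒪_T)`-algebra on the set `X(T)` of `S`-morphisms `T ⟶ X`, compatibly with
all morphisms `φ : T' ⟶ T` of `S`-schemes. By Yoneda, this is the same as giving addition,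
multiplication, zero, unit and scalar multiplication as morphisms of `S`-schemes. -/
structure GaAlgebraScheme (S : Scheme.{u}) where
  /-- the underlying `S`-scheme -/
  X : Over S
  ring : ∀ T : Over S, Ring (T ⟶ X)
  algebra : ∀ T : Over S, Algebra Γ(T.left, ⊤) (T ⟶ X)
  comp_one : ∀ {T' T : Over S} (φ : T' ⟶ T), φ ≫ (1 : T ⟶ X) = 1
  comp_add : ∀ {T' T : Over S} (φ : T' ⟶ T) (a b : T ⟶ X), φ ≫ (a + b) = φ ≫ a + φ ≫ b
  comp_mul : ∀ {T' T : Over S} (φ : T' ⟶ T) (a b : T ⟶ X), φ ≫ (a * b) = (φ ≫ a) * (φ ≫ b)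
  comp_smul : ∀ {T' T : Over S} (φ : T' ⟶ T) (c : Γ(T.left, ⊤)) (a : T ⟶ X),
    φ ≫ (c • a) = φ.left.appTop c • (φ ≫ a)

namespace GaAlgebraScheme

attribute [instance] GaAlgebraScheme.ring GaAlgebraScheme.algebra

variable {S : Scheme.{u}} (A : GaAlgebraScheme S)

/-- `A` is `n`-dimensional: its underlying module is a vector bundle of rank `n`. That is, locally
on `S` (over `U`), there are sections `e₁, …, eₙ` of `A` whose pullbacks to every scheme `T` over
`U` form a basis of the `Γ(T, 𝒪_T)`-module `A(T)`. -/
def HasDimension (n : ℕ) : Prop :=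
  ∀ s : S, ∃ U : S.Opens, s ∈ U ∧ ∃ e : Fin n → (Over.mk U.ι ⟶ A.X),
    ∀ (T : Over S) (g : T ⟶ Over.mk U.ι),
      ∃ b : Module.Basis (Fin n) Γ(T.left, ⊤) (T ⟶ A.X), ∀ i, b i = g ≫ e i

/-- The morphism `A → ⋀^(d+1) A`, `a ↦ 1 ∧ a ∧ a² ∧ ⋯ ∧ a^d`, is zero. A morphism of schemes is
determined by its effect on points with values in affine schemes `T`, for which
`(⋀^(d+1) A)(T)` is the exterior power of the `Γ(T, 𝒪_T)`-module `A(T)`. -/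
def DegreeLE (d : ℕ) : Prop :=
  ∀ (T : Over S), IsAffine T.left → ∀ a : T ⟶ A.X,
    exteriorPower.ιMulti Γ(T.left, ⊤) (d + 1) (fun i : Fin (d + 1) => a ^ (i : ℕ)) = 0

variable {A} in
lemma le_preimage {U : S.Opens} {T : Over S} (hT : T.hom ⁻¹ᵁ U = ⊤) (a : T ⟶ A.X) :
    ⊤ ≤ a.left ⁻¹ᵁ (A.X.hom ⁻¹ᵁ U) := by
  rw [← Scheme.Hom.comp_preimage, Over.w a, hT]

variable {A} in
/-- The value `g(a) ∈ Γ(T, 𝒪_T)` at a point `a ∈ A(T)` of a function `g` on the open subscheme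
`A|_U` of `A`, when `T` lies over the open subscheme `U` of `S`. -/
def valueOn {U : S.Opens} (g : Γ(A.X.left, A.X.hom ⁻¹ᵁ U)) {T : Over S} (hT : T.hom ⁻¹ᵁ U = ⊤)
    (a : T ⟶ A.X) : Γ(T.left, ⊤) :=
  a.left.appLE (A.X.hom ⁻¹ᵁ U) ⊤ (le_preimage hT a) g

variable {A} in
/-- The value `f(a) ∈ Γ(T, 𝒪_T)` of a function `f` on `A`, that is of a morphism of `S`-schemes
`A → 𝔾ₐ`, at a point `a ∈ A(T)`. -/
def value (f : Γ(A.X.left, ⊤)) {T : Over S} (a : T ⟶ A.X) : Γ(T.left, ⊤) :=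
  a.left.appTop f

/-- The functions on `A|_U` form an algebra over the functions on `U`. -/
instance functionsAlgebra (U : S.Opens) : Algebra Γ(S, U) Γ(A.X.left, A.X.hom ⁻¹ᵁ U) :=
  (A.X.hom.app U).hom.toAlgebra

lemma valueOn_smul {U : S.Opens} (r : Γ(S, U)) (g : Γ(A.X.left, A.X.hom ⁻¹ᵁ U)) {T : Over S}
    (hT : T.hom ⁻¹ᵁ U = ⊤) (a : T ⟶ A.X) :
    valueOn (r • g) hT a = valueOn (algebraMap _ _ r) hT a * valueOn g hT a := by
  rw [Algebra.smul_def]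
  exact map_mul (a.left.appLE (A.X.hom ⁻¹ᵁ U) ⊤ (le_preimage hT a)).hom _ _

/-- The sections over `U` of the linear dual `A^∨`: the linear functions `A|_U → 𝔾ₐ`, as a
`Γ(U, 𝒪_S)`-module of functions on `A|_U`. -/
def dual (U : S.Opens) : Submodule Γ(S, U) Γ(A.X.left, A.X.hom ⁻¹ᵁ U) where
  carrier := {g | ∀ (T : Over S) (hT : T.hom ⁻¹ᵁ U = ⊤),
    (∀ a b : T ⟶ A.X, valueOn g hT (a + b) = valueOn g hT a + valueOn g hT b) ∧
    ∀ (c : Γ(T.left, ⊤)) (a : T ⟶ A.X), valueOn g hT (c • a) = c * valueOn g hT a}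
  zero_mem' := fun T hT => by simp [valueOn]
  add_mem' := fun {g h} hg hh T hT => by
    have key : ∀ a : T ⟶ A.X, valueOn (g + h) hT a = valueOn g hT a + valueOn h hT a :=
      fun a => map_add (a.left.appLE (A.X.hom ⁻¹ᵁ U) ⊤ (le_preimage hT a)).hom _ _
    refine ⟨fun a b => ?_, fun c a => ?_⟩
    · rw [key, key, key, (hg T hT).1, (hh T hT).1]; ring
    · rw [key, key, (hg T hT).2, (hh T hT).2]; ring
  smul_mem' := fun r g hg T hT => by
    have key : ∀ a : T ⟶ A.X, valueOn (algebraMap Γ(S, U) Γ(A.X.left, A.X.hom ⁻¹ᵁ U) r) hT a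
        = T.hom.appLE U ⊤ hT.ge r := fun a => by
      have h := Scheme.Hom.appLE_comp_appLE a.left A.X.hom U (A.X.hom ⁻¹ᵁ U) ⊤ le_rfl
        (le_preimage hT a)
      simp only [Over.w] at h
      rw [← h, Scheme.Hom.appLE_eq_app]
      rfl
    refine ⟨fun a b => ?_, fun c a => ?_⟩
    · simp only [valueOn_smul, key]; rw [(hg T hT).1]; ring
    · simp only [valueOn_smul, key]; rw [(hg T hT).2]; ring

/-- The function `f` on `A` is a section over `S` of `Sym^d(A^∨)`, the degree `d` component of the
sheaf `Sym(A^∨)` of functions on `A`: locally on `S`, it is a linear combination, with functions on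
the base as coefficients, of products of `d` sections of `A^∨`. -/
def IsSymSection (d : ℕ) (f : Γ(A.X.left, ⊤)) : Prop :=
  ∀ s : S, ∃ U : S.Opens, s ∈ U ∧
    A.X.left.presheaf.map (homOfLE (le_top : A.X.hom ⁻¹ᵁ U ≤ ⊤)).op f ∈ A.dual U ^ d

variable {A} in
/-- The function `f`, viewed as a morphism `A → 𝔾ₐ`, is a morphism of multiplicative unitary monoid
schemes. -/
def IsMonoidMorphism (f : Γ(A.X.left, ⊤)) : Prop :=
  (∀ T : Over S, value f (1 : T ⟶ A.X) = 1) ∧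
  ∀ (T : Over S) (a b : T ⟶ A.X), value f (a * b) = value f a * value f b

variable {A} in
/-- For `a ∈ A(R)`, where `Spec R` is an affine `S`-scheme, this is the polynomial
`P(X) = f(X - a) ∈ R[X]`: the value of `f` at the point `X · 1 - a` of `A(R[X])`. -/
def charPoly (f : Γ(A.X.left, ⊤)) {R : CommRingCat.{u}} {t : Spec R ⟶ S}
    (a : Over.mk t ⟶ A.X) : R[X] :=
  let p : Spec (.of R[X]) ⟶ Spec R := Spec.map (CommRingCat.ofHom Polynomial.C)
  let T' : Over S := Over.mk (p ≫ t)
  let φ : T' ⟶ Over.mk t := Over.homMk p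
  let x : Γ(T'.left, ⊤) := (Scheme.ΓSpecIso (.of R[X])).inv (Polynomial.X : R[X])
  (Scheme.ΓSpecIso (.of R[X])).hom (value f (x • (1 : T' ⟶ A.X) - φ ≫ a))

variable {A} in
/-- The morphism of schemes `A → A` which evaluates at `a` the polynomial `P(X) = f(X - a)`
is zero (on points with values in all affine schemes, hence on all points). -/
def KillsCharPoly (f : Γ(A.X.left, ⊤)) : Prop :=
  ∀ (R : CommRingCat.{u}) (t : Spec R ⟶ S) (a : Over.mk t ⟶ A.X),
    Polynomial.aeval (R := Γ((Over.mk t).left, ⊤)) a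
      ((charPoly f a).map (Scheme.ΓSpecIso R).inv.hom) = 0

/-- `f` is a determinant of `A`, of degree `d`. -/
structure IsDeterminant (d : ℕ) (f : Γ(A.X.left, ⊤)) : Prop where
  sym : A.IsSymSection d f
  monoid : IsMonoidMorphism f
  kills : KillsCharPoly f

/-- The bijection between the `T`-points of `X ×_S S'` over `S'` and the `T`-points of `X`
over `S`. -/
abbrev pullbackPoints {S' : Scheme.{u}} (X : Over S) (g : S' ⟶ S) (T : Over S') :
    (T ⟶ (Over.pullback g).obj X) ≃ ((Over.map g).obj T ⟶ X) :=
  ((Over.mapPullbackAdj g).homEquiv T X).symm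

lemma pullbackPoints_comp {S' : Scheme.{u}} (X : Over S) (g : S' ⟶ S) {T' T : Over S'}
    (φ : T' ⟶ T) (a : T ⟶ (Over.pullback g).obj X) :
    pullbackPoints X g T' (φ ≫ a) = (Over.map g).map φ ≫ pullbackPoints X g T a :=
  (Over.mapPullbackAdj g).homEquiv_naturality_left_symm φ a

/-- The base change `A ×_S S'`, an algebra scheme over `S'`. -/
def baseChange {S' : Scheme.{u}} (g : S' ⟶ S) : GaAlgebraScheme S' where
  X := (Over.pullback g).obj A.X
  ring T := (pullbackPoints A.X g T).ring
  algebra T :=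
    letI : Algebra Γ(T.left, ⊤) ((Over.map g).obj T ⟶ A.X) := A.algebra ((Over.map g).obj T)
    (pullbackPoints A.X g T).algebra Γ(T.left, ⊤)
  comp_one φ := by
    apply (pullbackPoints A.X g _).injective
    rw [pullbackPoints_comp]
    simp only [Equiv.one_def, Equiv.apply_symm_apply]
    exact A.comp_one _
  comp_add φ a b := by
    apply (pullbackPoints A.X g _).injective
    rw [pullbackPoints_comp]
    simp only [Equiv.add_def, Equiv.apply_symm_apply, pullbackPoints_comp]
    exact A.comp_add _ _ _
  comp_mul φ a b := by
    apply (pullbackPoints A.X g _).injective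
    rw [pullbackPoints_comp]
    simp only [Equiv.mul_def, Equiv.apply_symm_apply, pullbackPoints_comp]
    exact A.comp_mul _ _ _
  comp_smul φ c a := by
    apply (pullbackPoints A.X g _).injective
    rw [pullbackPoints_comp]
    have h := A.comp_smul ((Over.map g).map φ) c (pullbackPoints A.X g _ a)
    rw [← pullbackPoints_comp] at h
    refine (congrArg _ (Equiv.apply_symm_apply (pullbackPoints A.X g _) _)).trans (h.trans ?_)
    exact (Equiv.apply_symm_apply (pullbackPoints A.X g _) _).symm

/-- The pullback to `A ×_S S'` of a function on `A`. -/
def pullbackFunction {S' : Scheme.{u}} (g : S' ⟶ S) (f : Γ(A.X.left, ⊤)) :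
    Γ((A.baseChange g).X.left, ⊤) :=
  (Limits.pullback.fst A.X.hom g).appTop f

end GaAlgebraScheme

end

/-! Locally the base is affine with ring `k` and `A` is a finite free `k`-algebra. Let `ξ` be its
generic element, whose coordinates are the variables of `P = k[x₁, …, xₙ]`. Over a domain, powers of
`ξ` are linearly independent exactly when their exterior product is nonzero, so `d` is the degree of
the minimal polynomial `p` of `ξ` over `Frac P`. This `p` divides the characteristic polynomial of
left multiplication by `ξ`, which is monic over `P`; since `k` is integrally closed, so is `P`, and
therefore `p` has coefficients in `P` (`GenericElement.exists_monic`).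

The determinant is `D = (-1)^d p(0)`. Everything about it comes from one rigidity: an element with
`1, …, ξ^(d-1)` independent satisfies at most one monic equation of degree `d`. Applied to `Xξ` it
shows that `D` is homogeneous of degree `d`; applied to `X - ξ` it shows `D(X - ξ) = p(X)`, which is
Cayley-Hamilton; applied to the characteristic polynomial of a competitor of `D` it gives
uniqueness. For multiplicativity, `D` divides the norm `N` of the regular representation, so `D(xy)`
divides `N(xy) = N(x)N(y)`. Over a field, such a divisor is a polynomial in `x` times a polynomial
in `y`, and setting `x = 1` or `y = 1`, with `D(1) = 1`, identifies it with `D(x)D(y)`. Together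
this is `GenericElement.exists_genericNorm`.

To globalize, a determinant is regarded as a natural family of functions on points. By Yoneda such a
family is a polynomial in local coordinates (`Frame.exists_eval_eq`), so the algebra applies; local
determinants agree on overlaps by uniqueness and glue. This needs the independence of `1, …,
ξ^(d-1)` over every affine chart (`HasDimension.isIndependent`). Since `S` is irreducible with
injective restriction maps, dependence in one chart spreads to all of them, so `1 ∧ a ∧ ⋯ ∧ a^(d-1)`
vanishes locally for every point `a`, against the minimality of `d`. Passing from local to global
vanishing over an affine `T` is not formal, because `A(T)` is free only locally; it rests on the
usual clearing of denominators on basic open sets (`HasDimension.ιMulti_eq_zero_of_locally`).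

Units are detected by the constant term of the Cayley-Hamilton equation. Under flat base change,
functions on affine charts of the base inject, so generic independence persists and `d` does not
drop. -/

noncomputable section

/-! ### Exterior products, minors and linear independence -/

section ExteriorPower

open Module exteriorPower

variable {R R' K M M' I : Type*} [CommRing R] [CommRing R'] [AddCommGroup M] [AddCommGroup M']
  [Module R M] [Module R' M'] [LinearOrder I]

/-- A decomposable element of an exterior power of a free module vanishes if and only if the
maximal minors of its coordinates vanish. -/
lemma ιMulti_eq_zero_iff_minors (b : Basis I R M) {d : ℕ} (v : Fin d → M) :
    ιMulti R d v = 0 ↔ ∀ s : Set.powersetCard I d,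
      (Matrix.of fun i j => b.repr (v i) (Set.powersetCard.ofFinEmbEquiv.symm s j)).det = 0 := by
  rw [← (b.exteriorPower d).repr.map_eq_zero_iff, DFunLike.ext_iff]
  refine forall_congr' fun s => ?_
  rw [basis_repr_apply, ιMultiDual_apply_ιMulti]
  simp only [Basis.coord_apply, Finsupp.coe_zero, Pi.zero_apply]

lemma minors_map (φ : R →+* R') {b : Basis I R M} {b' : Basis I R' M'} {d : ℕ} {v : Fin d → M}
    {v' : Fin d → M'} (h : ∀ i j, b'.repr (v' i) j = φ (b.repr (v i) j))
    (s : Set.powersetCard I d) :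
    (Matrix.of fun i j => b'.repr (v' i) (Set.powersetCard.ofFinEmbEquiv.symm s j)).det =
      φ (Matrix.of fun i j => b.repr (v i) (Set.powersetCard.ofFinEmbEquiv.symm s j)).det := by
  rw [RingHom.map_det]
  congr 1
  ext i j
  simp [h]

lemma ιMulti_eq_zero_of_repr (φ : R →+* R') (b : Basis I R M) (b' : Basis I R' M') {d : ℕ}
    {v : Fin d → M} {v' : Fin d → M'} (h : ∀ i j, b'.repr (v' i) j = φ (b.repr (v i) j))
    (hv : ιMulti R d v = 0) : ιMulti R' d v' = 0 := by
  rw [ιMulti_eq_zero_iff_minors b] at hv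
  rw [ιMulti_eq_zero_iff_minors b']
  intro s
  rw [minors_map φ h, hv, map_zero]

lemma ιMulti_eq_zero_of_repr_injective {φ : R →+* R'} (hφ : Function.Injective φ)
    (b : Basis I R M) (b' : Basis I R' M') {d : ℕ}
    {v : Fin d → M} {v' : Fin d → M'} (h : ∀ i j, b'.repr (v' i) j = φ (b.repr (v i) j))
    (hv : ιMulti R' d v' = 0) : ιMulti R d v = 0 := by
  rw [ιMulti_eq_zero_iff_minors b'] at hv
  rw [ιMulti_eq_zero_iff_minors b]
  intro s
  exact hφ (by rw [← minors_map φ h, hv, map_zero])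

/-- After restriction of scalars along `φ`, the composite of `f` with `ψ` is an `R`-alternating map
on `M`, so it factors through the exterior power over `R`. No bases are involved, so this also
applies to points where `A` has no global frame. -/
lemma alternatingMap_eq_zero_of_semilinear {N : Type*} [AddCommGroup N] [Module R' N]
    (φ : R →+* R') (ψ : M →+ M') (hψ : ∀ (r : R) (m : M), ψ (r • m) = φ r • ψ m) {d : ℕ}
    (f : M' [⋀^Fin d]→ₗ[R'] N) {v : Fin d → M} (hv : ιMulti R d v = 0) :
    f (fun i => ψ (v i)) = 0 := by
  let : Algebra R R' := φ.toAlgebra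
  let : Module R M' := Module.compHom M' φ
  have : IsScalarTower R R' M' := ⟨fun r r' m => by
    change (φ r * r') • m = φ r • r' • m
    rw [mul_smul]⟩
  let : Module R N := Module.compHom _ φ
  have : IsScalarTower R R' N := ⟨fun r r' m => by
    change (φ r * r') • m = φ r • r' • m
    rw [mul_smul]⟩
  let ψ' : M →ₗ[R] M' := { ψ with map_smul' := hψ }
  let F : M [⋀^Fin d]→ₗ[R] N := 
    { (f.toMultilinearMap.restrictScalars R).compLinearMap (fun _ => ψ') with
      map_eq_zero_of_eq' := fun v i j hv hij => f.map_eq_zero_of_eq _ (congrArg ψ hv) hij }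
  have h := alternatingMapLinearEquiv_apply_ιMulti F v
  rw [hv, map_zero] at h
  exact h.symm

lemma ιMulti_eq_zero_of_semilinear (φ : R →+* R') (ψ : M →+ M')
    (hψ : ∀ (r : R) (m : M), ψ (r • m) = φ r • ψ m) {d : ℕ} {v : Fin d → M}
    (hv : ιMulti R d v = 0) : ιMulti R' d (fun i => ψ (v i)) = 0 :=
  alternatingMap_eq_zero_of_semilinear φ ψ hψ _ hv

/-- Over a field, a family is independent if and only if its exterior product is nonzero. -/
lemma ιMulti_ne_zero_of_linearIndependent_field [Field K] [Module K M] {d : ℕ} {v : Fin d → M}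
    (hv : LinearIndependent K v) : ιMulti K d v ≠ 0 := by
  have h := ιMulti_family_linearIndependent_field (n := d) hv
  have hc : (Finset.univ : Finset (Fin d)) ∈ Set.powersetCard (Fin d) d := by simp
  have := h.ne_zero ⟨Finset.univ, hc⟩
  convert this
  rw [ιMulti_family]
  congr 1
  -- The increasing enumeration of the full set `Fin d` is the identity.
  have : Set.powersetCard.ofFinEmbEquiv.symm
      (⟨Finset.univ, hc⟩ : Set.powersetCard (Fin d) d) = (RelEmbedding.refl _) := by
    refine RelEmbedding.ext fun i => congrFun ((StrictMono.range_inj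
      (OrderEmbedding.strictMono _) (OrderEmbedding.strictMono _)).mp ?_) i
    rw [(Finite.injective_iff_surjective.mp (RelEmbedding.injective _)).range_eq,
      (Finite.injective_iff_surjective.mp (RelEmbedding.injective _)).range_eq]
  rw [this]
  rfl

/-- Inserting a relation `∑ cᵢ vᵢ = 0` in slot `j`, where `cⱼ ≠ 0`, gives `cⱼ` times the exterior
product; the exterior power of a free module over a domain is torsion free. -/
lemma ιMulti_eq_zero_of_not_linearIndependent [IsDomain R] [Module.Free R M]
    {d : ℕ} {v : Fin d → M} (hv : ¬ LinearIndependent R v) : ιMulti R d v = 0 := by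
  rw [Fintype.linearIndependent_iff] at hv
  push Not at hv
  obtain ⟨c, hc, j, hj⟩ := hv
  have h1 : c j • ιMulti R d v = 0 := by
    have h2 : ιMulti R d (Function.update v j (∑ i, c i • v i)) = 0 := by
      rw [hc]; exact (ιMulti R d).map_update_zero _ _
    rw [AlternatingMap.map_update_sum] at h2
    rw [Finset.sum_eq_single j] at h2
    · simpa [AlternatingMap.map_update_smul] using h2
    · intro i _ hij
      rw [AlternatingMap.map_update_smul, AlternatingMap.map_update_self _ _ hij.symm, smul_zero]
    · simp
  exact (smul_eq_zero.mp h1).resolve_left hj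

/-- Coordinates embed the module in a vector space over the fraction field, where independence
persists and the field case applies. -/
lemma ιMulti_ne_zero_of_linearIndependent [IsDomain R] [Finite I] (b : Basis I R M)
    {d : ℕ} {v : Fin d → M} (hv : LinearIndependent R v) : ιMulti R d v ≠ 0 := by
  cases nonempty_fintype I
  let K := FractionRing R
  let v' : Fin d → (I → K) := fun i j => algebraMap R K (b.repr (v i) j)
  have hv' : LinearIndependent K v' := by
    rw [← LinearIndependent.iff_fractionRing (R := R) (K := K)]
    let F : M →ₗ[R] (I → K) :=
      LinearMap.pi fun j => (Algebra.linearMap R K).comp (b.coord j)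
    refine hv.map' F (LinearMap.ker_eq_bot.mpr fun x y hxy => b.repr.injective ?_)
    ext j
    exact IsFractionRing.injective R K (congrFun hxy j)
  intro h
  refine ιMulti_ne_zero_of_linearIndependent_field hv' ?_
  exact ιMulti_eq_zero_of_repr (algebraMap R K) b (Pi.basisFun K I) (fun i j => by simp [v']) h

lemma linearIndependent_iff_ιMulti_ne_zero [IsDomain R] [Finite I] (b : Basis I R M)
    {d : ℕ} {v : Fin d → M} : LinearIndependent R v ↔ ιMulti R d v ≠ 0 := by
  have := Module.Free.of_basis b
  exact ⟨ιMulti_ne_zero_of_linearIndependent b,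
    fun h => by_contra fun h' => h (ιMulti_eq_zero_of_not_linearIndependent h')⟩

end ExteriorPower

/-! ### Normality of polynomial rings -/

section MvPolynomialNormal

lemma MvPolynomial.isIntegrallyClosed_fin (k : Type*) [CommRing k] [IsDomain k]
    [IsIntegrallyClosed k] (n : ℕ) : IsIntegrallyClosed (MvPolynomial (Fin n) k) := by
  induction n with
  | zero =>
    exact IsIntegrallyClosed.of_equiv (MvPolynomial.isEmptyRingEquiv k (Fin 0)).symm
  | succ n ih =>
    exact IsIntegrallyClosed.of_equiv (MvPolynomial.finSuccEquiv k n).toRingEquiv.symm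

end MvPolynomialNormal


/-! ### The generic element and its monic equation -/

namespace GenericElement

open TensorProduct Module

variable {k A : Type*} [CommRing k] [Ring A] [Algebra k A] {n : ℕ} (e : Basis (Fin n) k A)
  {C C' : Type*} [CommRing C] [CommRing C'] [Algebra k C] [Algebra k C']

/-- The coordinates of a point of the algebra with values in `C`. -/
def coords (a : C ⊗[k] A) : Fin n → C := (Algebra.TensorProduct.basis C e).repr a

lemma coords_injective : Function.Injective (coords e (C := C)) := fun _ _ h =>
  (Algebra.TensorProduct.basis C e).repr.injective (DFunLike.coe_injective h)

@[simp] lemma coords_tmul (c : C) (a : A) (i : Fin n) :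
    coords e (c ⊗ₜ[k] a) i = c * algebraMap k C (e.repr a i) := by
  simp [coords, Algebra.TensorProduct.basis_repr_tmul]

@[simp] lemma coords_add (a b : C ⊗[k] A) : coords e (a + b) = coords e a + coords e b := by
  ext i; simp [coords]

@[simp] lemma coords_sub (a b : C ⊗[k] A) : coords e (a - b) = coords e a - coords e b := by
  ext i; simp [coords]

@[simp] lemma coords_neg (a : C ⊗[k] A) : coords e (-a) = - coords e a := by
  ext i; simp [coords]

@[simp] lemma coords_smul (c : C) (a : C ⊗[k] A) : coords e (c • a) = c • coords e a := by
  ext i; simp [coords]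

@[simp] lemma coords_one : coords e (1 : C ⊗[k] A) = fun i => algebraMap k C (e.repr 1 i) := by
  ext i; rw [Algebra.TensorProduct.one_def, coords_tmul, one_mul]

variable (A) in
/-- Extension of scalars of points. -/
abbrev extend (φ : C →ₐ[k] C') : C ⊗[k] A →ₐ[k] C' ⊗[k] A :=
  Algebra.TensorProduct.map φ (AlgHom.id k A)

lemma extend_smul (φ : C →ₐ[k] C') (c : C) (a : C ⊗[k] A) :
    extend A φ (c • a) = φ c • extend A φ a := by
  induction a with
  | zero => simp
  | add x y hx hy => simp only [smul_add, map_add, hx, hy]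
  | tmul x y => simp [TensorProduct.smul_tmul']

@[simp] lemma coords_extend (φ : C →ₐ[k] C') (a : C ⊗[k] A) (i : Fin n) :
    coords e (extend A φ a) i = φ (coords e a i) := by
  induction a with
  | zero => simp [coords]
  | add x y hx hy => simp only [map_add, coords_add, Pi.add_apply, hx, hy]
  | tmul x y => simp

include e in
lemma extend_injective {φ : C →ₐ[k] C'} (hφ : Function.Injective φ) :
    Function.Injective (extend A φ) := fun a b h => coords_injective e <| by
  ext i
  exact hφ (by rw [← coords_extend, h, coords_extend])

/-- The point with given coordinates. -/
def ofCoords (c : Fin n → C) : C ⊗[k] A := ∑ i, c i ⊗ₜ e i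

@[simp] lemma coords_ofCoords (c : Fin n → C) : coords e (ofCoords e c) = c := by
  ext1 i
  simp only [coords, ofCoords, map_sum, Finsupp.coe_finsetSum, Finset.sum_apply,
    Algebra.TensorProduct.basis_repr_tmul]
  simp [Finsupp.single_apply]

lemma extend_ofCoords (φ : C →ₐ[k] C') (c : Fin n → C) :
    extend A φ (ofCoords e c) = ofCoords e (fun i => φ (c i)) := by
  apply coords_injective e
  ext1 i
  simp

lemma ofCoords_coords (a : C ⊗[k] A) : ofCoords e (coords e a) = a :=
  coords_injective e (coords_ofCoords e _)

/-- The generic element, with values in the polynomial ring. -/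
def generic : MvPolynomial (Fin n) k ⊗[k] A := ofCoords e MvPolynomial.X

@[simp] lemma coords_generic : coords e (generic e) = MvPolynomial.X := coords_ofCoords e _

lemma extend_generic (a : C ⊗[k] A) :
    extend A (MvPolynomial.aeval (coords e a)) (generic e) = a := by
  apply coords_injective e
  ext i
  simp

/-- The value of a polynomial function at a point. -/
def evalAt (D : MvPolynomial (Fin n) k) (a : C ⊗[k] A) : C := MvPolynomial.aeval (coords e a) D

@[simp] lemma evalAt_generic (D : MvPolynomial (Fin n) k) : evalAt e D (generic e) = D := by
  simp [evalAt]

lemma evalAt_extend (D : MvPolynomial (Fin n) k) (φ : C →ₐ[k] C') (a : C ⊗[k] A) :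
    evalAt e D (extend A φ a) = φ (evalAt e D a) := by
  have : coords e (extend A φ a) = φ ∘ coords e a := by ext; simp
  rw [evalAt, this, evalAt, MvPolynomial.comp_aeval_apply]; rfl

lemma aeval_extend (φ : C →ₐ[k] C') (a : C ⊗[k] A) (p : C[X]) :
    aeval (extend A φ a) (p.map φ.toRingHom) = extend A φ (aeval a p) := by
  induction p using Polynomial.induction_on' with
  | add p q hp hq => simp only [Polynomial.map_add, map_add, hp, hq]
  | monomial m c =>
    simp only [Polynomial.map_monomial, aeval_monomial, ← Algebra.smul_def, extend_smul, map_pow]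
    rfl

include e in
-- Over domains, independence is the nonvanishing of some minor of coordinates, and an injective
-- homomorphism neither creates nor destroys zeros of minors.
lemma linearIndependent_extend [IsDomain C] [IsDomain C'] {φ : C →ₐ[k] C'}
    (hφ : Function.Injective φ) {d : ℕ} {v : Fin d → C ⊗[k] A} :
    LinearIndependent C' (fun i => extend A φ (v i)) ↔ LinearIndependent C v := by
  rw [linearIndependent_iff_ιMulti_ne_zero (Algebra.TensorProduct.basis C e),
    linearIndependent_iff_ιMulti_ne_zero (Algebra.TensorProduct.basis C' e), not_iff_not]
  have h (i j) : (Algebra.TensorProduct.basis C' e).repr (extend A φ (v i)) j =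
      φ.toRingHom ((Algebra.TensorProduct.basis C e).repr (v i) j) := coords_extend e φ (v i) j
  exact ⟨ιMulti_eq_zero_of_repr_injective hφ _ _ h, ιMulti_eq_zero_of_repr _ _ _ h⟩

section Powers

variable {B : Type*} [Ring B] [Algebra C B]

lemma eq_zero_of_aeval_eq_zero {a : B} {d : ℕ}
    (h : LinearIndependent C fun i : Fin d => a ^ (i : ℕ)) {p : C[X]} (hp : p.degree < d)
    (ha : aeval a p = 0) : p = 0 := by
  rcases Nat.eq_zero_or_pos d with rfl | hd
  · simpa [degree_eq_bot, Nat.WithBot.lt_zero_iff] using hp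
  have hp' : p.natDegree < d := by
    by_cases h0 : p = 0
    · simpa [h0] using hd
    · exact (natDegree_lt_iff_degree_lt h0).mpr hp
  rw [aeval_eq_sum_range' hp', ← Fin.sum_univ_eq_sum_range (fun i => p.coeff i • a ^ i)] at ha
  have := Fintype.linearIndependent_iff.mp h _ ha
  ext i
  by_cases hi : i < d
  · simpa using this ⟨i, hi⟩
  · simpa using coeff_eq_zero_of_natDegree_lt (hp'.trans_le (not_lt.mp hi))

/-- The difference of two monic polynomials of degree `d` has degree less than `d`, so independence
kills it. This rigidity yields homogeneity, Cayley-Hamilton and uniqueness of the determinant. -/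
lemma eq_of_monic_of_aeval_eq_zero [Nontrivial C] {a : B} {d : ℕ}
    (h : LinearIndependent C fun i : Fin d => a ^ (i : ℕ)) {p q : C[X]}
    (hp : p.Monic) (hq : q.Monic) (hpd : p.natDegree = d) (hqd : q.natDegree = d)
    (hpa : aeval a p = 0) (hqa : aeval a q = 0) : p = q := by
  refine sub_eq_zero.mp (eq_zero_of_aeval_eq_zero h ?_ (by rw [map_sub, hpa, hqa, sub_zero]))
  rw [← hpd, ← degree_eq_natDegree hp.ne_zero]
  apply degree_sub_lt_left _ hp.ne_zero (by rw [hp.leadingCoeff, hq.leadingCoeff])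
  rw [degree_eq_natDegree hp.ne_zero, degree_eq_natDegree hq.ne_zero, hpd, hqd]

end Powers

/-- The norm form: the determinant of the left multiplication. -/
def normAt (a : C ⊗[k] A) : C :=
  (Algebra.leftMulMatrix (Algebra.TensorProduct.basis C e) a).det

lemma normAt_one : normAt e (1 : C ⊗[k] A) = 1 := by simp [normAt]

lemma normAt_mul (a b : C ⊗[k] A) : normAt e (a * b) = normAt e a * normAt e b := by
  simp [normAt]

lemma leftMulMatrix_extend (φ : C →ₐ[k] C') (a : C ⊗[k] A) :
    Algebra.leftMulMatrix (Algebra.TensorProduct.basis C' e) (extend A φ a) =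
      (Algebra.leftMulMatrix (Algebra.TensorProduct.basis C e) a).map φ := by
  ext i j
  rw [Matrix.map_apply, Algebra.leftMulMatrix_eq_repr_mul, Algebra.leftMulMatrix_eq_repr_mul]
  have : Algebra.TensorProduct.basis C' e j =
      extend A φ (Algebra.TensorProduct.basis C e j) := by simp
  rw [this, ← map_mul]
  exact coords_extend e φ _ i

lemma normAt_extend (φ : C →ₐ[k] C') (a : C ⊗[k] A) :
    normAt e (extend A φ a) = φ (normAt e a) := by
  rw [normAt, leftMulMatrix_extend, normAt, AlgHom.map_det]; rfl

/-- The left regular representation is faithful because the algebra is unital, so Cayley-Hamilton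
for matrices descends to the algebra. -/
lemma aeval_charpoly_leftMulMatrix (a : C ⊗[k] A) :
    aeval a (Algebra.leftMulMatrix (Algebra.TensorProduct.basis C e) a).charpoly = 0 := by
  apply Algebra.leftMulMatrix_injective (Algebra.TensorProduct.basis C e)
  rw [← Polynomial.aeval_algHom_apply, Matrix.aeval_self_charpoly, map_zero]

/-- If `1, ξ, …, ξ^d` are dependent, but `1, ξ, …, ξ^(d-1)` are not, the generic element `ξ` is
annihilated by a monic polynomial of degree `d`. -/
lemma exists_monic [IsDomain k] [IsIntegrallyClosed k] {d : ℕ}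
    (hind : LinearIndependent (MvPolynomial (Fin n) k) fun i : Fin d => generic e ^ (i : ℕ))
    (hdep : ¬ LinearIndependent (MvPolynomial (Fin n) k)
      fun i : Fin (d + 1) => generic e ^ (i : ℕ)) :
    ∃ p : (MvPolynomial (Fin n) k)[X], p.Monic ∧ p.natDegree = d ∧ aeval (generic e) p = 0 := by
  have := MvPolynomial.isIntegrallyClosed_fin k n
  set P := MvPolynomial (Fin n) k
  let K := FractionRing P
  let φ : P →ₐ[k] K := IsScalarTower.toAlgHom k P K
  have hφ : Function.Injective φ := IsFractionRing.injective P K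
  let ξ := extend A φ (generic e)
  have hind' : LinearIndependent K fun i : Fin d => ξ ^ (i : ℕ) := by
    simpa only [map_pow] using (linearIndependent_extend e hφ).mpr hind
  have hdep' : ¬ LinearIndependent K fun i : Fin (d + 1) => ξ ^ (i : ℕ) := by
    simpa only [map_pow] using (linearIndependent_extend e hφ).not.mpr hdep
  have hfin : Module.Finite K (K ⊗[k] A) := Module.Finite.of_basis (Algebra.TensorProduct.basis K e)
  have hint : IsIntegral K ξ := Algebra.IsIntegral.isIntegral ξ
  have hdeg : (minpoly K ξ).natDegree = d := by
    apply le_antisymm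
    · rw [Fintype.linearIndependent_iff] at hdep'
      push Not at hdep'
      obtain ⟨c, hc, j, hj⟩ := hdep'
      let q : K[X] := ∑ i : Fin (d + 1), C (c i) * X ^ (i : ℕ)
      have hq : aeval ξ q = 0 := by
        simpa [q, map_sum, Algebra.smul_def] using hc
      have hcoeff : q.coeff j = c j := by
        simp only [q, finsetSum_coeff, coeff_C_mul, coeff_X_pow]
        rw [Finset.sum_eq_single j] <;> simp +contextual [Fin.val_inj, eq_comm]
      have hq0 : q ≠ 0 := fun h => hj (by rw [← hcoeff, h, coeff_zero])
      refine natDegree_le_natDegree ((minpoly.degree_le_of_ne_zero K ξ hq0 hq)) |>.trans ?_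
      refine natDegree_sum_le_of_forall_le _ _ fun i _ => ?_
      exact (natDegree_C_mul_X_pow_le _ _).trans (Nat.lt_succ_iff.mp i.2)
    · by_contra! h
      refine minpoly.ne_zero hint (eq_zero_of_aeval_eq_zero hind' ?_ (minpoly.aeval K ξ))
      exact (natDegree_lt_iff_degree_lt (minpoly.ne_zero hint)).mp h
  -- The characteristic polynomial of left multiplication is a monic polynomial over `P`
  -- annihilating `ξ`.
  have hdvd : minpoly K ξ ∣ ((Algebra.leftMulMatrix (Algebra.TensorProduct.basis P e)
      (generic e)).charpoly).map (algebraMap P K) := by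
    apply minpoly.dvd
    refine (aeval_extend φ (generic e) _).trans ?_
    rw [aeval_charpoly_leftMulMatrix, map_zero]
  -- This is where normality enters: over an integrally closed domain, a monic factor over `K` of a
  -- monic polynomial has coefficients in `P`.
  obtain ⟨p, hp⟩ := IsIntegrallyClosed.eq_map_mul_C_of_dvd K (Matrix.charpoly_monic _) hdvd
  rw [(minpoly.monic hint).leadingCoeff, C_1, mul_one] at hp
  have hmonic : p.Monic :=
    Polynomial.monic_of_injective (IsFractionRing.injective P K) (hp ▸ minpoly.monic hint)
  refine ⟨p, hmonic, ?_, ?_⟩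
  · rw [← hdeg, ← hp, hmonic.natDegree_map]
  · apply extend_injective e hφ
    rw [← aeval_extend, map_zero]
    exact (congrArg (aeval ξ) hp).trans (minpoly.aeval K ξ)

end GenericElement


/-! ### Homogeneity and factorization of multivariate polynomials -/

section MvPolynomialLemmas

variable {σ k C : Type*} [CommRing k] [CommRing C] [Algebra k C]

/-- Under `xᵢ ↦ X bᵢ` a monomial of degree `m` acquires the factor `X^m`, so the powers of `X`
separate the homogeneous components. -/
lemma MvPolynomial.coeff_aeval_X_mul (b : σ → C) (D : MvPolynomial σ k) (j : ℕ) :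
    (MvPolynomial.aeval (fun i => (Polynomial.X * Polynomial.C (b i) : C[X])) D).coeff j =
      MvPolynomial.aeval b (MvPolynomial.homogeneousComponent j D) := by
  induction D using MvPolynomial.induction_on' with
  | add p q hp hq => simp only [map_add, Polynomial.coeff_add, hp, hq]
  | monomial m c =>
    have h : (MvPolynomial.aeval (fun i => (Polynomial.X * Polynomial.C (b i) : C[X])))
        (MvPolynomial.monomial m c) =
        Polynomial.C (MvPolynomial.aeval b (MvPolynomial.monomial m c)) *
          Polynomial.X ^ m.degree := by
      simp only [MvPolynomial.aeval_monomial, Finsupp.prod, mul_pow, Finset.prod_mul_distrib,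
        Finset.prod_pow_eq_pow_sum, map_mul, map_prod, map_pow, Finsupp.degree_apply,
        Polynomial.algebraMap_apply]
      ring
    rw [h, coeff_C_mul_X_pow]
    split_ifs with hj
    · subst hj
      rw [MvPolynomial.homogeneousComponent_of_mem
        (MvPolynomial.isHomogeneous_monomial (n := m.degree) c rfl), if_pos rfl]
    · rw [MvPolynomial.homogeneousComponent_of_mem
        (MvPolynomial.isHomogeneous_monomial (n := m.degree) c rfl), if_neg hj, map_zero]

lemma MvPolynomial.isHomogeneous_of_aeval_X_mul {D : MvPolynomial σ k} {d : ℕ}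
    (h : MvPolynomial.aeval (fun i => (Polynomial.X * Polynomial.C (MvPolynomial.X i) :
      (MvPolynomial σ k)[X])) D = Polynomial.X ^ d * Polynomial.C D) : D.IsHomogeneous d := by
  have := MvPolynomial.coeff_aeval_X_mul (MvPolynomial.X (R := k)) D d
  rw [h, coeff_X_pow_mul', if_pos le_rfl, Nat.sub_self, coeff_C_zero, MvPolynomial.aeval_X_left,
    AlgHom.id_apply] at this
  rw [this]
  exact MvPolynomial.homogeneousComponent_isHomogeneous d D

lemma MvPolynomial.aeval_smul_of_isHomogeneous {D : MvPolynomial σ k} {d : ℕ}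
    (h : D.IsHomogeneous d) (c : C) (b : σ → C) :
    MvPolynomial.aeval (c • b) D = c ^ d * MvPolynomial.aeval b D := by
  rw [MvPolynomial.aeval_def, MvPolynomial.aeval_def, MvPolynomial.eval₂_eq,
    MvPolynomial.eval₂_eq, Finset.mul_sum]
  refine Finset.sum_congr rfl fun m hm => ?_
  have hd : ∑ i ∈ m.support, m i = d := by
    rw [← h (MvPolynomial.mem_support_iff.mp hm), Finsupp.weight_apply, Finsupp.sum]; simp
  simp only [Pi.smul_apply, smul_eq_mul, mul_pow, Finset.prod_mul_distrib,
    Finset.prod_pow_eq_pow_sum, hd]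
  ring

/-- Top coefficients multiply in a product of polynomials of bounded degree. Applied to `D(X·1 -
a)`, this bounds the degree in `X` and gives the top coefficient `D(1)`. -/
lemma MvPolynomial.natDegree_aeval_linear (a b : σ → C) (m : σ →₀ ℕ) (c : k) :
    (MvPolynomial.aeval (fun i => Polynomial.C (a i) * Polynomial.X + Polynomial.C (b i))
      (MvPolynomial.monomial m c)).natDegree ≤ m.degree ∧
    (MvPolynomial.aeval (fun i => Polynomial.C (a i) * Polynomial.X + Polynomial.C (b i))
      (MvPolynomial.monomial m c)).coeff m.degree =
        MvPolynomial.aeval a (MvPolynomial.monomial m c) := by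
  have h1 : ∀ m : σ →₀ ℕ,
      (MvPolynomial.aeval (fun i => Polynomial.C (a i) * Polynomial.X + Polynomial.C (b i))
        (MvPolynomial.monomial m (1 : k))).natDegree ≤ m.degree ∧
      (MvPolynomial.aeval (fun i => Polynomial.C (a i) * Polynomial.X + Polynomial.C (b i))
        (MvPolynomial.monomial m (1 : k))).coeff m.degree =
          MvPolynomial.aeval a (MvPolynomial.monomial m (1 : k)) := by
    intro m
    induction m using Finsupp.induction_linear with
    | zero => simp
    | add m m' hm hm' =>
      have : MvPolynomial.monomial (m + m') (1 : k) =
          MvPolynomial.monomial m 1 * MvPolynomial.monomial m' 1 := by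
        rw [MvPolynomial.monomial_mul, one_mul]
      rw [this, map_mul, map_mul, map_add]
      exact ⟨natDegree_mul_le_of_le hm.1 hm'.1, by
        rw [Polynomial.coeff_mul_add_eq_of_natDegree_le hm.1 hm'.1, hm.2, hm'.2]⟩
    | single i r =>
      have hl : (Polynomial.C (a i) * Polynomial.X + Polynomial.C (b i)).natDegree ≤ 1 :=
        natDegree_linear_le
      simp only [MvPolynomial.aeval_monomial, map_one, one_mul, Finsupp.degree_single,
        Finsupp.prod_single_index, pow_zero]
      refine ⟨(natDegree_pow_le_of_le r hl).trans (by simp), ?_⟩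
      have := Polynomial.coeff_pow_of_natDegree_le (m := r) hl
      rw [mul_one] at this
      simpa using this
  have h2 : MvPolynomial.monomial m c = c • MvPolynomial.monomial m (1 : k) := by
    simp [MvPolynomial.smul_monomial]
  rw [h2, map_smul, map_smul]
  exact ⟨(natDegree_smul_le _ _).trans (h1 m).1, by rw [Polynomial.coeff_smul, (h1 m).2]⟩

lemma MvPolynomial.natDegree_aeval_linear_of_isHomogeneous {D : MvPolynomial σ k} {d : ℕ}
    (h : D.IsHomogeneous d) (a b : σ → C) :
    (MvPolynomial.aeval (fun i => Polynomial.C (a i) * Polynomial.X + Polynomial.C (b i))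
      D).natDegree ≤ d ∧
    (MvPolynomial.aeval (fun i => Polynomial.C (a i) * Polynomial.X + Polynomial.C (b i))
      D).coeff d = MvPolynomial.aeval a D := by
  have hd : ∀ m ∈ D.support, m.degree = d := fun m hm => by
    rw [← h (MvPolynomial.mem_support_iff.mp hm), Finsupp.degree_eq_weight_one]; rfl
  conv => enter [1, 1]; rw [D.as_sum, map_sum]
  conv => enter [2]; rw [D.as_sum, map_sum, map_sum, finsetSum_coeff]
  refine ⟨natDegree_sum_le_of_forall_le _ _ fun m hm => ?_, Finset.sum_congr rfl fun m hm => ?_⟩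
  · rw [← hd m hm]; exact (MvPolynomial.natDegree_aeval_linear a b m _).1
  · rw [← hd m hm]; exact (MvPolynomial.natDegree_aeval_linear a b m _).2

/-- Viewed as polynomials in the `σ`-variables over the domain `k[τ]`, the two factors have total
degrees adding up to zero, so both are constant. -/
lemma MvPolynomial.mem_range_rename_inr_of_mul_eq {τ : Type*} [IsDomain k]
    {p q : MvPolynomial (σ ⊕ τ) k} {r : MvPolynomial τ k} (hr : r ≠ 0)
    (h : p * q = MvPolynomial.rename Sum.inr r) :
    ∃ p₀ : MvPolynomial τ k, p = MvPolynomial.rename Sum.inr p₀ := by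
  let E := MvPolynomial.sumAlgEquiv k σ τ
  have hE : ∀ s : MvPolynomial τ k, E (MvPolynomial.rename Sum.inr s) = MvPolynomial.C s := by
    intro s
    have : (E : MvPolynomial (σ ⊕ τ) k →ₐ[k] MvPolynomial σ (MvPolynomial τ k)).comp
        (MvPolynomial.rename Sum.inr) =
        IsScalarTower.toAlgHom k (MvPolynomial τ k) (MvPolynomial σ (MvPolynomial τ k)) := by
      apply MvPolynomial.algHom_ext
      intro i
      simp [E, MvPolynomial.algebraMap_eq]
    exact DFunLike.congr_fun this s
  have h' : E p * E q = MvPolynomial.C r := by rw [← map_mul, h, hE]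
  have h0 : E p * E q ≠ 0 := by rw [h']; simpa using hr
  have hdeg := MvPolynomial.totalDegree_mul_of_isDomain (left_ne_zero_of_mul h0)
    (right_ne_zero_of_mul h0)
  rw [h', MvPolynomial.totalDegree_C] at hdeg
  have := MvPolynomial.totalDegree_eq_zero_iff_eq_C.mp (show (E p).totalDegree = 0 by omega)
  exact ⟨_, E.injective (by rw [hE]; exact this)⟩

lemma MvPolynomial.mem_range_rename_inl_of_mul_eq {τ : Type*} [IsDomain k]
    {p q : MvPolynomial (σ ⊕ τ) k} {r : MvPolynomial σ k} (hr : r ≠ 0)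
    (h : p * q = MvPolynomial.rename Sum.inl r) :
    ∃ p₀ : MvPolynomial σ k, p = MvPolynomial.rename Sum.inl p₀ := by
  have h' := congrArg (MvPolynomial.rename Sum.swap) h
  rw [map_mul, MvPolynomial.rename_rename] at h'
  obtain ⟨p₀, hp₀⟩ := MvPolynomial.mem_range_rename_inr_of_mul_eq hr h'
  refine ⟨p₀, MvPolynomial.rename_injective _ Sum.swap_leftInverse.injective ?_⟩
  rw [hp₀, MvPolynomial.rename_rename]
  rfl

/-- A factor of a polynomial `N(x) N(y)` is a product of a polynomial in `x` and a polynomial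
in `y`, which are determined by the values at a point `x = o` or `y = o`. -/
lemma MvPolynomial.eq_mul_of_dvd {F : Type*} [Field F] {f : MvPolynomial (σ ⊕ σ) F}
    {g N : MvPolynomial σ F} (o : σ → F) (hN : N ≠ 0)
    (hf : f ∣ MvPolynomial.rename Sum.inl N * MvPolynomial.rename Sum.inr N)
    (hg : MvPolynomial.aeval o g = 1)
    (h₁ : MvPolynomial.aeval (Sum.elim MvPolynomial.X fun i => MvPolynomial.C (o i)) f = g)
    (h₂ : MvPolynomial.aeval (Sum.elim (fun i => MvPolynomial.C (o i)) MvPolynomial.X) f = g) :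
    f = MvPolynomial.rename Sum.inl g * MvPolynomial.rename Sum.inr g := by
  -- Polynomial rings over a field are factorial, so a divisor of a product splits along the two
  -- factors; then `u` involves only `x` and `v` only `y`.
  obtain ⟨u, v, ⟨u', hu⟩, ⟨v', hv⟩, huv⟩ := exists_dvd_and_dvd_of_dvd_mul hf
  obtain ⟨u, rfl⟩ := MvPolynomial.mem_range_rename_inl_of_mul_eq hN hu.symm
  obtain ⟨v, rfl⟩ := MvPolynomial.mem_range_rename_inr_of_mul_eq hN hv.symm
  have hC (s : MvPolynomial σ F) :
      MvPolynomial.aeval (fun i => (MvPolynomial.C (o i) : MvPolynomial σ F)) s =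
        MvPolynomial.C (MvPolynomial.aeval o s) :=
    MvPolynomial.aeval_algebraMap_apply (MvPolynomial σ F) o s
  simp only [huv, map_mul, MvPolynomial.aeval_rename, Sum.elim_comp_inl, Sum.elim_comp_inr,
    hC, MvPolynomial.aeval_X_left, AlgHom.id_apply] at h₁ h₂
  -- The hypotheses now read `u · v(o) = g` and `u(o) · v = g`; with `u(o) v(o) = g(o) = 1` they
  -- give `g(x) g(y) = u(x) v(y)`.
  have h3 : MvPolynomial.aeval o u * MvPolynomial.aeval o v = 1 := by
    rw [← hg, ← h₁, map_mul, MvPolynomial.aeval_C]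
    rfl
  have h4 : (MvPolynomial.C (MvPolynomial.aeval o u) : MvPolynomial (σ ⊕ σ) F) *
      MvPolynomial.C (MvPolynomial.aeval o v) = 1 := by rw [← map_mul, h3, map_one]
  rw [huv]
  nth_rewrite 1 [← h₁]
  rw [← h₂, map_mul, map_mul, MvPolynomial.rename_C, MvPolynomial.rename_C]
  linear_combination (- MvPolynomial.rename Sum.inl u * MvPolynomial.rename Sum.inr v) * h4

lemma MvPolynomial.map_algebraMap_rename {τ F : Type*} [CommRing F] [Algebra k F] (g : σ → τ)
    (D : MvPolynomial σ k) :
    MvPolynomial.aeval (fun i => (MvPolynomial.X (g i) : MvPolynomial τ F)) D =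
      MvPolynomial.rename g (MvPolynomial.map (algebraMap k F) D) := by
  have : MvPolynomial.rename (R := F) g = MvPolynomial.aeval fun i => MvPolynomial.X (g i) :=
    MvPolynomial.algHom_ext fun i => by simp
  rw [this, MvPolynomial.aeval_map_algebraMap]

end MvPolynomialLemmas


/-! ### The generic norm over a normal domain -/

namespace GenericElement

open TensorProduct Module

variable {k A : Type*} [CommRing k] [Ring A] [Algebra k A] {n : ℕ} (e : Basis (Fin n) k A)
  {C C' : Type*} [CommRing C] [CommRing C'] [Algebra k C] [Algebra k C']

variable (k C) in
/-- The inclusion of the constant polynomials. -/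
abbrev constHom : C →ₐ[k] C[X] := IsScalarTower.toAlgHom k C C[X]

/-- The polynomial `D(X - a)`. -/
def charpolyAt (D : MvPolynomial (Fin n) k) (a : C ⊗[k] A) : C[X] :=
  evalAt e D ((X : C[X]) • (1 : C[X] ⊗[k] A) - extend A (constHom k C) a)

lemma charpolyAt_eq (D : MvPolynomial (Fin n) k) (a : C ⊗[k] A) :
    charpolyAt e D a = MvPolynomial.aeval
      (fun i => Polynomial.C (coords e (1 : C ⊗[k] A) i) * X + Polynomial.C (-coords e a i)) D := by
  rw [charpolyAt, evalAt]
  congr 2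
  ext1 i
  rw [coords_sub, coords_smul, coords_one, coords_one]
  simp only [Pi.sub_apply, Pi.smul_apply, coords_extend, smul_eq_mul, map_neg, sub_eq_add_neg]
  rw [mul_comm, IsScalarTower.algebraMap_apply k C C[X]]
  rfl

lemma charpolyAt_extend (D : MvPolynomial (Fin n) k) (φ : C →ₐ[k] C') (a : C ⊗[k] A) :
    charpolyAt e D (extend A φ a) = (charpolyAt e D a).map φ.toRingHom := by
  have h := evalAt_extend e D (Polynomial.mapAlgHom φ)
    ((X : C[X]) • (1 : C[X] ⊗[k] A) - extend A (constHom k C) a)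
  refine Eq.trans ?_ h
  rw [charpolyAt]
  congr 1
  apply coords_injective e
  ext1 i
  rw [coords_extend]
  simp [Polynomial.algebraMap_apply]

lemma eval_zero_charpolyAt (D : MvPolynomial (Fin n) k) (a : C ⊗[k] A) :
    (charpolyAt e D a).coeff 0 = evalAt e D (-a) := by
  rw [charpolyAt_eq, coeff_zero_eq_aeval_zero]
  rw [← AlgHom.restrictScalars_apply k (aeval (0 : C)) (MvPolynomial.aeval _ D),
    MvPolynomial.comp_aeval_apply, evalAt]
  congr 2
  ext1 i
  simp

lemma evalAt_one (D : MvPolynomial (Fin n) k) :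
    evalAt e D (1 : C ⊗[k] A) = algebraMap k C (MvPolynomial.aeval (e.repr 1) D) := by
  rw [evalAt, coords_one]
  exact MvPolynomial.aeval_algebraMap_apply C (e.repr 1) D

lemma evalAt_smul {D : MvPolynomial (Fin n) k} {d : ℕ} (hD : D.IsHomogeneous d) (c : C)
    (a : C ⊗[k] A) : evalAt e D (c • a) = c ^ d * evalAt e D a := by
  rw [evalAt, coords_smul, MvPolynomial.aeval_smul_of_isHomogeneous hD, evalAt]

lemma evalAt_neg {D : MvPolynomial (Fin n) k} {d : ℕ} (hD : D.IsHomogeneous d)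
    (a : C ⊗[k] A) : evalAt e D (-a) = (-1) ^ d * evalAt e D a := by
  rw [← evalAt_smul e hD, neg_one_smul]

lemma monic_charpolyAt {D : MvPolynomial (Fin n) k} {d : ℕ} (hD : D.IsHomogeneous d)
    (h1 : MvPolynomial.aeval (e.repr 1) D = 1) [Nontrivial C] (a : C ⊗[k] A) :
    (charpolyAt e D a).Monic ∧ (charpolyAt e D a).natDegree = d := by
  obtain ⟨hle, hc⟩ := MvPolynomial.natDegree_aeval_linear_of_isHomogeneous hD
    (coords e (1 : C ⊗[k] A)) (-coords e a)
  have h : MvPolynomial.aeval (coords e (1 : C ⊗[k] A)) D = 1 := by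
    rw [← evalAt, evalAt_one, h1, map_one]
  simp only [Pi.neg_apply] at hle hc
  rw [← charpolyAt_eq] at hle hc
  rw [h] at hc
  refine ⟨monic_of_natDegree_le_of_coeff_eq_one d hle hc, le_antisymm hle ?_⟩
  exact le_natDegree_of_ne_zero (by rw [hc]; exact one_ne_zero)

/-- A normalized homogeneous polynomial function of degree `d` satisfying the Cayley-Hamilton
identity is unique if `1, ξ, …, ξ^(d-1)` are independent. -/
lemma unique_of_aeval_charpolyAt [IsDomain k] {d : ℕ}
    (hind : LinearIndependent (MvPolynomial (Fin n) k) fun i : Fin d => generic e ^ (i : ℕ))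
    {D D' : MvPolynomial (Fin n) k} (hD : D.IsHomogeneous d) (hD' : D'.IsHomogeneous d)
    (h1 : MvPolynomial.aeval (e.repr 1) D = 1) (h1' : MvPolynomial.aeval (e.repr 1) D' = 1)
    (h : aeval (generic e) (charpolyAt e D (generic e)) = 0)
    (h' : aeval (generic e) (charpolyAt e D' (generic e)) = 0) : D = D' := by
  have hm := monic_charpolyAt e hD h1 (generic e)
  have hm' := monic_charpolyAt e hD' h1' (generic e)
  have := congrArg (fun p => p.coeff 0)
    (eq_of_monic_of_aeval_eq_zero hind hm.1 hm'.1 hm.2 hm'.2 h h')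
  simp only [eval_zero_charpolyAt, evalAt_neg e hD, evalAt_neg e hD', evalAt_generic] at this
  exact (IsUnit.mul_right_inj (isUnit_neg_one.pow d)).mp this

/-- Every point is a specialization of the generic element, and the Cayley-Hamilton identity is
compatible with specialization. -/
lemma aeval_charpolyAt_of_generic {D : MvPolynomial (Fin n) k}
    (h : aeval (generic e) (charpolyAt e D (generic e)) = 0) (a : C ⊗[k] A) :
    aeval a (charpolyAt e D a) = 0 := by
  have := aeval_extend (A := A) (MvPolynomial.aeval (coords e a)) (generic e)
    (charpolyAt e D (generic e))
  rwa [h, map_zero, ← charpolyAt_extend, extend_generic] at this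

lemma neg_one_pow_mul_self {R : Type*} [CommRing R] (d : ℕ) : (-1 : R) ^ d * (-1) ^ d = 1 := by
  rw [← mul_pow, neg_one_mul, neg_neg, one_pow]

section Monic

variable [IsDomain k] {d : ℕ}
  (hind : LinearIndependent (MvPolynomial (Fin n) k) fun i : Fin d => generic e ^ (i : ℕ))
  {p : (MvPolynomial (Fin n) k)[X]} (hp : p.Monic) (hd : p.natDegree = d)
  (h : aeval (generic e) p = 0)

include hind hp hd h

/-- The substitution `xᵢ ↦ X xᵢ` is injective and sends `ξ` to `Xξ`. Both the image of `p` and `p`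
with its roots scaled by `X` are monic of degree `d` and annihilate `Xξ`; by rigidity they coincide,
and their constant terms are the two sides. -/
lemma map_constantCoeff_of_scaling :
    MvPolynomial.aeval (fun i => (X * Polynomial.C (MvPolynomial.X i) :
      (MvPolynomial (Fin n) k)[X])) (p.coeff 0) = X ^ d * Polynomial.C (p.coeff 0) := by
  let φ : MvPolynomial (Fin n) k →ₐ[k] (MvPolynomial (Fin n) k)[X] :=
    MvPolynomial.aeval (fun i => (X * Polynomial.C (MvPolynomial.X i) : (MvPolynomial (Fin n) k)[X]))
  have hφ : Function.Injective φ := by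
    -- Setting `X = 1` is a retraction of the substitution.
    let χ : (MvPolynomial (Fin n) k)[X] →ₐ[k] MvPolynomial (Fin n) k := (aeval (1 : MvPolynomial (Fin n) k)).restrictScalars k
    have hχ : χ.comp φ = AlgHom.id k _ := MvPolynomial.algHom_ext fun i => by simp [χ, φ]
    exact Function.LeftInverse.injective (g := χ) fun x => DFunLike.congr_fun hχ x
  have hscale : extend A φ (generic e) =
      algebraMap (MvPolynomial (Fin n) k)[X] ((MvPolynomial (Fin n) k)[X] ⊗[k] A) X * extend A (constHom k (MvPolynomial (Fin n) k)) (generic e) := by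
    rw [← Algebra.smul_def]
    apply coords_injective e
    ext1 i
    simp [φ]
  have hind' : LinearIndependent (MvPolynomial (Fin n) k)[X] fun i : Fin d => extend A φ (generic e) ^ (i : ℕ) := by
    simpa only [map_pow] using (linearIndependent_extend e hφ).mpr hind
  have key := eq_of_monic_of_aeval_eq_zero hind' (hp.map φ.toRingHom)
    (q := (p.map (constHom k (MvPolynomial (Fin n) k)).toRingHom).scaleRoots X)
    ((monic_scaleRoots_iff X).mpr (hp.map _)) (by rw [hp.natDegree_map, hd])
    (by rw [natDegree_scaleRoots, hp.natDegree_map, hd])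
    (by rw [aeval_extend, h, map_zero])
    (by rw [hscale]; exact scaleRoots_aeval_eq_zero (by rw [aeval_extend, h, map_zero]))
  have := congrArg (fun q => q.coeff 0) key
  simp only [coeff_map, coeff_scaleRoots, hp.natDegree_map, hd, Nat.sub_zero] at this
  exact this.trans (mul_comm _ _)

/-- The substitution `xᵢ ↦ X·(i-th coordinate of 1) - xᵢ` is injective and sends `ξ` to `X - ξ`.
With `Y` the outer variable, the image of `p` and `(-1)^d p(X - Y)` are monic of degree `d` in `Y`
and annihilate `X - ξ`. Equating their values at `Y = 0` gives the identity. -/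
lemma map_constantCoeff_of_shift :
    charpolyAt e (p.coeff 0) (generic e) = (-1) ^ d * p := by
  let φ : MvPolynomial (Fin n) k →ₐ[k] (MvPolynomial (Fin n) k)[X] := MvPolynomial.aeval
    (fun i => (X * Polynomial.C (algebraMap k (MvPolynomial (Fin n) k) (e.repr 1 i)) -
      Polynomial.C (MvPolynomial.X i) : (MvPolynomial (Fin n) k)[X]))
  have hφ : Function.Injective φ := by
    -- Setting `X = 0` and changing the sign of every variable undoes the substitution.
    let χ : (MvPolynomial (Fin n) k)[X] →ₐ[k] MvPolynomial (Fin n) k := (MvPolynomial.aeval (fun i => - MvPolynomial.X i)).comp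
      ((aeval (0 : MvPolynomial (Fin n) k)).restrictScalars k)
    have hχ : χ.comp φ = AlgHom.id k _ := MvPolynomial.algHom_ext fun i => by simp [χ, φ]
    exact Function.LeftInverse.injective (g := χ) fun x => DFunLike.congr_fun hχ x
  have hshift : extend A φ (generic e) =
      algebraMap (MvPolynomial (Fin n) k)[X] ((MvPolynomial (Fin n) k)[X] ⊗[k] A) X - extend A (constHom k (MvPolynomial (Fin n) k)) (generic e) := by
    rw [Algebra.algebraMap_eq_smul_one]
    apply coords_injective e
    ext1 i
    simp [φ, Polynomial.algebraMap_apply]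
  have hind' : LinearIndependent (MvPolynomial (Fin n) k)[X] fun i : Fin d => extend A φ (generic e) ^ (i : ℕ) := by
    simpa only [map_pow] using (linearIndependent_extend e hφ).mpr hind
  let q : (MvPolynomial (Fin n) k)[X][X] := Polynomial.C ((-1) ^ d) *
    (p.map (constHom k (MvPolynomial (Fin n) k)).toRingHom).comp (Polynomial.C X - X)
  have hpm : (p.map (constHom k (MvPolynomial (Fin n) k)).toRingHom).Monic := hp.map _
  have hlin : (Polynomial.C X - X : (MvPolynomial (Fin n) k)[X][X]) = - (X - Polynomial.C X) := by ring
  have hlind : (Polynomial.C X - X : (MvPolynomial (Fin n) k)[X][X]).natDegree = 1 := by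
    rw [hlin, natDegree_neg, natDegree_X_sub_C]
  have hcm : ((p.map (constHom k (MvPolynomial (Fin n) k)).toRingHom).comp (Polynomial.C X - X)).leadingCoeff =
      (-1) ^ d := by
    rw [leadingCoeff_comp (by rw [hlind]; exact one_ne_zero), hpm.leadingCoeff, hlin,
      leadingCoeff_neg, leadingCoeff_X_sub_C, hp.natDegree_map, hd, one_mul]
  have hq : q.Monic := by
    rw [Monic, leadingCoeff_mul, leadingCoeff_C, hcm]
    exact neg_one_pow_mul_self d
  have hqd : q.natDegree = d := by
    rw [natDegree_C_mul (pow_ne_zero _ (neg_ne_zero.mpr one_ne_zero)), natDegree_comp, hlind,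
      hp.natDegree_map, hd, mul_one]
  have key := eq_of_monic_of_aeval_eq_zero hind' (hp.map φ.toRingHom) hq
    (by rw [hp.natDegree_map, hd]) hqd (by rw [aeval_extend, h, map_zero])
    (by
      rw [map_mul, aeval_comp, hshift, map_sub, aeval_C, aeval_C, aeval_X, sub_sub_cancel,
        aeval_extend, h, map_zero, mul_zero])
  have := congrArg (fun q => q.coeff 0) key
  simp only [coeff_map] at this
  rw [charpolyAt_eq]
  have h2 : (fun i => Polynomial.C (coords e (1 : MvPolynomial (Fin n) k ⊗[k] A) i) * X +
      Polynomial.C (-coords e (generic e) i)) = fun i =>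
      (X * Polynomial.C (algebraMap k (MvPolynomial (Fin n) k) (e.repr 1 i)) - Polynomial.C (MvPolynomial.X i) : (MvPolynomial (Fin n) k)[X]) := by
    ext1 i
    rw [coords_one, coords_generic, mul_comm, map_neg, ← sub_eq_add_neg]
  rw [h2]
  refine this.trans ?_
  rw [coeff_zero_eq_eval_zero, eval_mul, eval_comp]
  simp only [eval_C, eval_sub, eval_X, sub_zero]
  congr 1
  rw [Polynomial.eval_map]
  exact eval₂_C_X

end Monic

/-- A normalized factor of a multiplicative polynomial function is multiplicative. -/
lemma evalAt_mul_of_dvd [IsDomain k] {D N : MvPolynomial (Fin n) k}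
    (hN : ∀ a b : MvPolynomial (Fin n ⊕ Fin n) (FractionRing k) ⊗[k] A,
      evalAt e N (a * b) = evalAt e N a * evalAt e N b)
    (hN0 : N ≠ 0) (hD : D ∣ N) (h1 : MvPolynomial.aeval (e.repr 1) D = 1)
    (a b : C ⊗[k] A) : evalAt e D (a * b) = evalAt e D a * evalAt e D b := by
  obtain ⟨G, hG⟩ := hD
  -- Two independent generic elements. The coefficients are enlarged to a field because the argument
  -- uses unique factorization.
  let x : MvPolynomial (Fin n ⊕ Fin n) (FractionRing k) ⊗[k] A :=
    ofCoords e fun i => MvPolynomial.X (Sum.inl i)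
  let y : MvPolynomial (Fin n ⊕ Fin n) (FractionRing k) ⊗[k] A :=
    ofCoords e fun i => MvPolynomial.X (Sum.inr i)
  have hevx (D : MvPolynomial (Fin n) k) : evalAt e D x =
      MvPolynomial.rename Sum.inl (MvPolynomial.map (algebraMap k (FractionRing k)) D) := by
    rw [evalAt, coords_ofCoords, MvPolynomial.map_algebraMap_rename]
  have hevy (D : MvPolynomial (Fin n) k) : evalAt e D y =
      MvPolynomial.rename Sum.inr (MvPolynomial.map (algebraMap k (FractionRing k)) D) := by
    rw [evalAt, coords_ofCoords, MvPolynomial.map_algebraMap_rename]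
  let o : Fin n → FractionRing k := fun i => algebraMap k (FractionRing k) (e.repr 1 i)
  let ρ₁ : MvPolynomial (Fin n ⊕ Fin n) (FractionRing k) →ₐ[k]
      MvPolynomial (Fin n) (FractionRing k) :=
    (MvPolynomial.aeval (Sum.elim MvPolynomial.X
      fun i => MvPolynomial.C (o i))).restrictScalars k
  let ρ₂ : MvPolynomial (Fin n ⊕ Fin n) (FractionRing k) →ₐ[k]
      MvPolynomial (Fin n) (FractionRing k) :=
    (MvPolynomial.aeval (Sum.elim (fun i => MvPolynomial.C (o i))
      MvPolynomial.X)).restrictScalars k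
  have hone : ofCoords e (fun i => MvPolynomial.C (o i)) =
      (1 : MvPolynomial (Fin n) (FractionRing k) ⊗[k] A) := by
    apply coords_injective e
    rw [coords_ofCoords, coords_one]
    ext1 i
    rw [MvPolynomial.algebraMap_apply]
  have hρ₁x : extend A ρ₁ x = ofCoords e MvPolynomial.X := by
    simp only [x, extend_ofCoords, ρ₁, AlgHom.restrictScalars_apply, MvPolynomial.aeval_X,
      Sum.elim_inl]
  have hρ₁y : extend A ρ₁ y = 1 := by
    simp only [y, extend_ofCoords, ρ₁, AlgHom.restrictScalars_apply, MvPolynomial.aeval_X,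
      Sum.elim_inr, hone]
  have hρ₂x : extend A ρ₂ x = 1 := by
    simp only [x, extend_ofCoords, ρ₂, AlgHom.restrictScalars_apply, MvPolynomial.aeval_X,
      Sum.elim_inl, hone]
  have hρ₂y : extend A ρ₂ y = ofCoords e MvPolynomial.X := by
    simp only [y, extend_ofCoords, ρ₂, AlgHom.restrictScalars_apply, MvPolynomial.aeval_X,
      Sum.elim_inr]
  have hX : evalAt e D (ofCoords e
      (MvPolynomial.X : Fin n → MvPolynomial (Fin n) (FractionRing k))) =
      MvPolynomial.map (algebraMap k (FractionRing k)) D := by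
    rw [evalAt, coords_ofCoords, ← MvPolynomial.aeval_map_algebraMap (FractionRing k),
      MvPolynomial.aeval_X_left, AlgHom.id_apply]
  have hxy : evalAt e D (x * y) = evalAt e D x * evalAt e D y := by
    rw [hevx, hevy]
    refine MvPolynomial.eq_mul_of_dvd o
      (N := MvPolynomial.map (algebraMap k (FractionRing k)) N) ?_ ?_ ?_ ?_ ?_
    · rwa [Ne, map_eq_zero_iff _
        (MvPolynomial.map_injective _ (IsFractionRing.injective k (FractionRing k)))]
    · rw [← hevx, ← hevy, ← hN, hG]
      exact ⟨evalAt e G (x * y), by simp [evalAt]⟩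
    · rw [MvPolynomial.aeval_map_algebraMap]
      exact (MvPolynomial.aeval_algebraMap_apply (FractionRing k) (e.repr 1) D).trans
        (by rw [h1, map_one])
    · have := evalAt_extend e D ρ₁ (x * y)
      rw [map_mul, hρ₁x, hρ₁y, mul_one, hX] at this
      exact this.symm
    · have := evalAt_extend e D ρ₂ (x * y)
      rw [map_mul, hρ₂x, hρ₂y, one_mul, hX] at this
      exact this.symm
  -- The identity descends to `k[x, y]`, which embeds in the polynomial ring over the fraction
  -- field, and then specializes to arbitrary points.
  let ν : MvPolynomial (Fin n ⊕ Fin n) k →ₐ[k] MvPolynomial (Fin n ⊕ Fin n) (FractionRing k) :=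
    MvPolynomial.mapAlgHom (Algebra.ofId k (FractionRing k))
  have hν : Function.Injective ν :=
    MvPolynomial.map_injective _ (IsFractionRing.injective k (FractionRing k))
  let x₀ : MvPolynomial (Fin n ⊕ Fin n) k ⊗[k] A := ofCoords e fun i => MvPolynomial.X (Sum.inl i)
  let y₀ : MvPolynomial (Fin n ⊕ Fin n) k ⊗[k] A := ofCoords e fun i => MvPolynomial.X (Sum.inr i)
  have hx₀ : extend A ν x₀ = x := by
    simp only [x₀, x, extend_ofCoords, ν, MvPolynomial.mapAlgHom_apply, MvPolynomial.map_X]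
  have hy₀ : extend A ν y₀ = y := by
    simp only [y₀, y, extend_ofCoords, ν, MvPolynomial.mapAlgHom_apply, MvPolynomial.map_X]
  have hxy₀ : evalAt e D (x₀ * y₀) = evalAt e D x₀ * evalAt e D y₀ := by
    apply hν
    rw [← evalAt_extend, map_mul, map_mul, ← evalAt_extend, ← evalAt_extend, hx₀, hy₀, hxy]
  let θ : MvPolynomial (Fin n ⊕ Fin n) k →ₐ[k] C :=
    MvPolynomial.aeval (Sum.elim (coords e a) (coords e b))
  have hθx : extend A θ x₀ = a := by
    simp only [x₀, extend_ofCoords, θ, MvPolynomial.aeval_X, Sum.elim_inl]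
    exact ofCoords_coords e a
  have hθy : extend A θ y₀ = b := by
    simp only [y₀, extend_ofCoords, θ, MvPolynomial.aeval_X, Sum.elim_inr]
    exact ofCoords_coords e b
  have := congrArg θ hxy₀
  rwa [map_mul, ← evalAt_extend, ← evalAt_extend, ← evalAt_extend, map_mul, hθx, hθy] at this

lemma evalAt_normAt_generic (a : C ⊗[k] A) :
    evalAt e (normAt e (generic e)) a = normAt e a := by
  rw [evalAt, ← normAt_extend, extend_generic]

/-- Existence of the generic norm of an algebra over a normal domain. -/
theorem exists_genericNorm [IsDomain k] [IsIntegrallyClosed k] {d : ℕ}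
    (hind : LinearIndependent (MvPolynomial (Fin n) k) fun i : Fin d => generic e ^ (i : ℕ))
    (hdep : ¬ LinearIndependent (MvPolynomial (Fin n) k)
      fun i : Fin (d + 1) => generic e ^ (i : ℕ)) :
    ∃ D : MvPolynomial (Fin n) k, D.IsHomogeneous d ∧ MvPolynomial.aeval (e.repr 1) D = 1 ∧
      (∀ (C : Type*) [CommRing C] [Algebra k C] (a b : C ⊗[k] A),
        evalAt e D (a * b) = evalAt e D a * evalAt e D b) ∧
      aeval (generic e) (charpolyAt e D (generic e)) = 0 := by
  obtain ⟨p, hp, hd, h⟩ := exists_monic e hind hdep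
  -- The sign makes `D(X - ξ)` equal to `p`, hence `D(1) = 1`.
  let D : MvPolynomial (Fin n) k := (-1) ^ d * p.coeff 0
  have hcoeff : (p.coeff 0).IsHomogeneous d :=
    MvPolynomial.isHomogeneous_of_aeval_X_mul (map_constantCoeff_of_scaling e hind hp hd h)
  have hD : D.IsHomogeneous d := by
    have := (MvPolynomial.isHomogeneous_C (Fin n) ((-1 : k) ^ d)).mul hcoeff
    simpa [D] using this
  have hchar : charpolyAt e D (generic e) = p := by
    have := map_constantCoeff_of_shift e hind hp hd h
    rw [charpolyAt, evalAt] at this ⊢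
    simp only [D, map_mul, map_pow, map_neg, map_one]
    rw [this, ← mul_assoc, ← mul_pow]
    simp
  have h1 : MvPolynomial.aeval (e.repr 1) D = 1 := by
    have := (MvPolynomial.natDegree_aeval_linear_of_isHomogeneous hD
      (coords e (1 : MvPolynomial (Fin n) k ⊗[k] A)) (fun i => -coords e (generic e) i)).2
    rw [← charpolyAt_eq, hchar, ← hd, hp.coeff_natDegree, ← evalAt, evalAt_one] at this
    refine (MvPolynomial.C_injective (Fin n) k) ?_
    rw [MvPolynomial.C_1]; exact this.symm
  let N : MvPolynomial (Fin n) k := normAt e (generic e)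
  have hN1 : N ≠ 0 := fun h0 => by
    have := evalAt_normAt_generic e (1 : k ⊗[k] A)
    rw [normAt_one, show normAt e (generic e) = 0 from h0, evalAt, map_zero] at this
    exact zero_ne_one this
  have hdvd : D ∣ N := by
    let χ := (Algebra.leftMulMatrix (Algebra.TensorProduct.basis (MvPolynomial (Fin n) k) e) (generic e)).charpoly
    -- The remainder has degree less than `d` and annihilates `ξ`, so it vanishes by independence.
    -- Comparing constant terms in `p ∣ χ` then gives the divisibility of norms.
    have h0 : χ %ₘ p = 0 := by
      refine eq_zero_of_aeval_eq_zero hind ?_ ?_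
      · rw [← hd, ← degree_eq_natDegree hp.ne_zero]; exact degree_modByMonic_lt _ hp
      · have := congrArg (aeval (generic e)) (modByMonic_add_div χ p)
        rw [map_add, map_mul, h, zero_mul, add_zero] at this
        rw [this]; exact aeval_charpoly_leftMulMatrix e _
    obtain ⟨q, hq⟩ := (modByMonic_eq_zero_iff_dvd hp).mp h0
    have h2 := congrArg (fun q => q.coeff 0) hq
    simp only [mul_coeff_zero] at h2
    have h3 : N = (-1) ^ Fintype.card (Fin n) * χ.coeff 0 := Matrix.det_eq_sign_charpoly_coeff _
    rw [h3, h2]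
    refine dvd_mul_of_dvd_right (dvd_mul_of_dvd_left ?_ _) _
    exact ⟨(-1) ^ d, by simp only [D]; rw [mul_right_comm, ← mul_pow]; simp⟩
  refine ⟨D, hD, h1, fun C _ _ a b => ?_, by rw [hchar, h]⟩
  exact evalAt_mul_of_dvd e (fun a b => by
    simp only [N, evalAt_normAt_generic, normAt_mul]) hN1 hdvd h1 a b

end GenericElement


/-! ### Frames, and points as a base change of an algebra -/

namespace GaAlgebraScheme

open TensorProduct Module GenericElement

variable {S : Scheme.{u}} (A : GaAlgebraScheme S)

/-- The ring homomorphism induced by a morphism of `S`-schemes on global functions. -/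
abbrev pull {T' T : Over S} (φ : T' ⟶ T) : Γ(T.left, ⊤) →+* Γ(T'.left, ⊤) := φ.left.appTop.hom

lemma pull_comp {T'' T' T : Over S} (ψ : T'' ⟶ T') (φ : T' ⟶ T) (c : Γ(T.left, ⊤)) :
    pull (ψ ≫ φ) c = pull ψ (pull φ c) := by
  rw [pull, Over.comp_left, Scheme.Hom.comp_appTop]
  rfl

lemma pull_id {T : Over S} (c : Γ(T.left, ⊤)) : pull (𝟙 T) c = c := by simp [pull]

/-- The restriction of points of `A` along a morphism of `S`-schemes. -/
def res {T' T : Over S} (φ : T' ⟶ T) : (T ⟶ A.X) →+* (T' ⟶ A.X) :=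
  RingHom.mk' ⟨⟨fun a => φ ≫ a, A.comp_one φ⟩, A.comp_mul φ⟩ (A.comp_add φ)

variable {A}

lemma comp_smul' {T' T : Over S} (φ : T' ⟶ T) (c : Γ(T.left, ⊤)) (a : T ⟶ A.X) :
    φ ≫ (c • a) = pull φ c • (φ ≫ a) := A.comp_smul φ c a

lemma comp_zero {T' T : Over S} (φ : T' ⟶ T) : φ ≫ (0 : T ⟶ A.X) = 0 := map_zero (A.res φ)

lemma comp_sub {T' T : Over S} (φ : T' ⟶ T) (a b : T ⟶ A.X) :
    φ ≫ (a - b) = φ ≫ a - φ ≫ b := map_sub (A.res φ) a b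

lemma comp_pow {T' T : Over S} (φ : T' ⟶ T) (a : T ⟶ A.X) (m : ℕ) :
    φ ≫ (a ^ m) = (φ ≫ a) ^ m := map_pow (A.res φ) a m

lemma comp_sum {T' T : Over S} (φ : T' ⟶ T) {ι : Type*} (s : Finset ι) (a : ι → (T ⟶ A.X)) :
    φ ≫ (∑ i ∈ s, a i) = ∑ i ∈ s, φ ≫ a i := map_sum (A.res φ) a s

lemma ιMulti_comp {T' T : Over S} (φ : T' ⟶ T) {m : ℕ} {v : Fin m → (T ⟶ A.X)}
    (h : exteriorPower.ιMulti Γ(T.left, ⊤) m v = 0) :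
    exteriorPower.ιMulti Γ(T'.left, ⊤) m (fun i => φ ≫ v i) = 0 :=
  ιMulti_eq_zero_of_semilinear (pull φ) (A.res φ).toAddMonoidHom
    (fun c a => A.comp_smul φ c a) h

variable (A) in
/-- A frame of `A` over `T₀`: compatible bases of the modules of points of `A` with values in
schemes over `T₀`. -/
structure Frame (n : ℕ) (T₀ : Over S) where
  /-- the basis over a scheme over `T₀` -/
  basis : ∀ {T : Over S} (_ : T ⟶ T₀), Basis (Fin n) Γ(T.left, ⊤) (T ⟶ A.X)
  comp_basis : ∀ {T' T : Over S} (φ : T' ⟶ T) (g : T ⟶ T₀) (i : Fin n),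
    φ ≫ basis g i = basis (φ ≫ g) i

namespace Frame

variable {n : ℕ} {T₀ : Over S}

lemma exists_of_sections (e : Fin n → (T₀ ⟶ A.X))
    (he : ∀ (T : Over S) (g : T ⟶ T₀),
      ∃ b : Basis (Fin n) Γ(T.left, ⊤) (T ⟶ A.X), ∀ i, b i = g ≫ e i) :
    Nonempty (Frame A n T₀) := by
  choose b hb using he
  exact ⟨⟨fun {T} g => b T g, fun φ g i => by rw [hb, hb, Category.assoc]⟩⟩

/-- The restriction of a frame. -/
def restrict (F : Frame A n T₀) {T₁ : Over S} (h : T₁ ⟶ T₀) : Frame A n T₁ where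
  basis g := F.basis (g ≫ h)
  comp_basis φ g i := by rw [F.comp_basis, Category.assoc]

variable (F : Frame A n T₀)

/-- Restriction is semilinear and carries the basis to the basis, so coordinates restrict to
coordinates. -/
lemma repr_comp {T' T : Over S} (φ : T' ⟶ T) (g : T ⟶ T₀) (a : T ⟶ A.X) (i : Fin n) :
    (F.basis (φ ≫ g)).repr (φ ≫ a) i = pull φ ((F.basis g).repr a i) := by
  have h : φ ≫ a = ∑ j, pull φ ((F.basis g).repr a j) • F.basis (φ ≫ g) j := by
    conv_lhs => rw [← (F.basis g).sum_repr a]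
    simp only [comp_sum, comp_smul', F.comp_basis]
  rw [h, Basis.repr_sum_self]

/-- The value at `a` of the polynomial function `D` in the coordinates. -/
def eval {T : Over S} (g : T ⟶ T₀) (D : MvPolynomial (Fin n) Γ(T₀.left, ⊤)) (a : T ⟶ A.X) :
    Γ(T.left, ⊤) :=
  MvPolynomial.eval₂ (pull g) ((F.basis g).repr a) D

lemma eval_comp {T' T : Over S} (φ : T' ⟶ T) (g : T ⟶ T₀)
    (D : MvPolynomial (Fin n) Γ(T₀.left, ⊤)) (a : T ⟶ A.X) :
    F.eval (φ ≫ g) D (φ ≫ a) = pull φ (F.eval g D a) := by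
  have h1 : pull (φ ≫ g) = (pull φ).comp (pull g) := RingHom.ext fun c => pull_comp φ g c
  have h2 : ⇑((F.basis (φ ≫ g)).repr (φ ≫ a)) = pull φ ∘ ((F.basis g).repr a) :=
    funext fun i => F.repr_comp φ g a i
  rw [eval, eval, h1, h2, MvPolynomial.eval₂_comp_left]

/-- The global functions on `T`, as an algebra over the global functions on `T₀`. -/
def Sec {T : Over S} (_ : T ⟶ T₀) : Type u := Γ(T.left, ⊤)

instance {T : Over S} (g : T ⟶ T₀) : CommRing (Sec g) := inferInstanceAs (CommRing Γ(T.left, ⊤))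

instance {T : Over S} (g : T ⟶ T₀) : Algebra Γ(T₀.left, ⊤) (Sec g) := (pull g).toAlgebra

instance {T : Over S} (g : T ⟶ T₀) : Algebra (Sec g) (T ⟶ A.X) := A.algebra T

/-- The basis of the algebra of points over `T₀`. -/
abbrev basis₀ : Basis (Fin n) Γ(T₀.left, ⊤) (T₀ ⟶ A.X) := F.basis (𝟙 T₀)

/-- The comparison of the base change of the algebra of points over `T₀` with the points
over `T`. -/
def compare {T : Over S} (g : T ⟶ T₀) : Sec g ⊗[Γ(T₀.left, ⊤)] (T₀ ⟶ A.X) →ₐ[Sec g] (T ⟶ A.X) :=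
  letI : Algebra Γ(T₀.left, ⊤) (T ⟶ A.X) := Algebra.compHom _ (algebraMap Γ(T₀.left, ⊤) (Sec g))
  haveI : IsScalarTower Γ(T₀.left, ⊤) (Sec g) (T ⟶ A.X) := IsScalarTower.of_algebraMap_eq' rfl
  Algebra.TensorProduct.lift (Algebra.ofId (Sec g) (T ⟶ A.X))
    { A.res g with
      commutes' := fun c => by
        have h := A.comp_smul g c 1
        rw [A.comp_one, ← Algebra.algebraMap_eq_smul_one] at h
        exact h.trans (Algebra.algebraMap_eq_smul_one (A := (T ⟶ A.X)) (pull g c)).symm }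
    fun x y => Algebra.commutes x _

lemma compare_tmul {T : Over S} (g : T ⟶ T₀) (c : Sec g) (a : T₀ ⟶ A.X) :
    compare g (c ⊗ₜ a) = c • (g ≫ a) := by
  let : Algebra Γ(T₀.left, ⊤) (T ⟶ A.X) := Algebra.compHom _ (algebraMap Γ(T₀.left, ⊤) (Sec g))
  have : IsScalarTower Γ(T₀.left, ⊤) (Sec g) (T ⟶ A.X) := IsScalarTower.of_algebraMap_eq' rfl
  exact (Algebra.TensorProduct.lift_tmul _ _ _ _ _).trans (Algebra.smul_def c _).symm

lemma repr_compare {T : Over S} (g : T ⟶ T₀) (a : Sec g ⊗[Γ(T₀.left, ⊤)] (T₀ ⟶ A.X))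
    (i : Fin n) : (F.basis g).repr (compare g a) i = coords F.basis₀ a i := by
  induction a with
  | zero => rw [map_zero, map_zero, coords, map_zero]; rfl
  | add x y hx hy => rw [map_add, map_add, coords_add, Finsupp.add_apply, hx, hy, Pi.add_apply]; rfl
  | tmul c a =>
    rw [compare_tmul, coords_tmul]
    have h := F.repr_comp g (𝟙 T₀) a i
    rw [Category.comp_id] at h
    have h2 : (F.basis g).repr (c • (g ≫ a)) = (show Γ(T.left, ⊤) from c) •
      (F.basis g).repr (g ≫ a) := map_smul (F.basis g).repr (show Γ(T.left, ⊤) from c) _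
    rw [h2, Finsupp.smul_apply, h]
    rfl

include F in
-- The comparison preserves coordinates, and on both sides a point is determined by its coordinates,
-- which can be prescribed freely.
lemma compare_bijective {T : Over S} (g : T ⟶ T₀) :
    Function.Bijective (compare (A := A) g) := by
  constructor
  · intro a b h
    apply coords_injective F.basis₀
    ext1 i
    rw [← repr_compare, h, repr_compare]
  · intro b
    refine ⟨ofCoords F.basis₀ (fun i => ((F.basis g).repr b i : Γ(T.left, ⊤))), ?_⟩
    apply (F.basis g).repr.injective
    ext i
    rw [repr_compare]
    exact congrFun (coords_ofCoords F.basis₀ (C := Sec g) _) i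

/-- The isomorphism of the base change of the algebra of points over `T₀` with the points
over `T`. -/
def compareEquiv {T : Over S} (g : T ⟶ T₀) :
    Sec g ⊗[Γ(T₀.left, ⊤)] (T₀ ⟶ A.X) ≃ₐ[Sec g] (T ⟶ A.X) :=
  AlgEquiv.ofBijective (compare g) (F.compare_bijective g)

lemma coords_compareEquiv_symm {T : Over S} (g : T ⟶ T₀) (a : T ⟶ A.X) (i : Fin n) :
    coords F.basis₀ ((F.compareEquiv g).symm a) i = (F.basis g).repr a i := by
  rw [← repr_compare]
  exact congrArg (fun b => (F.basis g).repr b i) ((F.compareEquiv g).apply_symm_apply a)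

lemma eval_eq {T : Over S} (g : T ⟶ T₀) (D : MvPolynomial (Fin n) Γ(T₀.left, ⊤)) (a : T ⟶ A.X) :
    F.eval g D a = evalAt F.basis₀ D ((F.compareEquiv g).symm a) := by
  rw [evalAt, MvPolynomial.aeval_def, eval]
  have : coords F.basis₀ ((F.compareEquiv g).symm a) = (F.basis g).repr a :=
    funext fun i => F.coords_compareEquiv_symm g a i
  rw [this]
  rfl

end Frame

section AffineBase

variable {T₀ : Over S} [IsAffine T₀.left] (C : Type u) [CommRing C] [Algebra Γ(T₀.left, ⊤) C]

variable (T₀) in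
/-- The morphism from the spectrum of an algebra over the global functions on `T₀`. -/
def specToBase : Spec (.of C) ⟶ T₀.left :=
  Spec.map (CommRingCat.ofHom (algebraMap Γ(T₀.left, ⊤) C)) ≫ T₀.left.isoSpec.inv

variable (T₀) in
/-- The spectrum of an algebra over the global functions on `T₀`. -/
abbrev specOver : Over S := Over.mk (specToBase T₀ C ≫ T₀.hom)

variable (T₀) in
/-- The structure morphism of the spectrum of an algebra. -/
abbrev specOverHom : specOver T₀ C ⟶ T₀ := Over.homMk (specToBase T₀ C)

lemma isoSpec_inv_appTop (Y : Scheme.{u}) [IsAffine Y] :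
    Y.isoSpec.inv.appTop ≫ (Scheme.ΓSpecIso Γ(Y, ⊤)).hom = 𝟙 _ := by
  rw [← Scheme.toSpecΓ_appTop, ← Scheme.Hom.comp_appTop, Scheme.toSpecΓ_isoSpec_inv,
    Scheme.Hom.id_appTop]

lemma specToBase_appTop :
    (specToBase T₀ C).appTop ≫ (Scheme.ΓSpecIso (.of C)).hom =
      CommRingCat.ofHom (algebraMap Γ(T₀.left, ⊤) C) := by
  rw [specToBase, Scheme.Hom.comp_appTop, Category.assoc, Scheme.ΓSpecIso_naturality,
    ← Category.assoc]
  erw [isoSpec_inv_appTop]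
  rw [Category.id_comp]

variable (T₀) in
/-- The functions on the spectrum of an algebra. -/
def specRing : Γ((specOver T₀ C).left, ⊤) ≃+* C :=
  (Scheme.ΓSpecIso (.of C)).commRingCatIsoToRingEquiv

lemma specRing_pull (c : Γ(T₀.left, ⊤)) :
    specRing T₀ C (pull (specOverHom T₀ C) c) = algebraMap _ C c :=
  congrArg (fun f => f.hom c) (specToBase_appTop C)

variable (T₀) in
/-- The functions on the spectrum of an algebra, as an algebra. -/
def secSpecOver : Frame.Sec (specOverHom T₀ C) ≃ₐ[Γ(T₀.left, ⊤)] C :=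
  AlgEquiv.ofRingEquiv (f := specRing T₀ C) (specRing_pull C)

variable {C} in
/-- A morphism to the spectrum of an algebra is given by a homomorphism of algebras. -/
lemma exists_hom_specOver {T : Over S} (g : T ⟶ T₀) (f : C →+* Γ(T.left, ⊤))
    (hf : ∀ c, f (algebraMap Γ(T₀.left, ⊤) C c) = pull g c) :
    ∃ h : T ⟶ specOver T₀ C, h ≫ specOverHom T₀ C = g ∧
      ∀ c : C, pull h ((specRing T₀ C).symm c) = f c := by
  let f' : CommRingCat.of C ⟶ Γ(T.left, ⊤) := CommRingCat.ofHom f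
  let h₀ : T.left ⟶ Spec (.of C) := T.left.toSpecΓ ≫ Spec.map f'
  have h₁ : h₀ ≫ specToBase T₀ C = g.left := by
    have : CommRingCat.ofHom (algebraMap Γ(T₀.left, ⊤) C) ≫ f' = g.left.appTop := by
      ext c
      exact hf c
    simp only [h₀, specToBase, Category.assoc]
    rw [← Spec.map_comp_assoc, this, ← Scheme.toSpecΓ_naturality_assoc,
      Scheme.toSpecΓ_isoSpec_inv, Category.comp_id]
  refine ⟨Over.homMk h₀ ?_, ?_, fun c => ?_⟩
  · change h₀ ≫ specToBase T₀ C ≫ T₀.hom = T.hom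
    rw [← Category.assoc, h₁, Over.w]
  · ext1
    exact h₁
  · have h₂ : (Scheme.ΓSpecIso (.of C)).inv ≫ h₀.appTop = f' := by
      rw [Iso.inv_comp_eq, Scheme.Hom.comp_appTop, Scheme.toSpecΓ_appTop,
        Scheme.ΓSpecIso_naturality]
    exact congrArg (fun f => f.hom c) h₂

end AffineBase

end GaAlgebraScheme


/-! ### Determinants as natural families of functions -/

namespace GaAlgebraScheme

open TensorProduct Module GenericElement

variable {S : Scheme.{u}} (A : GaAlgebraScheme S)

/-- A family of functions on the sets of points of `A` with values in schemes over `T₀`. -/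
abbrev Family (T₀ : Over S) := ∀ (T : Over S), (T ⟶ T₀) → (T ⟶ A.X) → Γ(T.left, ⊤)

variable {A}

section CharPoly

variable {T₀ : Over S} {R : CommRingCat.{u}} {t : Spec R ⟶ S}

variable (t) in
/-- The affine line over an affine `S`-scheme. -/
abbrev line : Over S :=
  Over.mk (Spec.map (CommRingCat.ofHom (Polynomial.C : R →+* R[X])) ≫ t)

variable (t) in
/-- The projection of the affine line. -/
abbrev lineHom : line t ⟶ Over.mk t := Over.homMk (Spec.map (CommRingCat.ofHom Polynomial.C))

variable (t) in
/-- The coordinate of the affine line. -/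
def lineCoord : Γ((line t).left, ⊤) := (Scheme.ΓSpecIso (.of R[X])).inv (Polynomial.X : R[X])

/-- The characteristic polynomial associated with a family of functions. -/
def charPolyOf (v : A.Family T₀) (g : Over.mk t ⟶ T₀) (a : Over.mk t ⟶ A.X) : R[X] :=
  (Scheme.ΓSpecIso (.of R[X])).hom
    (v (line t) (lineHom t ≫ g) (lineCoord t • 1 - lineHom t ≫ a))

variable (t) in
lemma eval₂_line (q : Γ((Over.mk t).left, ⊤)[X]) :
    (Scheme.ΓSpecIso (.of R[X])).hom (q.eval₂ (pull (lineHom t)) (lineCoord t)) =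
      q.map (Scheme.ΓSpecIso R).hom.hom := by
  have h : ((Scheme.ΓSpecIso (.of R[X])).hom.hom.comp
      (Polynomial.eval₂RingHom (pull (lineHom t)) (lineCoord t))) =
      Polynomial.mapRingHom (Scheme.ΓSpecIso R).hom.hom := by
    apply Polynomial.ringHom_ext
    · intro c
      have := congrArg (fun f => f.hom c)
        (Scheme.ΓSpecIso_naturality (CommRingCat.ofHom (Polynomial.C : R →+* R[X])))
      simp only [RingHom.comp_apply, coe_eval₂RingHom, eval₂_C, coe_mapRingHom, Polynomial.map_C]
      exact this
    · simp only [RingHom.comp_apply, coe_eval₂RingHom, eval₂_X, coe_mapRingHom, Polynomial.map_X]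
      exact congrArg (fun f => f.hom (Polynomial.X : R[X]))
        (Scheme.ΓSpecIso (.of R[X])).inv_hom_id
  exact DFunLike.congr_fun h q

variable {n : ℕ} (F : Frame A n T₀)

/-- Both polynomials are `D` at `X·1 - a`: one is computed on the affine line over `Spec R`, the
other in `Γ(Spec R)[X]`. This carries Cayley-Hamilton back and forth between schemes and algebras.
-/
lemma charPolyOf_eval (D : MvPolynomial (Fin n) Γ(T₀.left, ⊤)) (g : Over.mk t ⟶ T₀)
    (a : Over.mk t ⟶ A.X) :
    (charPolyOf (fun _ g a => F.eval g D a) g a).map (Scheme.ΓSpecIso R).inv.hom =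
      charpolyAt F.basis₀ D ((F.compareEquiv g).symm a) := by
  have h1 : (charpolyAt F.basis₀ D ((F.compareEquiv g).symm a)).eval₂
      (pull (lineHom t)) (lineCoord t) =
      F.eval (lineHom t ≫ g) D (lineCoord t • 1 - lineHom t ≫ a) := by
    rw [charpolyAt_eq, MvPolynomial.aeval_def]
    refine (MvPolynomial.eval₂_comp_left
      (Polynomial.eval₂RingHom (pull (lineHom t)) (lineCoord t)) _ _ _).trans ?_
    rw [Frame.eval]
    congr 1
    · ext c
      rw [pull_comp]
      exact Polynomial.eval₂_C _ _
    · funext i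
      have hone : coords F.basis₀
          (1 : Frame.Sec g ⊗[Γ(T₀.left, ⊤)] (T₀ ⟶ A.X)) i = (F.basis g).repr 1 i := by
        rw [← F.coords_compareEquiv_symm g 1 i, map_one]
      have h2 : (F.basis (lineHom t ≫ g)).repr 1 i = pull (lineHom t) ((F.basis g).repr 1 i) := by
        rw [← F.repr_comp, A.comp_one]
      let f (u w : Γ((Over.mk t).left, ⊤)) : Γ((line t).left, ⊤) :=
        Polynomial.eval₂ (pull (lineHom t)) (lineCoord t) (C u * Polynomial.X + C (-w))
      refine (congrArg₂ f hone (F.coords_compareEquiv_symm g a i)).trans ?_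
      rw [map_sub, map_smul, Finsupp.sub_apply, Finsupp.smul_apply, F.repr_comp, h2]
      simp only [f]
      rw [Polynomial.eval₂_add, Polynomial.eval₂_mul, Polynomial.eval₂_C, Polynomial.eval₂_C,
        Polynomial.eval₂_X, smul_eq_mul, mul_comm, sub_eq_add_neg, map_neg]
  rw [charPolyOf, ← h1]
  refine (congrArg (Polynomial.map _) (eval₂_line t _)).trans ?_
  refine (Polynomial.map_map _ _ _).trans ?_
  have : (Scheme.ΓSpecIso R).inv.hom.comp (Scheme.ΓSpecIso R).hom.hom = RingHom.id _ :=
    congrArg CommRingCat.Hom.hom (Scheme.ΓSpecIso R).hom_inv_id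
  rw [this]
  exact Polynomial.map_id

end CharPoly

/-- A family of functions with the characteristic properties of the determinant of degree `d`. -/
structure IsDetFamily {T₀ : Over S} (d : ℕ) (v : A.Family T₀) : Prop where
  natural : ∀ {T' T : Over S} (φ : T' ⟶ T) (g : T ⟶ T₀) (a : T ⟶ A.X),
    v T' (φ ≫ g) (φ ≫ a) = pull φ (v T g a)
  smul : ∀ {T : Over S} (g : T ⟶ T₀) (c : Γ(T.left, ⊤)) (a : T ⟶ A.X),
    v T g (c • a) = c ^ d * v T g a
  one : ∀ {T : Over S} (g : T ⟶ T₀), v T g 1 = 1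
  mul : ∀ {T : Over S} (g : T ⟶ T₀) (a b : T ⟶ A.X), v T g (a * b) = v T g a * v T g b
  kills : ∀ {R : CommRingCat.{u}} {t : Spec R ⟶ S} (g : Over.mk t ⟶ T₀) (a : Over.mk t ⟶ A.X),
    Polynomial.aeval (R := Γ((Over.mk t).left, ⊤)) a
      ((charPolyOf v g a).map (Scheme.ΓSpecIso R).inv.hom) = 0

lemma IsDetFamily.restrict {T₀ T₁ : Over S} {d : ℕ} {v : A.Family T₀} (hv : IsDetFamily d v)
    (h : T₁ ⟶ T₀) : IsDetFamily (A := A) (T₀ := T₁) d (fun T g a => v T (g ≫ h) a) where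
  natural φ g a := by rw [Category.assoc, hv.natural]
  smul g c a := hv.smul _ c a
  one g := hv.one _
  mul g a b := hv.mul _ a b
  kills {R t} g a := by
    have := hv.kills (g ≫ h) a
    rwa [charPolyOf, ← Category.assoc] at this

namespace Frame

variable {n : ℕ} {T₀ : Over S} (F : Frame A n T₀)

lemma eval_mul_one {T : Over S} (g : T ⟶ T₀) {D : MvPolynomial (Fin n) Γ(T₀.left, ⊤)}
    (hD : MvPolynomial.aeval (F.basis₀.repr 1) D = 1) : F.eval g D 1 = 1 := by
  rw [F.eval_eq, map_one, evalAt_one, hD, map_one]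
  rfl

/-- A generic determinant of the algebra of points over `T₀` defines a determinant. -/
lemma isDetFamily_eval {d : ℕ} {D : MvPolynomial (Fin n) Γ(T₀.left, ⊤)}
    (hD : D.IsHomogeneous d) (h1 : MvPolynomial.aeval (F.basis₀.repr 1) D = 1)
    (hmul : ∀ (C : Type u) [CommRing C] [Algebra Γ(T₀.left, ⊤) C]
      (a b : C ⊗[Γ(T₀.left, ⊤)] (T₀ ⟶ A.X)),
        evalAt F.basis₀ D (a * b) = evalAt F.basis₀ D a * evalAt F.basis₀ D b)
    (h : aeval (generic F.basis₀) (charpolyAt F.basis₀ D (generic F.basis₀)) = 0) :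
    IsDetFamily (A := A) (T₀ := T₀) d (fun _ g a => F.eval g D a) where
  natural φ g a := F.eval_comp φ g D a
  smul g c a := by
    rw [F.eval_eq, F.eval_eq]
    exact (congrArg _ (map_smul (F.compareEquiv g).symm (show Sec g from c) a)).trans
      (evalAt_smul (C := Sec g) F.basis₀ hD _ _)
  one g := F.eval_mul_one g h1
  mul g a b := by
    rw [F.eval_eq, F.eval_eq, F.eval_eq, map_mul]
    exact hmul (Sec g) _ _
  kills {R t} g a := by
    rw [charPolyOf_eval]
    have := congrArg (F.compareEquiv g)
      (aeval_charpolyAt_of_generic F.basis₀ h ((F.compareEquiv g).symm a))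
    rw [map_zero] at this
    refine Eq.trans ?_ ((Polynomial.aeval_algHom_apply (F.compareEquiv g).toAlgHom _ _).trans this)
    exact congrArg (fun b => aeval (R := Sec g) b _) ((F.compareEquiv g).apply_symm_apply a).symm

lemma aeval_repr_one {D : MvPolynomial (Fin n) Γ(T₀.left, ⊤)}
    (h : F.eval (𝟙 T₀) D 1 = 1) : MvPolynomial.aeval (F.basis₀.repr 1) D = 1 := by
  have h2 : pull (𝟙 T₀) = RingHom.id _ := RingHom.ext fun c => pull_id c
  rw [eval, h2] at h
  exact h

variable [IsAffine T₀.left]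

/-- The points of `A` with values in the spectrum of an algebra `C` over the functions
on `T₀`. -/
def specPoints (C : Type u) [CommRing C] [Algebra Γ(T₀.left, ⊤) C] :
    (specOver T₀ C ⟶ A.X) →+* C ⊗[Γ(T₀.left, ⊤)] (T₀ ⟶ A.X) :=
  (extend (T₀ ⟶ A.X) (secSpecOver T₀ C).toAlgHom).toRingHom.comp
    (F.compareEquiv (specOverHom T₀ C)).symm.toRingEquiv.toRingHom

lemma coords_specPoints {C : Type u} [CommRing C] [Algebra Γ(T₀.left, ⊤) C]
    (a : specOver T₀ C ⟶ A.X) (i : Fin n) :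
    coords F.basis₀ (F.specPoints C a) i =
      specRing T₀ C ((F.basis (specOverHom T₀ C)).repr a i) := by
  refine (coords_extend F.basis₀ (secSpecOver T₀ C).toAlgHom _ i).trans ?_
  exact congrArg (secSpecOver T₀ C) (F.coords_compareEquiv_symm _ a i)

lemma ιMulti_specPoints {C : Type u} [CommRing C] [Algebra Γ(T₀.left, ⊤) C] {m : ℕ}
    (v : Fin m → (specOver T₀ C ⟶ A.X)) :
    exteriorPower.ιMulti C m (fun i => F.specPoints C (v i)) = 0 ↔
      exteriorPower.ιMulti Γ((specOver T₀ C).left, ⊤) m v = 0 := by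
  have h (i j) : (Algebra.TensorProduct.basis C F.basis₀).repr (F.specPoints C (v i)) j =
      (specRing T₀ C).toRingHom
        ((F.basis (specOverHom T₀ C)).repr (v i) j) := F.coords_specPoints (v i) j
  constructor
  · exact ιMulti_eq_zero_of_repr_injective (φ := (specRing T₀ C).toRingHom)
      (specRing T₀ C).injective _ _ h
  · exact ιMulti_eq_zero_of_repr _ _ _ h

lemma specRing_eval {C : Type u} [CommRing C] [Algebra Γ(T₀.left, ⊤) C]
    (D : MvPolynomial (Fin n) Γ(T₀.left, ⊤)) (a : specOver T₀ C ⟶ A.X) :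
    specRing T₀ C (F.eval (specOverHom T₀ C) D a) =
      evalAt F.basis₀ D (F.specPoints C a) := by
  rw [F.eval_eq]
  exact (evalAt_extend F.basis₀ D (secSpecOver T₀ C).toAlgHom _).symm

/-- The point with values in the spectrum of `C` with the given coordinates. -/
def specPoint {C : Type u} [CommRing C] [Algebra Γ(T₀.left, ⊤) C] (c : Fin n → C) :
    specOver T₀ C ⟶ A.X :=
  (F.basis (specOverHom T₀ C)).equivFun.symm fun i => (specRing T₀ C).symm (c i)

lemma repr_specPoint {C : Type u} [CommRing C] [Algebra Γ(T₀.left, ⊤) C] (c : Fin n → C)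
    (i : Fin n) : (F.basis (specOverHom T₀ C)).repr (F.specPoint c) i =
      (specRing T₀ C).symm (c i) := by
  rw [← Basis.equivFun_apply, specPoint, LinearEquiv.apply_symm_apply]

lemma smul_specPoint {C : Type u} [CommRing C] [Algebra Γ(T₀.left, ⊤) C] (x : C)
    (c : Fin n → C) : (specRing T₀ C).symm x • F.specPoint c = F.specPoint (x • c) := by
  apply (F.basis (specOverHom T₀ C)).repr.injective
  ext i
  rw [repr_specPoint, map_smul, Finsupp.smul_apply, repr_specPoint, Pi.smul_apply, smul_eq_mul,
    smul_eq_mul, map_mul]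

lemma specPoints_specPoint {C : Type u} [CommRing C] [Algebra Γ(T₀.left, ⊤) C]
    (c : Fin n → C) : F.specPoints C (F.specPoint c) = ofCoords F.basis₀ c := by
  apply coords_injective F.basis₀
  ext1 i
  rw [coords_specPoints, repr_specPoint, coords_ofCoords, RingEquiv.apply_symm_apply]

lemma specRing_eval_specPoint {C : Type u} [CommRing C] [Algebra Γ(T₀.left, ⊤) C]
    (D : MvPolynomial (Fin n) Γ(T₀.left, ⊤)) (c : Fin n → C) :
    specRing T₀ C (F.eval (specOverHom T₀ C) D (F.specPoint c)) = MvPolynomial.aeval c D := by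
  rw [specRing_eval, specPoints_specPoint, evalAt, coords_ofCoords]

variable (n T₀) in
/-- The affine space over `T₀`. -/
def _root_.GaAlgebraScheme.genericOver : Over S := specOver T₀ (MvPolynomial (Fin n) Γ(T₀.left, ⊤))

variable (n T₀) in
/-- The projection of the affine space over `T₀`. -/
def _root_.GaAlgebraScheme.genericHom : genericOver n T₀ ⟶ T₀ := specOverHom T₀ _

variable (n T₀) in
/-- The functions on the affine space over `T₀`. -/
def _root_.GaAlgebraScheme.genericRing :
    Γ((genericOver n T₀).left, ⊤) ≃+* MvPolynomial (Fin n) Γ(T₀.left, ⊤) :=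
  specRing T₀ (MvPolynomial (Fin n) Γ(T₀.left, ⊤))

/-- The generic point. -/
def genericPoint : genericOver n T₀ ⟶ A.X :=
  F.specPoint (C := MvPolynomial (Fin n) Γ(T₀.left, ⊤)) MvPolynomial.X

lemma specPoints_genericPoint :
    F.specPoints (MvPolynomial (Fin n) Γ(T₀.left, ⊤)) F.genericPoint = generic F.basis₀ :=
  F.specPoints_specPoint _

lemma repr_genericPoint (i : Fin n) : (F.basis (genericHom n T₀)).repr F.genericPoint i =
    (genericRing n T₀).symm (MvPolynomial.X i) :=
  F.repr_specPoint (C := MvPolynomial (Fin n) Γ(T₀.left, ⊤)) _ i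

lemma genericRing_eval (D : MvPolynomial (Fin n) Γ(T₀.left, ⊤)) :
    genericRing n T₀ (F.eval (genericHom n T₀) D F.genericPoint) = D :=
  (F.specRing_eval_specPoint (C := MvPolynomial (Fin n) Γ(T₀.left, ⊤)) D _).trans
    (MvPolynomial.aeval_X_left_apply D)

/-- Every point is a specialization of the generic point. -/
lemma exists_comp_genericPoint {T : Over S} (g : T ⟶ T₀) (a : T ⟶ A.X) :
    ∃ h : T ⟶ genericOver n T₀, h ≫ genericHom n T₀ = g ∧ h ≫ F.genericPoint = a ∧
      ∀ D, pull h ((genericRing n T₀).symm D) = F.eval g D a := by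
  obtain ⟨h, hg, hf⟩ : ∃ h : T ⟶ genericOver n T₀, h ≫ genericHom n T₀ = g ∧
      ∀ D, pull h ((genericRing n T₀).symm D) = F.eval g D a :=
    exists_hom_specOver (C := MvPolynomial (Fin n) Γ(T₀.left, ⊤)) g
      (MvPolynomial.eval₂Hom (pull g) (fun i => (F.basis g).repr a i))
      (fun c => MvPolynomial.eval₂_C _ _ _)
  refine ⟨h, hg, ?_, hf⟩
  subst hg
  apply (F.basis (h ≫ genericHom n T₀)).repr.injective
  ext i
  rw [F.repr_comp, repr_genericPoint, hf]
  exact MvPolynomial.eval₂_X _ _ i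

/-- Yoneda: over `T₀` the scheme `A` is an affine space, so a natural family is determined by its
value at the generic point, and that value is a polynomial in the coordinates. -/
lemma exists_eval_eq {v : A.Family T₀}
    (hv : ∀ {T' T : Over S} (φ : T' ⟶ T) (g : T ⟶ T₀) (a : T ⟶ A.X),
      v T' (φ ≫ g) (φ ≫ a) = pull φ (v T g a)) :
    ∃ D : MvPolynomial (Fin n) Γ(T₀.left, ⊤), v = fun _ g a => F.eval g D a := by
  refine ⟨genericRing n T₀ (v _ (genericHom n T₀) F.genericPoint), ?_⟩
  funext T g a
  obtain ⟨h, hg, ha, hD⟩ := F.exists_comp_genericPoint g a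
  rw [← hD, RingEquiv.symm_apply_apply, ← hg, ← ha]
  exact hv h _ _

lemma aeval_smul_of_eval_smul {d : ℕ} {D : MvPolynomial (Fin n) Γ(T₀.left, ⊤)}
    (h : ∀ {T : Over S} (g : T ⟶ T₀) (c : Γ(T.left, ⊤)) (a : T ⟶ A.X),
      F.eval g D (c • a) = c ^ d * F.eval g D a)
    {C : Type u} [CommRing C] [Algebra Γ(T₀.left, ⊤) C] (x : C) (c : Fin n → C) :
    MvPolynomial.aeval (x • c) D = x ^ d * MvPolynomial.aeval c D := by
  have h1 := congrArg (specRing T₀ C) (h (specOverHom T₀ C) ((specRing T₀ C).symm x)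
    (F.specPoint c))
  rwa [smul_specPoint, specRing_eval_specPoint, map_mul, map_pow, RingEquiv.apply_symm_apply,
    specRing_eval_specPoint] at h1

/-- Scaling by the variable `X` the point whose coordinates are the `xᵢ`, viewed over `P[X]`, turns
the functional equation into a polynomial identity detecting homogeneity. -/
lemma isHomogeneous_of_eval_smul {d : ℕ} {D : MvPolynomial (Fin n) Γ(T₀.left, ⊤)}
    (h : ∀ {T : Over S} (g : T ⟶ T₀) (c : Γ(T.left, ⊤)) (a : T ⟶ A.X),
      F.eval g D (c • a) = c ^ d * F.eval g D a) : D.IsHomogeneous d := by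
  apply MvPolynomial.isHomogeneous_of_aeval_X_mul
  refine (F.aeval_smul_of_eval_smul h
    (Polynomial.X : (MvPolynomial (Fin n) Γ(T₀.left, ⊤))[X])
    (fun i => Polynomial.C (MvPolynomial.X i))).trans (congrArg _ ?_)
  refine (MvPolynomial.aeval_algebraMap_apply (MvPolynomial (Fin n) Γ(T₀.left, ⊤))[X]
    (MvPolynomial.X : Fin n → MvPolynomial (Fin n) Γ(T₀.left, ⊤)) D).trans ?_
  rw [MvPolynomial.aeval_X_left]
  rfl

/-- The Cayley-Hamilton hypothesis is applied at the generic point, a point with values in an affine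
scheme, and transported to the algebra over the polynomial ring. -/
lemma aeval_generic_charpolyAt {D : MvPolynomial (Fin n) Γ(T₀.left, ⊤)}
    (h : ∀ {R : CommRingCat.{u}} {t : Spec R ⟶ S} (g : Over.mk t ⟶ T₀) (a : Over.mk t ⟶ A.X),
      Polynomial.aeval (R := Γ((Over.mk t).left, ⊤)) a
        ((charPolyOf (fun _ g a => F.eval g D a) g a).map (Scheme.ΓSpecIso R).inv.hom) = 0) :
    aeval (generic F.basis₀) (charpolyAt F.basis₀ D (generic F.basis₀)) = 0 := by
  have h0 : ∀ {R : CommRingCat.{u}} {t : Spec R ⟶ S} (g : Over.mk t ⟶ T₀)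
      (a : Over.mk t ⟶ A.X), Polynomial.aeval (R := Sec g) a
        (charpolyAt F.basis₀ D ((F.compareEquiv g).symm a)) = 0 := fun g a =>
    (congrArg (Polynomial.aeval (R := Sec g) a) (charPolyOf_eval F D g a).symm).trans (h g a)
  have h1 := h0 (R := .of (MvPolynomial (Fin n) Γ(T₀.left, ⊤))) (specOverHom T₀ _)
    (F.specPoint (C := MvPolynomial (Fin n) Γ(T₀.left, ⊤)) MvPolynomial.X)
  have h2 := congrArg (F.compareEquiv (specOverHom T₀ _)).symm h1
  rw [map_zero] at h2
  have h3 := congrArg (extend (T₀ ⟶ A.X) (secSpecOver T₀ _).toAlgHom)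
    ((Polynomial.aeval_algHom_apply
      (F.compareEquiv (specOverHom T₀ _)).symm.toAlgHom (F.specPoint (C := MvPolynomial (Fin n) Γ(T₀.left, ⊤)) MvPolynomial.X) _).trans h2)
  rw [map_zero, ← aeval_extend] at h3
  have h4 := charpolyAt_extend F.basis₀ D (secSpecOver T₀ _).toAlgHom
    ((F.compareEquiv (specOverHom T₀ _)).symm (F.specPoint (C := MvPolynomial (Fin n) Γ(T₀.left, ⊤)) MvPolynomial.X))
  rw [← specPoints_genericPoint]
  refine Eq.trans ?_ h3
  exact congrArg _ h4

/-- Reduces uniqueness of a determinant family to uniqueness of the polynomial `D`; these are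
exactly the properties required by `unique_of_aeval_charpolyAt`. -/
lemma _root_.GaAlgebraScheme.IsDetFamily.exists_generic {d : ℕ} {v : A.Family T₀}
    (hv : IsDetFamily d v) :
    ∃ D : MvPolynomial (Fin n) Γ(T₀.left, ⊤), v = (fun _ g a => F.eval g D a) ∧
      D.IsHomogeneous d ∧ MvPolynomial.aeval (F.basis₀.repr 1) D = 1 ∧
      aeval (generic F.basis₀) (charpolyAt F.basis₀ D (generic F.basis₀)) = 0 := by
  obtain ⟨D, rfl⟩ := F.exists_eval_eq hv.natural
  exact ⟨D, rfl, F.isHomogeneous_of_eval_smul hv.smul, F.aeval_repr_one (hv.one _),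
    F.aeval_generic_charpolyAt hv.kills⟩

/-- The powers of the generic point of exponent less than `d` are linearly independent. -/
abbrev IsIndependent (d : ℕ) : Prop :=
  LinearIndependent (MvPolynomial (Fin n) Γ(T₀.left, ⊤))
    fun i : Fin d => generic F.basis₀ ^ (i : ℕ)

lemma linearIndependent_specPoints_iff {C : Type u} [CommRing C] [IsDomain C]
    [Algebra Γ(T₀.left, ⊤) C] {d : ℕ} (a : specOver T₀ C ⟶ A.X) :
    LinearIndependent C (fun i : Fin d => F.specPoints C a ^ (i : ℕ)) ↔
      exteriorPower.ιMulti Γ((specOver T₀ C).left, ⊤) d (fun i : Fin d => a ^ (i : ℕ)) ≠ 0 := by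
  have h (i : Fin d) : F.specPoints C a ^ (i : ℕ) = F.specPoints C (a ^ (i : ℕ)) :=
    (map_pow _ _ _).symm
  simp only [h]
  exact (linearIndependent_iff_ιMulti_ne_zero (Algebra.TensorProduct.basis C F.basis₀)).trans
    (not_congr (F.ιMulti_specPoints fun i : Fin d => a ^ (i : ℕ)))

lemma isIndependent_iff [IsDomain Γ(T₀.left, ⊤)] {d : ℕ} : F.IsIndependent d ↔
    exteriorPower.ιMulti Γ((genericOver n T₀).left, ⊤) d
      (fun i : Fin d => F.genericPoint ^ (i : ℕ)) ≠ 0 := by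
  exact (Iff.of_eq (congrArg (fun x => LinearIndependent _ fun i : Fin d => x ^ (i : ℕ))
    F.specPoints_genericPoint.symm)).trans (F.linearIndependent_specPoints_iff F.genericPoint)

/-- Uniqueness of the determinant over an affine base with a frame. -/
lemma _root_.GaAlgebraScheme.IsDetFamily.unique [IsDomain Γ(T₀.left, ⊤)] {d : ℕ}
    (hind : F.IsIndependent d) {v v' : A.Family T₀}
    (hv : IsDetFamily d v) (hv' : IsDetFamily d v') : v = v' := by
  obtain ⟨D, rfl, hD⟩ := hv.exists_generic F
  obtain ⟨D', rfl, hD'⟩ := hv'.exists_generic F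
  rw [unique_of_aeval_charpolyAt F.basis₀ hind hD.1 hD'.1 hD.2.1 hD'.2.1 hD.2.2 hD'.2.2]

instance _root_.GaAlgebraScheme.isAffine_genericOver : IsAffine (genericOver n T₀).left :=
  inferInstanceAs (IsAffine (Spec (.of (MvPolynomial (Fin n) Γ(T₀.left, ⊤)))))

lemma not_isIndependent_of_degreeLE [IsDomain Γ(T₀.left, ⊤)] {d : ℕ} (hd : A.DegreeLE d) :
    ¬ F.IsIndependent (d + 1) := fun h =>
  F.isIndependent_iff.mp h (hd _ inferInstance _)

/-- Existence of the determinant over a normal affine base with a frame. -/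
lemma exists_isDetFamily [IsDomain Γ(T₀.left, ⊤)] [IsIntegrallyClosed Γ(T₀.left, ⊤)] {d : ℕ}
    (hd : A.DegreeLE d)
    (hind : F.IsIndependent d) :
    ∃ v : A.Family T₀, IsDetFamily d v := by
  obtain ⟨D, hD, h1, hmul, h⟩ :=
    exists_genericNorm F.basis₀ hind (F.not_isIndependent_of_degreeLE hd)
  exact ⟨_, F.isDetFamily_eval hD h1 hmul h⟩

end Frame

end GaAlgebraScheme


/-! ### Locality, gluing and open subschemes -/

namespace GaAlgebraScheme

variable {S : Scheme.{u}}

section Locality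

/-- Morphisms of `S`-schemes which agree locally on the source agree. -/
lemma hom_ext_locally {T X : Over S} {a b : T ⟶ X}
    (H : ∀ x : T.left, ∃ (T' : Over S) (φ : T' ⟶ T), IsOpenImmersion φ.left ∧
      x ∈ Set.range φ.left ∧ φ ≫ a = φ ≫ b) : a = b := by
  choose T' φ hφ hx h using H
  ext1
  let 𝒰 : T.left.OpenCover := {
    I₀ := T.left, X x := (T' x).left, f x := (φ x).left
    mem₀ := by
      rw [Scheme.presieve₀_mem_precoverage_iff]
      exact ⟨fun x => ⟨x, hx x⟩, hφ⟩ }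
  exact Scheme.Cover.hom_ext 𝒰 _ _ fun x => congrArg (·.left) (h x)

/-- Compatible morphisms of `S`-schemes glue. -/
lemma exists_hom_glue {T X : Over S} {ι : Type*} {T' : ι → Over S} (φ : ∀ i, T' i ⟶ T)
    (hφ : ∀ i, IsOpenImmersion (φ i).left) (hcov : ∀ x : T.left, ∃ i, x ∈ Set.range (φ i).left)
    (a : ∀ i, T' i ⟶ X)
    (ha : ∀ (i j) (Z : Over S) (α : Z ⟶ T' i) (β : Z ⟶ T' j),
      α ≫ φ i = β ≫ φ j → α ≫ a i = β ≫ a j) :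
    ∃ b : T ⟶ X, ∀ i, φ i ≫ b = a i := by
  let 𝒰 : T.left.OpenCover := {
    I₀ := ι, X i := (T' i).left, f i := (φ i).left
    mem₀ := by
      rw [Scheme.presieve₀_mem_precoverage_iff]
      exact ⟨hcov, hφ⟩ }
  have hglue (i j) : Limits.pullback.fst (𝒰.f i) (𝒰.f j) ≫ (a i).left =
      Limits.pullback.snd (𝒰.f i) (𝒰.f j) ≫ (a j).left := by
    let Z : Over S := Over.mk (Limits.pullback.fst (𝒰.f i) (𝒰.f j) ≫ (T' i).hom)
    let α : Z ⟶ T' i := Over.homMk (Limits.pullback.fst (𝒰.f i) (𝒰.f j))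
    let β : Z ⟶ T' j := Over.homMk (Limits.pullback.snd (𝒰.f i) (𝒰.f j)) (by
      change _ = Limits.pullback.fst (𝒰.f i) (𝒰.f j) ≫ (T' i).hom
      rw [← Over.w (φ i), ← Over.w (φ j), ← Category.assoc, ← Category.assoc,
        Limits.pullback.condition])
    refine congrArg (·.left) (ha i j Z α β ?_)
    ext1
    exact Limits.pullback.condition
  have hb (i) : (φ i).left ≫ 𝒰.glueMorphisms (fun i => (a i).left) hglue = (a i).left :=
    Scheme.Cover.ι_glueMorphisms 𝒰 _ _ i
  refine ⟨Over.homMk (𝒰.glueMorphisms (fun i => (a i).left) hglue) ?_, fun i => ?_⟩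
  · apply Scheme.Cover.hom_ext 𝒰
    intro i
    rw [← Category.assoc]
    exact (congrArg (· ≫ X.hom) (hb i)).trans ((Over.w (a i)).trans (Over.w (φ i)).symm)
  · ext1
    exact hb i

variable (S) in
/-- The affine line over `S`. -/
abbrev affineLine : Over S := Over.mk (AffineSpace PUnit.{u + 1} S ↘ S)

/-- Functions as morphisms to the affine line. -/
def toAffineLine {T : Over S} (c : Γ(T.left, ⊤)) : T ⟶ affineLine S :=
  Over.homMk (AffineSpace.homOfVector T.hom fun _ => c) (AffineSpace.homOfVector_over _ _)

lemma comp_toAffineLine {T' T : Over S} (φ : T' ⟶ T) (c : Γ(T.left, ⊤)) :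
    φ ≫ toAffineLine c = toAffineLine (pull φ c) := by
  ext1
  refine (AffineSpace.comp_homOfVector _ _ _).trans ?_
  rw [Over.w]
  rfl

/-- The function given by a morphism to the affine line. -/
def ofAffineLine {T : Over S} (a : T ⟶ affineLine S) : Γ(T.left, ⊤) :=
  pull a (AffineSpace.coord S PUnit.unit)

lemma ofAffineLine_toAffineLine {T : Over S} (c : Γ(T.left, ⊤)) :
    ofAffineLine (toAffineLine c) = c :=
  AffineSpace.homOfVector_appTop_coord _ _ _

lemma ofAffineLine_comp {T' T : Over S} (φ : T' ⟶ T) (a : T ⟶ affineLine S) :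
    ofAffineLine (φ ≫ a) = pull φ (ofAffineLine a) := pull_comp _ _ _

/-- Functions which agree locally agree. -/
lemma pull_ext_locally {T : Over S} {c c' : Γ(T.left, ⊤)}
    (H : ∀ x : T.left, ∃ (T' : Over S) (φ : T' ⟶ T), IsOpenImmersion φ.left ∧
      x ∈ Set.range φ.left ∧ pull φ c = pull φ c') : c = c' := by
  rw [← ofAffineLine_toAffineLine c, ← ofAffineLine_toAffineLine c']
  congr 1
  refine hom_ext_locally fun x => ?_
  obtain ⟨T', φ, h1, h2, h3⟩ := H x
  exact ⟨T', φ, h1, h2, by rw [comp_toAffineLine, comp_toAffineLine, h3]⟩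

/-- Compatible functions glue. -/
lemma exists_pull_glue {T : Over S} {ι : Type*} {T' : ι → Over S} (φ : ∀ i, T' i ⟶ T)
    (hφ : ∀ i, IsOpenImmersion (φ i).left) (hcov : ∀ x : T.left, ∃ i, x ∈ Set.range (φ i).left)
    (c : ∀ i, Γ((T' i).left, ⊤))
    (hc : ∀ (i j) (Z : Over S) (α : Z ⟶ T' i) (β : Z ⟶ T' j),
      α ≫ φ i = β ≫ φ j → pull α (c i) = pull β (c j)) :
    ∃ b : Γ(T.left, ⊤), ∀ i, pull (φ i) b = c i := by
  obtain ⟨b, hb⟩ := exists_hom_glue φ hφ hcov (fun i => toAffineLine (c i))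
    fun i j Z α β h => by rw [comp_toAffineLine, comp_toAffineLine, hc i j Z α β h]
  exact ⟨ofAffineLine b, fun i => by rw [← ofAffineLine_comp, hb, ofAffineLine_toAffineLine]⟩

end Locality

section Opens

/-- An open subscheme of an `S`-scheme. -/
abbrev openOver (T : Over S) (W : T.left.Opens) : Over S := Over.mk (W.ι ≫ T.hom)

/-- The inclusion of an open subscheme. -/
abbrev openHom (T : Over S) (W : T.left.Opens) : openOver T W ⟶ T := Over.homMk W.ι

lemma exists_lift {T' T₁ T : Over S} (φ : T' ⟶ T) (j : T₁ ⟶ T) [IsOpenImmersion j.left]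
    (h : Set.range φ.left ⊆ Set.range j.left) : ∃ ψ : T' ⟶ T₁, ψ ≫ j = φ := by
  refine ⟨Over.homMk (IsOpenImmersion.lift j.left φ.left h) ?_, ?_⟩
  · rw [← Over.w j, ← Category.assoc, IsOpenImmersion.lift_fac, Over.w]
  · ext1
    exact IsOpenImmersion.lift_fac _ _ _

instance (U : S.Opens) (T : Over S) : Subsingleton (T ⟶ Over.mk U.ι) :=
  ⟨fun f g => by
    ext1
    rw [← cancel_mono U.ι]
    exact (Over.w f).trans (Over.w g).symm⟩

/-- The inclusion of open subschemes of `S`. -/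
abbrev inclusion {U V : S.Opens} (h : U ≤ V) : Over.mk U.ι ⟶ Over.mk V.ι :=
  Over.homMk (S.homOfLE h)

lemma nonempty_hom_iff {U : S.Opens} {T : Over S} :
    Nonempty (T ⟶ Over.mk U.ι) ↔ T.hom ⁻¹ᵁ U = ⊤ := by
  constructor
  · rintro ⟨g⟩
    have := Over.w g
    rw [← this, Scheme.Hom.comp_preimage]
    change g.left ⁻¹ᵁ (U.ι ⁻¹ᵁ U) = ⊤
    rw [Scheme.Opens.ι_preimage_self]
    rfl
  · intro h
    refine ⟨Over.homMk (IsOpenImmersion.lift U.ι T.hom ?_) (IsOpenImmersion.lift_fac _ _ _)⟩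
    rw [Scheme.Opens.range_ι]
    rintro _ ⟨x, rfl⟩
    exact (h.ge trivial : x ∈ T.hom ⁻¹ᵁ U)

/-- Every point of an `S`-scheme has an affine open neighbourhood over a given neighbourhood of
its image. -/
lemma exists_spec_nhd (T : Over S) (x : T.left) {U : S.Opens} (hx : T.hom x ∈ U) :
    ∃ (R : CommRingCat.{u}) (t : Spec R ⟶ S) (φ : Over.mk t ⟶ T), IsOpenImmersion φ.left ∧
      x ∈ Set.range φ.left ∧ Nonempty (Over.mk t ⟶ Over.mk U.ι) := by
  obtain ⟨W, hW, hxW, hWU⟩ := T.left.isBasis_affineOpens.exists_subset_of_mem_open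
    (show x ∈ ((T.hom ⁻¹ᵁ U : T.left.Opens) : Set T.left) from hx) (T.hom ⁻¹ᵁ U).isOpen
  obtain ⟨W, hW, rfl⟩ := hW
  replace hW : IsAffineOpen W := hW
  refine ⟨_, IsAffineOpen.fromSpec hW ≫ T.hom, Over.homMk (IsAffineOpen.fromSpec hW), ?_, ?_, ?_⟩
  · exact inferInstanceAs (IsOpenImmersion (IsAffineOpen.fromSpec hW))
  · change x ∈ Set.range (IsAffineOpen.fromSpec hW)
    rw [IsAffineOpen.range_fromSpec]
    exact hxW
  · rw [nonempty_hom_iff, eq_top_iff]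
    intro y _
    have : IsAffineOpen.fromSpec hW y ∈ (W : Set T.left) := by
      rw [← IsAffineOpen.range_fromSpec hW]
      exact ⟨y, rfl⟩
    exact hWU this

lemma exists_affine_subset {V : S.Opens} {s : S} (hs : s ∈ V) :
    ∃ U : S.Opens, IsAffineOpen U ∧ s ∈ U ∧ U ≤ V := by
  obtain ⟨W, hW, hxW, hWU⟩ := S.isBasis_affineOpens.exists_subset_of_mem_open
    (show s ∈ (V : Set S) from hs) V.isOpen
  obtain ⟨W, hW, rfl⟩ := hW
  exact ⟨W, hW, hxW, hWU⟩

variable {A : GaAlgebraScheme S} {n : ℕ}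

/-- There are frames on arbitrarily small affine open subschemes of the base. -/
lemma HasDimension.exists_frame (hA : A.HasDimension n) {V : S.Opens} {s : S} (hs : s ∈ V) :
    ∃ U : S.Opens, IsAffineOpen U ∧ s ∈ U ∧ U ≤ V ∧ Nonempty (Frame A n (Over.mk U.ι)) := by
  obtain ⟨U₀, hU₀, e, he⟩ := hA s
  obtain ⟨F⟩ := Frame.exists_of_sections e he
  obtain ⟨U, hU, hsU, hUV⟩ := exists_affine_subset (show s ∈ U₀ ⊓ V from ⟨hU₀, hs⟩)
  exact ⟨U, hU, hsU, hUV.trans inf_le_right, ⟨F.restrict (inclusion (hUV.trans inf_le_left))⟩⟩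

end Opens

end GaAlgebraScheme


/-! ### Clearing denominators on basic open subschemes -/

section ExteriorPower

open Module exteriorPower

variable {R R' M : Type*} [CommRing R] [CommRing R'] [AddCommGroup M] [Module R M]

lemma ιMulti_smul {d : ℕ} (c : R) (v : Fin d → M) :
    ιMulti R d (c • v) = c ^ d • ιMulti R d v := by
  have h := (ιMulti R d (M := M)).toMultilinearMap.map_smul_univ (fun _ => c) v
  rw [Finset.prod_const, Finset.card_univ, Fintype.card_fin] at h
  exact h

/-- If, up to powers of `f`, the vectors are combinations of given ones with coefficients whose
minors vanish after inverting `f`, then a power of `f` annihilates their exterior product. -/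
lemma exists_pow_smul_ιMulti_eq_zero {d n : ℕ} {φ : R →+* R'} {f : R}
    (hφ : ∀ r, φ r = 0 → ∃ N : ℕ, f ^ N * r = 0) {v : Fin (d + 1) → M} {x : Fin n → M}
    {b : Fin (d + 1) → Fin n → R} {N : ℕ} (hb : ∀ i, f ^ N • v i = ∑ j, b i j • x j)
    (hv : ιMulti R' (d + 1) (fun i j => φ (b i j) : Fin (d + 1) → Fin n → R') = 0) :
    ∃ K : ℕ, f ^ K • ιMulti R (d + 1) v = 0 := by
  rw [ιMulti_eq_zero_iff_minors (Pi.basisFun R' (Fin n))] at hv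
  have hmin (s : Set.powersetCard (Fin n) (d + 1)) : ∃ N : ℕ, f ^ N *
      (Matrix.of fun i j => (Pi.basisFun R (Fin n)).repr (b i)
        (Set.powersetCard.ofFinEmbEquiv.symm s j)).det = 0 := by
    apply hφ
    rw [← minors_map φ (b' := Pi.basisFun R' (Fin n)) (v' := fun i j => φ (b i j))]
    · exact hv s
    · exact fun i j => rfl
  choose L hL using hmin
  let L₀ := Finset.univ.sup L
  have hb' : ιMulti R (d + 1) (f ^ L₀ • b) = 0 := by
    rw [ιMulti_eq_zero_iff_minors (Pi.basisFun R (Fin n))]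
    intro s
    have h1 : (Matrix.of fun i j => (Pi.basisFun R (Fin n)).repr ((f ^ L₀ • b) i)
        (Set.powersetCard.ofFinEmbEquiv.symm s j)) =
        f ^ L₀ • (Matrix.of fun i j => (Pi.basisFun R (Fin n)).repr (b i)
          (Set.powersetCard.ofFinEmbEquiv.symm s j)) := by
      ext i j
      simp
    -- Scaling the `d + 1` vectors by `f^L₀` multiplies every minor by `f^(L₀(d+1))`, an exponent at
    -- least `L s` since `d + 1 ≥ 1`.
    have h2 : L₀ * d + (L₀ - L s) + L s = L₀ * (d + 1) := by
      have : L s ≤ L₀ := Finset.le_sup (Finset.mem_univ s)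
      rw [mul_add]
      omega
    rw [h1, Matrix.det_smul, Fintype.card_fin, ← pow_mul, ← h2, pow_add, mul_assoc, hL, mul_zero]
  -- The vanishing product in the free module is pushed to `M` along the map sending the standard
  -- basis to `x`.
  let F : (Fin n → R) →ₗ[R] M := Fintype.linearCombination R x
  have hF : ιMulti R (d + 1) (f ^ (L₀ + N) • v) = 0 := by
    have h := congrArg (exteriorPower.map (d + 1) F) hb'
    rw [map_zero, exteriorPower.map_apply_ιMulti] at h
    rw [← h]
    congr 1
    funext i
    simp only [Function.comp_apply, Pi.smul_apply, map_smul]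
    rw [pow_add, mul_smul, hb]
    rfl
  exact ⟨_, by rw [pow_mul, ← ιMulti_smul, hF]⟩

end ExteriorPower

namespace GaAlgebraScheme

variable {S : Scheme.{u}} {A : GaAlgebraScheme S}

section BasicOpen

/-- The open subscheme of an `S`-scheme where a function is invertible. -/
abbrev basicOver (T : Over S) (f : Γ(T.left, ⊤)) : Over S := openOver T (T.left.basicOpen f)

/-- The inclusion of the open subscheme where a function is invertible. -/
abbrev basicHom (T : Over S) (f : Γ(T.left, ⊤)) : basicOver T f ⟶ T :=
  openHom T (T.left.basicOpen f)

instance (T : Over S) (W : T.left.Opens) : IsOpenImmersion (openHom T W).left :=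
  inferInstanceAs (IsOpenImmersion W.ι)

lemma exists_basicHom_lift {T' T : Over S} (φ : T' ⟶ T) (f : Γ(T.left, ⊤)) :
    ∃ ψ : basicOver T' (pull φ f) ⟶ basicOver T f,
      ψ ≫ basicHom T f = basicHom T' (pull φ f) ≫ φ := by
  apply exists_lift
  change Set.range (Scheme.Opens.ι _ ≫ φ.left) ⊆ Set.range (Scheme.Opens.ι _)
  rw [Scheme.Opens.range_ι]
  rintro _ ⟨x, rfl⟩
  have : x.1 ∈ φ.left ⁻¹ᵁ T.left.basicOpen f := by
    rw [Scheme.preimage_basicOpen_top]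
    exact x.2
  exact this

lemma exists_basicHom_factor {Z T' T : Over S} {φ : T' ⟶ T} {f : Γ(T.left, ⊤)} {α : Z ⟶ T'}
    {ψ : Z ⟶ basicOver T f} (h : ψ ≫ basicHom T f = α ≫ φ) :
    ∃ γ : Z ⟶ basicOver T' (pull φ f), γ ≫ basicHom T' (pull φ f) = α := by
  apply exists_lift
  change Set.range α.left ⊆ Set.range (Scheme.Opens.ι _)
  rw [Scheme.Opens.range_ι]
  rintro _ ⟨x, rfl⟩
  have h1 : φ.left (α.left x) = (T.left.basicOpen f).ι (ψ.left x) := by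
    rw [← Scheme.Hom.comp_apply, ← Scheme.Hom.comp_apply]
    exact congrArg (fun a : Z ⟶ T => a.left x) h.symm
  have h2 : α.left x ∈ φ.left ⁻¹ᵁ T.left.basicOpen f := by
    change φ.left (α.left x) ∈ T.left.basicOpen f
    rw [h1]
    exact (ψ.left x).2
  rwa [Scheme.preimage_basicOpen_top] at h2

lemma isOpenImmersion_basicHom_lift {T' T : Over S} {φ : T' ⟶ T} [IsOpenImmersion φ.left]
    {f : Γ(T.left, ⊤)} {ψ : basicOver T' (pull φ f) ⟶ basicOver T f}
    (h : ψ ≫ basicHom T f = basicHom T' (pull φ f) ≫ φ) : IsOpenImmersion ψ.left := by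
  have h1 : ψ.left ≫ (basicHom T f).left = (basicHom T' (pull φ f)).left ≫ φ.left :=
    congrArg (·.left) h
  have : IsOpenImmersion (ψ.left ≫ (basicHom T f).left) := by
    rw [h1]
    infer_instance
  exact IsOpenImmersion.of_comp _ (basicHom T f).left

lemma mem_range_basicHom_lift {T' T : Over S} {φ : T' ⟶ T}
    {f : Γ(T.left, ⊤)} {ψ : basicOver T' (pull φ f) ⟶ basicOver T f}
    (h : ψ ≫ basicHom T f = basicHom T' (pull φ f) ≫ φ) {z : (basicOver T f).left}
    (hz : (basicHom T f).left z ∈ Set.range φ.left) : z ∈ Set.range ψ.left := by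
  obtain ⟨w, hw⟩ := hz
  have hw' : w ∈ φ.left ⁻¹ᵁ T.left.basicOpen f := by
    change φ.left w ∈ T.left.basicOpen f
    rw [hw]
    exact z.2
  rw [Scheme.preimage_basicOpen_top] at hw'
  refine ⟨⟨w, hw'⟩, (T.left.basicOpen f).ι.isOpenEmbedding.injective ?_⟩
  refine Eq.trans ?_ hw
  exact congrArg (fun a : basicOver T' (pull φ f) ⟶ T => a.left ⟨w, hw'⟩) h

lemma openHom_injective {Z T : Over S} {W : T.left.Opens} {α β : Z ⟶ openOver T W}
    (h : α ≫ openHom T W = β ≫ openHom T W) : α = β := by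
  ext1
  rw [← cancel_mono W.ι]
  exact congrArg (·.left) h

lemma basicHom_pull (T : Over S) (f c : Γ(T.left, ⊤)) :
    (T.left.basicOpen f).topIso.hom (pull (basicHom T f) c) =
      T.left.presheaf.map (homOfLE (le_top : T.left.basicOpen f ≤ ⊤)).op c := by
  have h : (T.left.basicOpen f).ι.appTop ≫ (T.left.basicOpen f).topIso.hom =
      T.left.presheaf.map (homOfLE (le_top : T.left.basicOpen f ≤ ⊤)).op := by
    rw [Scheme.Opens.ι_appTop, Scheme.Opens.topIso_hom]
    exact (Functor.map_comp _ _ _).symm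
  exact congrArg (fun g => g.hom c) h

lemma exists_pow_mul_eq_zero (T : Over S) [IsAffine T.left] (f c : Γ(T.left, ⊤))
    (h : pull (basicHom T f) c = 0) : ∃ N : ℕ, f ^ N * c = 0 := by
  have := (isAffineOpen_top T.left).isLocalization_basicOpen f
  have h1 := basicHom_pull T f c
  rw [h, map_zero] at h1
  have h2 : algebraMap Γ(T.left, ⊤) Γ(T.left, T.left.basicOpen f) c = 0 := h1.symm
  obtain ⟨⟨_, N, rfl⟩, hN⟩ := (IsLocalization.map_eq_zero_iff (Submonoid.powers f) _ c).mp h2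
  exact ⟨N, hN⟩

lemma exists_pow_mul_eq_pull (T : Over S) [IsAffine T.left] (f : Γ(T.left, ⊤))
    (c : Γ((basicOver T f).left, ⊤)) :
    ∃ (N : ℕ) (b : Γ(T.left, ⊤)), pull (basicHom T f) b = pull (basicHom T f) f ^ N * c := by
  have := (isAffineOpen_top T.left).isLocalization_basicOpen f
  obtain ⟨⟨b, ⟨_, N, rfl⟩⟩, hN⟩ := IsLocalization.surj (Submonoid.powers f)
    ((T.left.basicOpen f).topIso.hom c)
  refine ⟨N, b, (T.left.basicOpen f).topIso.commRingCatIsoToRingEquiv.injective ?_⟩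
  have h : (T.left.basicOpen f).topIso.commRingCatIsoToRingEquiv
      (pull (basicHom T f) f ^ N * c) =
      (T.left.basicOpen f).topIso.commRingCatIsoToRingEquiv (pull (basicHom T f) f) ^ N *
        (T.left.basicOpen f).topIso.commRingCatIsoToRingEquiv c := by rw [map_mul, map_pow]
  refine (basicHom_pull T f b).trans (hN.symm.trans ((mul_comm _ _).trans (Eq.trans ?_ h.symm)))
  exact congrArg (· * _) ((map_pow _ _ _).trans (congrArg (· ^ N) (basicHom_pull T f f).symm))

variable {n : ℕ}

lemma pow_smul_eq_zero_of_le {R M : Type*} [CommRing R] [AddCommGroup M] [Module R M] {f : R}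
    {m : M} {N N' : ℕ} (h : f ^ N • m = 0) (hN : N ≤ N') : f ^ N' • m = 0 := by
  rw [← Nat.sub_add_cancel hN, pow_add, mul_smul, h, smul_zero]

lemma _root_.GaAlgebraScheme.Frame.exists_pow_smul_eq_zero {T₀ T : Over S} (F : Frame A n T₀)
    (g : T ⟶ T₀) [IsAffine T.left] (f : Γ(T.left, ⊤)) (m : T ⟶ A.X)
    (h : basicHom T f ≫ m = 0) : ∃ N : ℕ, f ^ N • m = 0 := by
  have h1 (i) : ∃ N : ℕ, f ^ N * (F.basis g).repr m i = 0 := by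
    apply exists_pow_mul_eq_zero
    rw [← F.repr_comp, h, map_zero, Finsupp.zero_apply]
  choose N hN using h1
  refine ⟨Finset.univ.sup N, (F.basis g).repr.injective ?_⟩
  ext i
  rw [map_smul, map_zero, Finsupp.smul_apply, Finsupp.zero_apply]
  exact pow_smul_eq_zero_of_le (hN i) (Finset.le_sup (Finset.mem_univ i))

lemma _root_.GaAlgebraScheme.Frame.exists_basicHom_comp_eq {T₀ T : Over S} (F : Frame A n T₀)
    (g : T ⟶ T₀) [IsAffine T.left] (f : Γ(T.left, ⊤)) (e : basicOver T f ⟶ A.X) :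
    ∃ (N : ℕ) (m : T ⟶ A.X), basicHom T f ≫ m = pull (basicHom T f) f ^ N • e := by
  choose N c hc using fun i => exists_pow_mul_eq_pull T f ((F.basis (basicHom T f ≫ g)).repr e i)
  refine ⟨Finset.univ.sup N,
    (F.basis g).equivFun.symm fun i => f ^ (Finset.univ.sup N - N i) * c i, ?_⟩
  apply (F.basis (basicHom T f ≫ g)).repr.injective
  ext i
  rw [F.repr_comp, ← Module.Basis.equivFun_apply, LinearEquiv.apply_symm_apply, map_mul, hc,
    map_smul, Finsupp.smul_apply, smul_eq_mul, map_pow, ← mul_assoc, ← pow_add,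
    Nat.sub_add_cancel (Finset.le_sup (Finset.mem_univ i))]

/-- A point of `A` which vanishes where `f` is invertible is annihilated by a power of `f`. -/
lemma HasDimension.exists_pow_smul_eq_zero (hA : A.HasDimension n) (T : Over S)
    [CompactSpace T.left] (f : Γ(T.left, ⊤)) (m : T ⟶ A.X) (h : basicHom T f ≫ m = 0) :
    ∃ N : ℕ, f ^ N • m = 0 := by
  -- `U N` consists of the points near which `f^N • m` vanishes. These sets are open, increase with
  -- `N` and cover `T` because frames exist locally; by quasi-compactness one `N` suffices.
  let U (N : ℕ) : Set T.left := {x | ∃ (T' : Over S) (φ : T' ⟶ T), IsOpenImmersion φ.left ∧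
    x ∈ Set.range φ.left ∧ φ ≫ (f ^ N • m) = 0}
  have hmono : Monotone U := by
    rintro N N' hN x ⟨T', φ, h1, h2, h3⟩
    refine ⟨T', φ, h1, h2, ?_⟩
    rw [comp_smul', map_pow] at h3 ⊢
    exact pow_smul_eq_zero_of_le h3 hN
  obtain ⟨N, hN⟩ := isCompact_univ.elim_directed_cover U (fun N => by
    rw [isOpen_iff_mem_nhds]
    rintro x ⟨T', φ, h1, h2, h3⟩
    exact Filter.mem_of_superset (h1.base_open.isOpen_range.mem_nhds h2)
      fun y hy => ⟨T', φ, h1, hy, h3⟩) (fun x _ => by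
    obtain ⟨W, -, hxW, -, ⟨F⟩⟩ := hA.exists_frame (V := ⊤) (s := T.hom x) trivial
    obtain ⟨R, t, φ, h1, h2, ⟨g⟩⟩ := exists_spec_nhd T x hxW
    have : IsAffine (Over.mk t).left := inferInstanceAs (IsAffine (Spec R))
    obtain ⟨ψ, hψ⟩ := exists_basicHom_lift φ f
    obtain ⟨N, hN⟩ := F.exists_pow_smul_eq_zero g (pull φ f) (φ ≫ m) (by
      rw [← Category.assoc, ← hψ, Category.assoc, h, comp_zero])
    rw [Set.mem_iUnion]
    exact ⟨N, _, φ, h1, h2, by rw [comp_smul', map_pow, hN]⟩) hmono.directed_le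
  refine ⟨N, hom_ext_locally fun x => ?_⟩
  obtain ⟨T', φ, h1, h2, h3⟩ := hN (Set.mem_univ x)
  exact ⟨T', φ, h1, h2, by rw [h3, comp_zero]⟩

/-- Two extensions of the same point agree after multiplication by a power of `f`. -/
lemma HasDimension.exists_pow_smul_comp_eq (hA : A.HasDimension n) {T T₁ T₂ : Over S}
    [IsAffine T.left] [IsAffine T₁.left] [IsAffine T₂.left] (φ₁ : T₁ ⟶ T) (φ₂ : T₂ ⟶ T)
    (f : Γ(T.left, ⊤)) (m₁ : T₁ ⟶ A.X) (m₂ : T₂ ⟶ A.X) (e : basicOver T f ⟶ A.X)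
    (h₁ : ∀ (Z : Over S) (α : Z ⟶ T₁) (ψ : Z ⟶ basicOver T f),
      ψ ≫ basicHom T f = α ≫ φ₁ → α ≫ m₁ = ψ ≫ e)
    (h₂ : ∀ (Z : Over S) (α : Z ⟶ T₂) (ψ : Z ⟶ basicOver T f),
      ψ ≫ basicHom T f = α ≫ φ₂ → α ≫ m₂ = ψ ≫ e) :
    ∃ K : ℕ, ∀ (Z : Over S) (α : Z ⟶ T₁) (β : Z ⟶ T₂), α ≫ φ₁ = β ≫ φ₂ →
      α ≫ (pull φ₁ f ^ K • m₁) = β ≫ (pull φ₂ f ^ K • m₂) := by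
  -- The fibre product over the affine `T` is affine, hence quasi-compact, so a single power of `f`
  -- kills the difference of the two extensions on it.
  let P : Over S := Over.mk (Limits.pullback.fst φ₁.left φ₂.left ≫ T₁.hom)
  let p₁ : P ⟶ T₁ := Over.homMk (Limits.pullback.fst φ₁.left φ₂.left)
  let p₂ : P ⟶ T₂ := Over.homMk (Limits.pullback.snd φ₁.left φ₂.left) (by
    change _ = Limits.pullback.fst φ₁.left φ₂.left ≫ T₁.hom
    rw [← Over.w φ₁, ← Over.w φ₂, ← Category.assoc, ← Category.assoc, Limits.pullback.condition])
  have hp : p₁ ≫ φ₁ = p₂ ≫ φ₂ := by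
    ext1
    exact Limits.pullback.condition
  have : IsAffine P.left := inferInstanceAs (IsAffine (Limits.pullback φ₁.left φ₂.left))
  have hf : pull p₂ (pull φ₂ f) = pull p₁ (pull φ₁ f) := by rw [← pull_comp, ← pull_comp, hp]
  obtain ⟨ψ, hψ⟩ := exists_basicHom_lift (p₁ ≫ φ₁) f
  obtain ⟨K, hK⟩ := hA.exists_pow_smul_eq_zero P (pull (p₁ ≫ φ₁) f) (p₁ ≫ m₁ - p₂ ≫ m₂) (by
    rw [comp_sub, sub_eq_zero, ← Category.assoc, ← Category.assoc, h₁ _ _ ψ, h₂ _ _ ψ]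
    · rw [hψ, hp, Category.assoc]
    · rw [hψ, Category.assoc])
  rw [pull_comp] at hK
  refine ⟨K, fun Z α β hαβ => ?_⟩
  obtain ⟨γ, hγ₁, hγ₂⟩ : ∃ γ : Z ⟶ P, γ ≫ p₁ = α ∧ γ ≫ p₂ = β := by
    refine ⟨Over.homMk (Limits.pullback.lift α.left β.left (congrArg (·.left) hαβ)) ?_, ?_, ?_⟩
    · change _ ≫ Limits.pullback.fst φ₁.left φ₂.left ≫ T₁.hom = _
      rw [Limits.pullback.lift_fst_assoc, Over.w]
    · ext1
      exact Limits.pullback.lift_fst _ _ _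
    · ext1
      exact Limits.pullback.lift_snd _ _ _
  subst hγ₁ hγ₂
  rw [Category.assoc, Category.assoc]
  congr 1
  rw [comp_smul', comp_smul', map_pow, map_pow, hf, ← sub_eq_zero, ← smul_sub, hK]

end BasicOpen

end GaAlgebraScheme


namespace GaAlgebraScheme

variable {S : Scheme.{u}} {A : GaAlgebraScheme S} {n : ℕ}

section Extension

lemma comp_pow_smul {T' T : Over S} (φ : T' ⟶ T) (c : Γ(T.left, ⊤)) (N : ℕ) (m : T ⟶ A.X) :
    φ ≫ (c ^ N • m) = pull φ c ^ N • (φ ≫ m) := by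
  rw [comp_smul', map_pow]

/-- Over a chart with a frame the coordinates extend one by one. The conclusion is phrased by test
schemes `Z`, so that different charts can be compared without choosing a model of their overlaps. -/
lemma _root_.GaAlgebraScheme.Frame.exists_extension {T₀ T' T : Over S} (F : Frame A n T₀)
    (g : T' ⟶ T₀) (φ : T' ⟶ T) [IsAffine T'.left] (f : Γ(T.left, ⊤)) (e : basicOver T f ⟶ A.X) :
    ∃ (N : ℕ) (m : T' ⟶ A.X), ∀ (Z : Over S) (α : Z ⟶ T') (ψ : Z ⟶ basicOver T f),
      ψ ≫ basicHom T f = α ≫ φ → α ≫ m = ψ ≫ (pull (basicHom T f) f ^ N • e) := by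
  obtain ⟨ψ₀, hψ₀⟩ := exists_basicHom_lift φ f
  obtain ⟨N, m, hm⟩ := F.exists_basicHom_comp_eq g (pull φ f) (ψ₀ ≫ e)
  have hc : pull ψ₀ (pull (basicHom T f) f) = pull (basicHom _ (pull φ f)) (pull φ f) := by
    rw [← pull_comp, ← pull_comp, hψ₀]
  refine ⟨N, m, fun Z α ψ h => ?_⟩
  obtain ⟨γ, rfl⟩ := exists_basicHom_factor h
  obtain rfl : ψ = γ ≫ ψ₀ := openHom_injective (by
    rw [h, Category.assoc, Category.assoc, hψ₀])
  rw [Category.assoc, Category.assoc]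
  refine congrArg (γ ≫ ·) (hm.trans ?_)
  exact (congrArg (· ^ N • (ψ₀ ≫ e)) hc.symm).trans (comp_pow_smul ψ₀ _ N e).symm

lemma comp_eq_of_extension {T' T : Over S} {φ : T' ⟶ T} {f : Γ(T.left, ⊤)}
    {e : basicOver T f ⟶ A.X} {K N : ℕ} {b : T ⟶ A.X} {m : T' ⟶ A.X}
    (hb : φ ≫ b = pull φ f ^ K • m)
    (hm : ∀ (Z : Over S) (α : Z ⟶ T') (ψ : Z ⟶ basicOver T f), ψ ≫ basicHom T f = α ≫ φ →
      α ≫ m = ψ ≫ (pull (basicHom T f) f ^ N • e))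
    {Z : Over S} {α : Z ⟶ T'} {ψ : Z ⟶ basicOver T f} (h : ψ ≫ basicHom T f = α ≫ φ) :
    ψ ≫ (basicHom T f ≫ b) = ψ ≫ (pull (basicHom T f) f ^ (K + N) • e) := by
  have h1 : pull α (pull φ f) = pull ψ (pull (basicHom T f) f) := by
    rw [← pull_comp, ← pull_comp, h]
  rw [← Category.assoc, h, Category.assoc, hb, comp_pow_smul, hm _ α ψ h, h1, pow_add, mul_smul]
  exact (comp_pow_smul ψ _ K _).symm

/-- A point of `A` over the open subscheme where `f` is invertible extends, after multiplication
by a power of `f`. -/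
lemma HasDimension.exists_basicHom_comp_eq (hA : A.HasDimension n) (T : Over S)
    [IsAffine T.left] (f : Γ(T.left, ⊤)) (e : basicOver T f ⟶ A.X) :
    ∃ (N : ℕ) (m : T ⟶ A.X), basicHom T f ≫ m = pull (basicHom T f) f ^ N • e := by
  have hloc (x : T.left) : ∃ (T' : Over S) (φ : T' ⟶ T) (m : T' ⟶ A.X) (N : ℕ),
      IsAffine T'.left ∧ IsOpenImmersion φ.left ∧ x ∈ Set.range φ.left ∧
      ∀ (Z : Over S) (α : Z ⟶ T') (ψ : Z ⟶ basicOver T f),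
        ψ ≫ basicHom T f = α ≫ φ → α ≫ m = ψ ≫ (pull (basicHom T f) f ^ N • e) := by
    obtain ⟨W, -, hxW, -, ⟨F⟩⟩ := hA.exists_frame (V := ⊤) (s := T.hom x) trivial
    obtain ⟨R, t, φ, h1, h2, ⟨g⟩⟩ := exists_spec_nhd T x hxW
    have : IsAffine (Over.mk t).left := inferInstanceAs (IsAffine (Spec R))
    obtain ⟨N, m, hm⟩ := F.exists_extension g φ f e
    exact ⟨_, φ, m, N, this, h1, h2, hm⟩
  choose T' φ m N hT' hφ hx hm using hloc
  obtain ⟨t, ht⟩ := isCompact_univ.elim_nhds_subcover (fun x => Set.range (φ x).left)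
    fun x _ => (hφ x).base_open.isOpen_range.mem_nhds (hx x)
  -- One exponent for all charts of the finite cover; raising it only multiplies the local
  -- extensions by powers of `f`.
  let N₀ := t.sup N
  have hm' (x) (hx : x ∈ t) (Z : Over S) (α : Z ⟶ T' x) (ψ : Z ⟶ basicOver T f)
      (h : ψ ≫ basicHom T f = α ≫ φ x) : α ≫ (pull (φ x) f ^ (N₀ - N x) • m x) =
        ψ ≫ (pull (basicHom T f) f ^ N₀ • e) := by
    have h1 : pull α (pull (φ x) f) = pull ψ (pull (basicHom T f) f) := by
      rw [← pull_comp, ← pull_comp, h]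
    rw [comp_pow_smul, hm x Z α ψ h, h1]
    refine (congrArg (_ • ·) (comp_pow_smul ψ _ (N x) e)).trans
      (Eq.trans ?_ (comp_pow_smul ψ _ N₀ e).symm)
    rw [smul_smul, ← pow_add, Nat.sub_add_cancel (Finset.le_sup hx)]
  -- The local extensions need not agree on overlaps, where `f` may be a zero divisor; a further
  -- power of `f` repairs this for all pairs at once.
  have hK (x y : t) := hA.exists_pow_smul_comp_eq (φ x) (φ y) f _ _ _ (hm' x x.2) (hm' y y.2)
  choose K hK using hK
  let K₀ := Finset.univ.sup fun p : t × t => K p.1 p.2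
  obtain ⟨b, hb⟩ := exists_hom_glue (fun x : t => φ x) (fun x => hφ x) (fun x => by
      obtain ⟨y, hy, hxy⟩ := Set.mem_iUnion₂.mp (ht.2 (Set.mem_univ x))
      exact ⟨⟨y, hy⟩, hxy⟩)
    (fun x : t => pull (φ x) f ^ K₀ • pull (φ x) f ^ (N₀ - N x) • m x) fun x y Z α β h => by
      have hle : K x y ≤ K₀ := Finset.le_sup (f := fun p : t × t => K p.1 p.2)
        (Finset.mem_univ (x, y))
      have h1 := hK x y Z α β h
      have h2 : pull α (pull (φ x) f) = pull β (pull (φ y) f) := by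
        rw [← pull_comp, ← pull_comp, h]
      rw [← Nat.sub_add_cancel hle, pow_add, pow_add, mul_smul, mul_smul, comp_pow_smul α,
        comp_pow_smul β, h1, h2]
  refine ⟨K₀ + N₀, b, hom_ext_locally fun z => ?_⟩
  obtain ⟨y, hy, w, hw⟩ := Set.mem_iUnion₂.mp (ht.2 (Set.mem_univ ((basicHom T f).left z)))
  obtain ⟨ψ, hψ⟩ := exists_basicHom_lift (φ y) f
  refine ⟨_, ψ, ?_, ?_, ?_⟩
  · have := hφ y
    exact isOpenImmersion_basicHom_lift hψ
  · exact mem_range_basicHom_lift hψ ⟨w, hw⟩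
  · exact comp_eq_of_extension (hb ⟨y, hy⟩) (hm' y hy) hψ

lemma exists_pull_eq_uniform {ι : Type*} [Finite ι] (T : Over S) [IsAffine T.left]
    (f : Γ(T.left, ⊤)) (c : ι → Γ((basicOver T f).left, ⊤)) :
    ∃ (N : ℕ) (b : ι → Γ(T.left, ⊤)),
      ∀ i, pull (basicHom T f) (b i) = pull (basicHom T f) f ^ N * c i := by
  cases nonempty_fintype ι
  choose N b hb using fun i => exists_pow_mul_eq_pull T f (c i)
  refine ⟨Finset.univ.sup N, fun i => f ^ (Finset.univ.sup N - N i) * b i, fun i => ?_⟩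
  rw [map_mul, hb, map_pow, ← mul_assoc, ← pow_add,
    Nat.sub_add_cancel (Finset.le_sup (Finset.mem_univ i))]

lemma HasDimension.exists_comp_eq_uniform {ι : Type*} [Finite ι] (hA : A.HasDimension n)
    (T : Over S) [IsAffine T.left] (f : Γ(T.left, ⊤)) (e : ι → (basicOver T f ⟶ A.X)) :
    ∃ (N : ℕ) (m : ι → (T ⟶ A.X)),
      ∀ i, basicHom T f ≫ m i = pull (basicHom T f) f ^ N • e i := by
  cases nonempty_fintype ι
  choose N m hm using fun i => hA.exists_basicHom_comp_eq T f (e i)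
  refine ⟨Finset.univ.sup N, fun i => f ^ (Finset.univ.sup N - N i) • m i, fun i => ?_⟩
  rw [comp_pow_smul, hm, smul_smul, ← pow_add,
    Nat.sub_add_cancel (Finset.le_sup (Finset.mem_univ i))]

lemma HasDimension.exists_pow_smul_eq_zero_uniform {ι : Type*} [Finite ι] (hA : A.HasDimension n)
    (T : Over S) [IsAffine T.left] (f : Γ(T.left, ⊤)) (m : ι → (T ⟶ A.X))
    (h : ∀ i, basicHom T f ≫ m i = 0) : ∃ N : ℕ, ∀ i, f ^ N • m i = 0 := by
  cases nonempty_fintype ι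
  choose N hN using fun i => hA.exists_pow_smul_eq_zero T f (m i) (h i)
  exact ⟨Finset.univ.sup N,
    fun i => pow_smul_eq_zero_of_le (hN i) (Finset.le_sup (Finset.mem_univ i))⟩

/-- Although `A(T)` has no given basis, the frame over the basic open and the coordinates of the `v
i` extend to `T` after multiplication by powers of `f`. Thus the `v i` are, up to such a power,
combinations of finitely many points, with coefficients whose minors vanish where `f` is invertible.
-/
lemma HasDimension.exists_pow_smul_ιMulti_eq_zero (hA : A.HasDimension n) {T₀ : Over S}
    (F : Frame A n T₀) (T : Over S) [IsAffine T.left] (f : Γ(T.left, ⊤)) (g : basicOver T f ⟶ T₀)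
    {d : ℕ} {v : Fin (d + 1) → (T ⟶ A.X)}
    (hv : exteriorPower.ιMulti Γ((basicOver T f).left, ⊤) (d + 1)
      (fun i => basicHom T f ≫ v i) = 0) :
    ∃ K : ℕ, f ^ K • exteriorPower.ιMulti Γ(T.left, ⊤) (d + 1) v = 0 := by
  obtain ⟨N₀, x, hx⟩ := hA.exists_comp_eq_uniform T f (F.basis g)
  obtain ⟨N₁, b, hb⟩ := exists_pull_eq_uniform T f fun p : Fin (d + 1) × Fin n =>
    (F.basis g).repr (basicHom T f ≫ v p.1) p.2
  -- The expected expression of `f^(N₁+N₀) • v i` holds where `f` is invertible, hence on `T` after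
  -- multiplication by a further `f^L`.
  obtain ⟨L, hL⟩ := hA.exists_pow_smul_eq_zero_uniform T f
    (fun i => f ^ (N₁ + N₀) • v i - ∑ j, b (i, j) • x j) (fun i => by
      rw [comp_sub, comp_sum, comp_pow_smul, sub_eq_zero]
      simp only [comp_smul', hx, hb]
      conv_lhs => rw [← (F.basis g).sum_repr (basicHom T f ≫ v i)]
      rw [Finset.smul_sum]
      refine Finset.sum_congr rfl fun j _ => ?_
      rw [smul_smul, smul_smul, pow_add]
      congr 1
      ring)
  refine _root_.exists_pow_smul_ιMulti_eq_zero (φ := pull (basicHom T f)) (f := f) (x := x)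
    (b := fun i j => f ^ L * b (i, j)) (N := L + (N₁ + N₀))
    (exists_pow_mul_eq_zero T f) (fun i => ?_) ?_
  · have h := hL i
    rw [smul_sub, sub_eq_zero, smul_smul, ← pow_add] at h
    rw [h, Finset.smul_sum]
    simp only [mul_smul]
  · have h := ιMulti_smul (pull (basicHom T f) f ^ (L + N₁)) (fun i => basicHom T f ≫ v i)
    rw [hv, smul_zero] at h
    refine ιMulti_eq_zero_of_repr (RingHom.id _) (F.basis g) (Pi.basisFun _ (Fin n)) ?_ h
    intro i j
    rw [Pi.basisFun_repr, map_mul, hb, map_pow, ← mul_assoc, ← pow_add, Pi.smul_apply, map_smul]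
    rfl

/-- The vanishing of an exterior product of points with values in an affine scheme is local. -/
lemma HasDimension.ιMulti_eq_zero_of_locally (hA : A.HasDimension n) (T : Over S)
    [IsAffine T.left] {d : ℕ} {v : Fin (d + 1) → (T ⟶ A.X)}
    (H : ∀ x : T.left, ∃ (T' : Over S) (φ : T' ⟶ T), IsOpenImmersion φ.left ∧
      x ∈ Set.range φ.left ∧
      exteriorPower.ιMulti Γ(T'.left, ⊤) (d + 1) (fun i => φ ≫ v i) = 0) :
    exteriorPower.ιMulti Γ(T.left, ⊤) (d + 1) v = 0 := by
  let ω := exteriorPower.ιMulti Γ(T.left, ⊤) (d + 1) v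
  -- It suffices that these `f` generate the unit ideal, that is, that their basic opens cover `T`:
  -- then the radical of the annihilator of `ω` contains `1`, and so does the annihilator.
  let s : Set Γ(T.left, ⊤) := {f | ∃ K : ℕ, f ^ K • ω = 0}
  have hs : Ideal.span s = ⊤ := by
    rw [← (isAffineOpen_top T.left).iSup_basicOpen_eq_self_iff, eq_top_iff]
    intro x _
    obtain ⟨T', φ, h1, h2, h3⟩ := H x
    obtain ⟨U, -, hxU, -, ⟨F⟩⟩ := hA.exists_frame (V := ⊤) (s := T.hom x) trivial
    obtain ⟨_, ⟨_, ⟨f, rfl⟩, rfl⟩, hxf, hf⟩ := (isBasis_basicOpen T.left).exists_subset_of_mem_open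
      (show x ∈ ((φ.left.opensRange ⊓ T.hom ⁻¹ᵁ U : T.left.Opens) : Set T.left) from ⟨h2, hxU⟩)
      (φ.left.opensRange ⊓ T.hom ⁻¹ᵁ U).isOpen
    obtain ⟨ψ, hψ⟩ := exists_lift (basicHom T f) φ (by
      change Set.range (Scheme.Opens.ι _) ⊆ _
      rw [Scheme.Opens.range_ι]
      exact fun y hy => (hf hy).1)
    obtain ⟨g⟩ : Nonempty (basicOver T f ⟶ Over.mk U.ι) := by
      rw [nonempty_hom_iff, eq_top_iff]
      exact fun y _ => (hf y.2).2
    obtain ⟨K, hK⟩ := hA.exists_pow_smul_ιMulti_eq_zero F T f g (v := v) (by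
      simpa only [← hψ, Category.assoc] using ιMulti_comp ψ h3)
    exact TopologicalSpace.Opens.mem_iSup.mpr ⟨⟨f, K, hK⟩, hxf⟩
  have hJ : s ⊆ (Ideal.radical (Submodule.span Γ(T.left, ⊤) {ω}).annihilator : Set _) := by
    rintro f ⟨K, hK⟩
    exact ⟨K, Submodule.mem_annihilator_span_singleton _ _ |>.mpr hK⟩
  have h1 := Ideal.radical_eq_top.mp (top_le_iff.mp (hs ▸ Ideal.span_le.mpr hJ))
  have h2 : (1 : Γ(T.left, ⊤)) ∈ (Submodule.span Γ(T.left, ⊤) {ω}).annihilator := by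
    rw [h1]
    trivial
  rwa [Submodule.mem_annihilator_span_singleton, one_smul] at h2

end Extension

end GaAlgebraScheme


/-! ### Normal charts and generic independence -/

/-- Being integrally closed may be checked at the maximal ideals, and the localizations there are
stalks of `S`. -/
lemma AlgebraicGeometry.IsAffineOpen.isIntegrallyClosed {S : Scheme.{u}} [IsIntegral S]
    (hS : S.IsNormalScheme) {U : S.Opens} (hU : IsAffineOpen U) [Nonempty U] :
    IsIntegrallyClosed Γ(U, ⊤) := by
  have : IsIntegrallyClosed Γ(S, U) := by
    refine IsIntegrallyClosed.of_localization_maximal fun P _ hP => ?_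
    let y : PrimeSpectrum Γ(S, U) := ⟨P, hP.isPrime⟩
    have hy : hU.fromSpec y ∈ U := by
      have h : hU.fromSpec y ∈ Set.range hU.fromSpec := ⟨y, rfl⟩
      rwa [hU.range_fromSpec] at h
    let : Algebra Γ(S, U) (S.presheaf.stalk (hU.fromSpec y)) :=
      TopCat.Presheaf.algebra_section_stalk S.presheaf ⟨hU.fromSpec y, hy⟩
    have : IsLocalization P.primeCompl (S.presheaf.stalk (hU.fromSpec y)) :=
      hU.isLocalization_stalk' y hy
    have := (hS (hU.fromSpec y)).2
    exact IsIntegrallyClosed.of_equiv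
      (IsLocalization.algEquiv P.primeCompl (S.presheaf.stalk (hU.fromSpec y))
        (Localization.AtPrime P)).toRingEquiv
  exact IsIntegrallyClosed.of_equiv U.topIso.commRingCatIsoToRingEquiv.symm

/-- A flat module over a domain is torsion free, so no nonzero element can kill the nonzero `1` of
`R'`. -/
lemma RingHom.Flat.injective_of_isDomain {R R' : Type*} [CommRing R] [CommRing R'] [IsDomain R]
    [Nontrivial R'] {f : R →+* R'} (hf : f.Flat) : Function.Injective f := by
  algebraize [f]
  exact FaithfulSMul.algebraMap_injective R R'

namespace GaAlgebraScheme

open Module GenericElement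

variable {S : Scheme.{u}} {A : GaAlgebraScheme S} {n : ℕ}

namespace Frame

variable {T₀ : Over S} (F : Frame A n T₀)

lemma eval_restrict {T₁ T : Over S} (h : T₁ ⟶ T₀) (g : T ⟶ T₁)
    (D : MvPolynomial (Fin n) Γ(T₀.left, ⊤)) (a : T ⟶ A.X) :
    (F.restrict h).eval g (MvPolynomial.map (pull h) D) a = F.eval (g ≫ h) D a := by
  have h1 : pull (g ≫ h) = (pull g).comp (pull h) := RingHom.ext fun c => pull_comp g h c
  rw [eval, eval, h1, MvPolynomial.eval₂_map]
  rfl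

variable [IsAffine T₀.left]

/-- Any point is a pullback of the generic one, and exterior products pull back: nonvanishing at `a`
forces nonvanishing generically. -/
lemma isIndependent_of_ne_zero [IsDomain Γ(T₀.left, ⊤)] {d : ℕ} {T : Over S} (g : T ⟶ T₀)
    {a : T ⟶ A.X} (h : exteriorPower.ιMulti Γ(T.left, ⊤) d (fun i : Fin d => a ^ (i : ℕ)) ≠ 0) :
    F.IsIndependent d := by
  rw [isIndependent_iff]
  intro h0
  obtain ⟨h', -, rfl, -⟩ := F.exists_comp_genericPoint g a
  refine h ?_
  simp only [← comp_pow]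
  exact ιMulti_comp h' h0

/-- A converse for points satisfying no polynomial equation: specialization from the generic point
is then injective on functions, so a nonzero minor stays nonzero. -/
lemma ιMulti_ne_zero_of_isIndependent [IsDomain Γ(T₀.left, ⊤)] {F : Frame A n T₀} {d : ℕ}
    (hF : F.IsIndependent d) {T : Over S} (g : T ⟶ T₀) (a : T ⟶ A.X)
    (ha : ∀ D, F.eval g D a = 0 → D = 0) :
    exteriorPower.ιMulti Γ(T.left, ⊤) d (fun i : Fin d => a ^ (i : ℕ)) ≠ 0 := by
  rw [isIndependent_iff] at hF
  intro h0
  obtain ⟨h', rfl, rfl, hD⟩ := F.exists_comp_genericPoint g a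
  have hinj : Function.Injective (pull h') := by
    rw [injective_iff_map_eq_zero]
    intro x hx
    rw [← (genericRing n T₀).symm_apply_apply x] at hx ⊢
    rw [ha _ ((hD _).symm.trans hx), map_zero]
  refine hF (ιMulti_eq_zero_of_repr_injective hinj (F.basis (genericHom n T₀))
    (F.basis (h' ≫ genericHom n T₀)) (fun i j => ?_) h0)
  rw [← F.repr_comp, comp_pow]

/-- Generic independence is preserved by injective extensions of the base. -/
lemma IsIndependent.restrict_ιMulti_ne_zero [IsDomain Γ(T₀.left, ⊤)] {F : Frame A n T₀} {d : ℕ}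
    (hF : F.IsIndependent d) {T₁ : Over S} [IsAffine T₁.left]
    (h : T₁ ⟶ T₀) (hinj : Function.Injective (pull h)) :
    exteriorPower.ιMulti Γ((genericOver n T₁).left, ⊤) d
      (fun i : Fin d => (F.restrict h).genericPoint ^ (i : ℕ)) ≠ 0 := by
  refine ιMulti_ne_zero_of_isIndependent hF (genericHom n T₁ ≫ h) _ fun D hD => ?_
  have h1 := (F.restrict h).genericRing_eval (MvPolynomial.map (pull h) D)
  rw [F.eval_restrict, hD, map_zero] at h1
  exact MvPolynomial.map_injective _ hinj (h1.symm.trans (map_zero _).symm)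

end Frame

instance (U : S.Opens) [h : IsAffine U] : IsAffine (Over.mk U.ι).left := h

instance (U : S.Opens) [IsIntegral S] [Nonempty U] : IsDomain Γ((Over.mk U.ι).left, ⊤) :=
  inferInstanceAs (IsDomain Γ(U, ⊤))

lemma pull_inclusion_injective [IsIntegral S] {U V : S.Opens} [hU : Nonempty U] (h : U ≤ V) :
    Function.Injective (pull (inclusion h)) := by
  change Function.Injective ((S.homOfLE h).appTop)
  rw [Scheme.homOfLE_appTop]
  have : Nonempty ↑(U.ι ''ᵁ S.homOfLE h ⁻¹ᵁ ⊤) :=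
    ⟨⟨_, Set.mem_image_of_mem _ (Set.mem_univ hU.some)⟩⟩
  exact map_injective_of_isIntegral _ _

/-- Over an integral base, all frames on affine open subschemes are generically independent, for
the least degree of `A`. -/
lemma HasDimension.isIndependent [IsIntegral S] (hA : A.HasDimension n) {d : ℕ}
    (hd : IsLeast {e : ℕ | A.DegreeLE e} d) (hd0 : d ≠ 0) {U : S.Opens} [IsAffine U]
    [hU : Nonempty U] (F : Frame A n (Over.mk U.ι)) : F.IsIndependent d := by
  obtain ⟨d, rfl⟩ := Nat.exists_eq_succ_of_ne_zero hd0
  by_contra hF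
  -- Here `d` is one less than the original degree, so this contradicts minimality.
  have hle : A.DegreeLE d := by
    intro T hT a
    refine hA.ιMulti_eq_zero_of_locally T fun x => ?_
    obtain ⟨V, hV, hxV, -, ⟨F'⟩⟩ := hA.exists_frame (V := ⊤) (s := T.hom x) trivial
    obtain ⟨R, t, φ, h1, h2, ⟨g⟩⟩ := exists_spec_nhd T x hxV
    refine ⟨_, φ, h1, h2, ?_⟩
    by_contra hne
    have : IsAffine V := hV
    have : Nonempty V := ⟨⟨_, hxV⟩⟩
    simp only [comp_pow] at hne
    have hF' := F'.isIndependent_of_ne_zero g hne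
    -- Irreducibility supplies a common affine open `W`. Independence for the frame on `V` passes to
    -- the generic point over `W` by injectivity of restriction; that point is a specialization of
    -- the generic point of `F`, so `F` would be independent as well.
    obtain ⟨s, hs⟩ := nonempty_preirreducible_inter U.isOpen V.isOpen
      ⟨_, hU.some.2⟩ ⟨_, hxV⟩
    obtain ⟨W, hW, hsW, hWUV⟩ := exists_affine_subset (show s ∈ U ⊓ V from hs)
    have : IsAffine W := hW
    have : Nonempty W := ⟨⟨_, hsW⟩⟩
    exact hF (F.isIndependent_of_ne_zero
      (genericHom _ _ ≫ inclusion (hWUV.trans inf_le_left))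
      (hF'.restrict_ιMulti_ne_zero (inclusion (hWUV.trans inf_le_right))
        (pull_inclusion_injective _)))
  exact absurd (hd.2 hle) (by omega)

end GaAlgebraScheme


/-! ### Homogeneous functions and symmetric powers of the dual -/

lemma MvPolynomial.IsHomogeneous.aeval_mem_pow {ι R B : Type*} [CommRing R] [CommRing B]
    [Algebra R B] {N : Submodule R B} {ξ : ι → B} (hξ : ∀ i, ξ i ∈ N) {d : ℕ}
    {D : MvPolynomial ι R} (hD : D.IsHomogeneous d) : MvPolynomial.aeval ξ D ∈ N ^ d := by
  have hprod (s : Finset ι) (m : ι →₀ ℕ) : ∏ i ∈ s, ξ i ^ m i ∈ N ^ ∑ i ∈ s, m i := by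
    classical
    induction s using Finset.induction_on with
    | empty => simpa using ⟨1, map_one _⟩
    | insert i s hi ih =>
      rw [Finset.prod_insert hi, Finset.sum_insert hi, pow_add]
      exact Submodule.mul_mem_mul (Submodule.pow_mem_pow N (hξ i) _) ih
  rw [MvPolynomial.aeval_def, MvPolynomial.eval₂_eq]
  refine Submodule.sum_mem _ fun m hm => ?_
  rw [← Algebra.smul_def]
  refine Submodule.smul_mem _ _ ?_
  have hw : ∑ i ∈ m.support, m i = d := by
    rw [← hD (MvPolynomial.mem_support_iff.mp hm)]
    exact DFunLike.congr_fun (Finsupp.degree_eq_weight_one (R := ℕ)) m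
  exact hw ▸ hprod m.support m

lemma AlgebraicGeometry.Scheme.Hom.appLE_top_top {X Y : Scheme.{u}} (f : X ⟶ Y)
    (e : ⊤ ≤ f ⁻¹ᵁ ⊤) : f.appLE ⊤ ⊤ e = f.appTop := f.appLE_eq_app

lemma AlgebraicGeometry.Scheme.Hom.comp_appLE_top {X Y Z : Scheme.{u}} (f : X ⟶ Y) (g : Y ⟶ Z)
    (U : Z.Opens) (e : ⊤ ≤ g ⁻¹ᵁ U) (e' : ⊤ ≤ (f ≫ g) ⁻¹ᵁ U) :
    (f ≫ g).appLE U ⊤ e' = g.appLE U ⊤ e ≫ f.appTop :=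
  (Scheme.Hom.appLE_comp_appLE f g U ⊤ ⊤ e (le_top : ⊤ ≤ f ⁻¹ᵁ ⊤)).symm.trans
    (congrArg (g.appLE U ⊤ e ≫ ·) (f.appLE_top_top _))

lemma AlgebraicGeometry.Scheme.Opens.ι_appLE_top {X : Scheme.{u}} (W : X.Opens)
    (e : ⊤ ≤ W.ι ⁻¹ᵁ W) : W.ι.appLE W ⊤ e = W.topIso.inv := by
  rw [Scheme.Opens.ι_appLE, Scheme.Opens.topIso_inv]
  rfl

namespace GaAlgebraScheme

open Module GenericElement

variable {S : Scheme.{u}} {A : GaAlgebraScheme S} {n : ℕ}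

section Values

lemma value_eq_pull (f : Γ(A.X.left, ⊤)) {T : Over S} (a : T ⟶ A.X) : value f a = pull a f := rfl

lemma value_comp (f : Γ(A.X.left, ⊤)) {T' T : Over S} (φ : T' ⟶ T) (a : T ⟶ A.X) :
    value f (φ ≫ a) = pull φ (value f a) := pull_comp φ a f

lemma eq_of_value_eq {f f' : Γ(A.X.left, ⊤)}
    (h : ∀ (T : Over S) (a : T ⟶ A.X), value f a = value f' a) : f = f' := by
  have := h A.X (𝟙 _)
  rwa [value_eq_pull, value_eq_pull, pull_id, pull_id] at this

/-- The value of functions on an open subscheme at a point. -/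
def valueOnHom {U : S.Opens} {T : Over S} (hT : T.hom ⁻¹ᵁ U = ⊤) (a : T ⟶ A.X) :
    Γ(A.X.left, A.X.hom ⁻¹ᵁ U) →+* Γ(T.left, ⊤) :=
  (a.left.appLE (A.X.hom ⁻¹ᵁ U) ⊤ (le_preimage hT a)).hom

lemma valueOn_eq {U : S.Opens} (g : Γ(A.X.left, A.X.hom ⁻¹ᵁ U)) {T : Over S}
    (hT : T.hom ⁻¹ᵁ U = ⊤) (a : T ⟶ A.X) : valueOn g hT a = valueOnHom hT a g := rfl

lemma valueOnHom_algebraMap {U : S.Opens} {T : Over S} (hT : T.hom ⁻¹ᵁ U = ⊤) (a : T ⟶ A.X)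
    (r : Γ(S, U)) : valueOnHom hT a (algebraMap Γ(S, U) Γ(A.X.left, A.X.hom ⁻¹ᵁ U) r) =
      T.hom.appLE U ⊤ hT.ge r := by
  have h := Scheme.Hom.appLE_comp_appLE a.left A.X.hom U (A.X.hom ⁻¹ᵁ U) ⊤ le_rfl
    (le_preimage hT a)
  simp only [Over.w] at h
  rw [← h, Scheme.Hom.appLE_eq_app]
  rfl

lemma valueOn_comp {U : S.Opens} (g : Γ(A.X.left, A.X.hom ⁻¹ᵁ U)) {T' T : Over S}
    (hT : T.hom ⁻¹ᵁ U = ⊤) (hT' : T'.hom ⁻¹ᵁ U = ⊤) (φ : T' ⟶ T) (a : T ⟶ A.X) :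
    valueOn g hT' (φ ≫ a) = pull φ (valueOn g hT a) := by
  exact congrArg (fun f => f.hom g) (Scheme.Hom.comp_appLE_top φ.left a.left (A.X.hom ⁻¹ᵁ U)
    (le_preimage hT a) (le_preimage hT' (φ ≫ a)))

lemma valueOn_map (f : Γ(A.X.left, ⊤)) {U : S.Opens} {T : Over S} (hT : T.hom ⁻¹ᵁ U = ⊤)
    (a : T ⟶ A.X) : valueOn (A.X.left.presheaf.map
      (homOfLE (le_top : A.X.hom ⁻¹ᵁ U ≤ ⊤)).op f) hT a = value f a := by
  have h := Scheme.Hom.map_appLE a.left (le_preimage hT a)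
    (homOfLE (le_top : A.X.hom ⁻¹ᵁ U ≤ ⊤)).op
  rw [Scheme.Hom.appLE_top_top] at h
  exact congrArg (fun f' => f'.hom f) h

variable (A) in
/-- The tautological point of `A` over an open subscheme of the base. -/
abbrev taut (U : S.Opens) : openOver A.X (A.X.hom ⁻¹ᵁ U) ⟶ A.X := openHom A.X (A.X.hom ⁻¹ᵁ U)

variable (A) in
lemma taut_preimage (U : S.Opens) : (openOver A.X (A.X.hom ⁻¹ᵁ U)).hom ⁻¹ᵁ U = ⊤ := by
  change (Scheme.Opens.ι _ ≫ A.X.hom) ⁻¹ᵁ U = ⊤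
  rw [Scheme.Hom.comp_preimage, Scheme.Opens.ι_preimage_self]

lemma exists_comp_taut {U : S.Opens} {T : Over S} (hT : T.hom ⁻¹ᵁ U = ⊤) (a : T ⟶ A.X) :
    ∃ ψ, ψ ≫ A.taut U = a := by
  apply exists_lift
  change _ ⊆ Set.range (Scheme.Opens.ι _)
  rw [Scheme.Opens.range_ι]
  rintro _ ⟨x, rfl⟩
  exact le_preimage hT a (trivial : x ∈ (⊤ : T.left.Opens))

lemma valueOnHom_taut (U : S.Opens) (g : Γ(A.X.left, A.X.hom ⁻¹ᵁ U)) :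
    valueOnHom (taut_preimage A U) (A.taut U) g = (A.X.hom ⁻¹ᵁ U).topIso.inv g := by
  exact congrArg (fun f => f.hom g) ((A.X.hom ⁻¹ᵁ U).ι_appLE_top _)

/-- A function is its own value at the tautological point. Hence prescribing a natural family at
that point defines a function, and equality of functions can be tested there. -/
lemma valueOnHom_taut_bijective (U : S.Opens) :
    Function.Bijective (valueOnHom (taut_preimage A U) (A.taut U)) := by
  have : ⇑(valueOnHom (taut_preimage A U) (A.taut U)) =
      (A.X.hom ⁻¹ᵁ U).topIso.commRingCatIsoToRingEquiv.symm := funext (valueOnHom_taut U)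
  rw [this]
  exact RingEquiv.bijective _

lemma appLE_topIso {U : S.Opens} {T : Over S} (hT : T.hom ⁻¹ᵁ U = ⊤) (g : T ⟶ Over.mk U.ι)
    (c : Γ((Over.mk U.ι).left, ⊤)) : T.hom.appLE U ⊤ hT.ge (U.topIso.hom c) = pull g c := by
  have hU : ⊤ ≤ U.ι ⁻¹ᵁ U := by rw [Scheme.Opens.ι_preimage_self]
  have hw : g.left ≫ U.ι = T.hom := Over.w g
  have h := Scheme.Hom.comp_appLE_top g.left U.ι U hU (by rw [hw]; exact hT.ge)
  simp only [hw] at h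
  rw [h, Scheme.Opens.ι_appLE_top, CommRingCat.comp_apply]
  exact congrArg (pull g) (congrArg (fun f => f.hom c) U.topIso.hom_inv_id)

end Values

section Homogeneous

variable (A) in
/-- The functions on `A` over an open subscheme which are homogeneous of degree `d`. -/
def homogeneous (U : S.Opens) (d : ℕ) : Submodule Γ(S, U) Γ(A.X.left, A.X.hom ⁻¹ᵁ U) where
  carrier := {g | ∀ (T : Over S) (hT : T.hom ⁻¹ᵁ U = ⊤) (c : Γ(T.left, ⊤)) (a : T ⟶ A.X),
    valueOnHom hT (c • a) g = c ^ d * valueOnHom hT a g}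
  zero_mem' T hT c a := by simp
  add_mem' hg hh T hT c a := by rw [map_add, map_add, hg, hh, mul_add]
  smul_mem' r g hg T hT c a := by
    rw [Algebra.smul_def r g, map_mul, map_mul, hg T hT, valueOnHom_algebraMap, valueOnHom_algebraMap,
      mul_left_comm]

lemma dual_pow_le (U : S.Opens) (d : ℕ) : A.dual U ^ d ≤ A.homogeneous U d := by
  induction d with
  | zero =>
    rw [pow_zero, Submodule.one_le]
    intro T hT c a
    rw [map_one, map_one, pow_zero, one_mul]
  | succ d ih =>
    rw [pow_succ, Submodule.mul_le]
    intro g hg h hh T hT c a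
    have h1 : valueOnHom hT (c • a) h = c * valueOnHom hT a h := (hh T hT).2 c a
    rw [map_mul, map_mul, ih hg T hT, h1]
    ring

lemma IsSymSection.value_smul {d : ℕ} {f : Γ(A.X.left, ⊤)} (hf : A.IsSymSection d f) {T : Over S}
    (c : Γ(T.left, ⊤)) (a : T ⟶ A.X) : value f (c • a) = c ^ d * value f a := by
  refine pull_ext_locally fun x => ?_
  obtain ⟨U, hxU, hU⟩ := hf (T.hom x)
  obtain ⟨R, t, φ, h1, h2, hg⟩ := exists_spec_nhd T x hxU
  rw [nonempty_hom_iff] at hg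
  refine ⟨_, φ, h1, h2, ?_⟩
  have := dual_pow_le U d hU _ hg (pull φ c) (φ ≫ a)
  rw [← valueOn_eq, ← valueOn_eq, valueOn_map, valueOn_map] at this
  rw [← value_comp, comp_smul', this, map_mul, map_pow, value_comp]

/-- The coordinate of the tautological point defines a function; naturality makes it compute the
coordinate of every point, and coordinates are linear. -/
lemma Frame.exists_coordinate {U : S.Opens} (F : Frame A n (Over.mk U.ι)) (i : Fin n) :
    ∃ ξ ∈ A.dual U, ∀ (T : Over S) (hT : T.hom ⁻¹ᵁ U = ⊤) (g : T ⟶ Over.mk U.ι) (a : T ⟶ A.X),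
      valueOnHom hT a ξ = (F.basis g).repr a i := by
  obtain ⟨g₀⟩ := nonempty_hom_iff.mpr (taut_preimage A U)
  obtain ⟨ξ, hξ⟩ := (valueOnHom_taut_bijective U).2 ((F.basis g₀).repr (A.taut U) i)
  have key : ∀ (T : Over S) (hT : T.hom ⁻¹ᵁ U = ⊤) (g : T ⟶ Over.mk U.ι) (a : T ⟶ A.X),
      valueOnHom hT a ξ = (F.basis g).repr a i := by
    intro T hT g a
    obtain ⟨ψ, rfl⟩ := exists_comp_taut hT a
    obtain rfl : g = ψ ≫ g₀ := Subsingleton.elim _ _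
    rw [← valueOn_eq, valueOn_comp _ (taut_preimage A U), valueOn_eq, hξ, F.repr_comp]
  refine ⟨ξ, fun T hT => ?_, key⟩
  obtain ⟨g⟩ := nonempty_hom_iff.mpr hT
  refine ⟨fun a b => ?_, fun c a => ?_⟩
  · rw [valueOn_eq, valueOn_eq, valueOn_eq, key T hT g, key T hT g, key T hT g, map_add]
    rfl
  · rw [valueOn_eq, valueOn_eq, key T hT g, key T hT g, map_smul]
    rfl

/-- In a local frame `f` is a homogeneous polynomial of degree `d` in the coordinates, and these are
sections of the dual. With `IsSymSection.value_smul`, the symmetric power becomes a scaling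
condition on values. -/
lemma HasDimension.isSymSection (hA : A.HasDimension n) {d : ℕ} {f : Γ(A.X.left, ⊤)}
    (h : ∀ {T : Over S} (c : Γ(T.left, ⊤)) (a : T ⟶ A.X), value f (c • a) = c ^ d * value f a) :
    A.IsSymSection d f := by
  intro s
  obtain ⟨U, hU, hsU, -, ⟨F⟩⟩ := hA.exists_frame (V := ⊤) (s := s) trivial
  have : IsAffine U := hU
  refine ⟨U, hsU, ?_⟩
  obtain ⟨D, hD⟩ := F.exists_eval_eq (v := fun _ _ a => value f a) fun φ _ a => value_comp f φ a
  have hD' (T : Over S) (g : T ⟶ Over.mk U.ι) (a : T ⟶ A.X) : value f a = F.eval g D a :=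
    congrFun (congrFun (congrFun hD T) g) a
  have hhom : D.IsHomogeneous d := F.isHomogeneous_of_eval_smul fun {T} g c a => by
    rw [← hD', ← hD', h]
  choose ξ hξ hval using F.exists_coordinate
  let θ : Γ((Over.mk U.ι).left, ⊤) →+* Γ(S, U) := U.topIso.hom.hom
  have hmem := (hhom.map θ).aeval_mem_pow hξ
  convert hmem using 1
  apply (valueOnHom_taut_bijective U).1
  obtain ⟨g₀⟩ := nonempty_hom_iff.mpr (taut_preimage A U)
  rw [← valueOn_eq, valueOn_map, hD' _ g₀, MvPolynomial.aeval_def, MvPolynomial.eval₂_map,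
    MvPolynomial.eval₂_comp_left, Frame.eval]
  congr 1
  · ext c
    rw [RingHom.comp_apply, RingHom.comp_apply, valueOnHom_algebraMap]
    exact (appLE_topIso (taut_preimage A U) g₀ c).symm
  · funext i
    exact (hval i _ _ g₀ _).symm

end Homogeneous

end GaAlgebraScheme


/-! ### Uniqueness and existence of the determinant over the whole base -/

namespace GaAlgebraScheme

variable {S : Scheme.{u}} {A : GaAlgebraScheme S} {n d : ℕ}

section CharPoly

lemma charPoly_eq_charPolyOf (f : Γ(A.X.left, ⊤)) {T₀ : Over S} {R : CommRingCat.{u}}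
    {t : Spec R ⟶ S} (g : Over.mk t ⟶ T₀) (a : Over.mk t ⟶ A.X) :
    charPoly f a = charPolyOf (fun _ _ a => value f a) g a := rfl

/-- The map `R[X] → R'[X]` induced by `r` relates the two affine lines and preserves their
coordinate, so naturality of `value` gives the claim. It makes Cayley-Hamilton a local condition. -/
lemma charPoly_comp_homMk (f : Γ(A.X.left, ⊤)) {R R' : CommRingCat.{u}} (r : R ⟶ R')
    {t : Spec R ⟶ S} (a : Over.mk t ⟶ A.X) :
    charPoly f ((Over.homMk (Spec.map r) : Over.mk (Spec.map r ≫ t) ⟶ Over.mk t) ≫ a) =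
      (charPoly f a).map r.hom := by
  let ρ : CommRingCat.of R[X] ⟶ CommRingCat.of R'[X] :=
    CommRingCat.ofHom (Polynomial.mapRingHom r.hom)
  have hC : CommRingCat.ofHom (Polynomial.C : R →+* R[X]) ≫ ρ =
      r ≫ CommRingCat.ofHom (Polynomial.C : R' →+* R'[X]) := by
    ext1
    exact RingHom.ext fun c => Polynomial.map_C r.hom
  let ψ : line (Spec.map r ≫ t) ⟶ line t := Over.homMk (Spec.map ρ) (by
    change Spec.map ρ ≫ Spec.map (CommRingCat.ofHom (Polynomial.C : R →+* R[X])) ≫ t = _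
    rw [← Spec.map_comp_assoc, hC, Spec.map_comp_assoc]
    rfl)
  have hψ : ψ ≫ lineHom t = lineHom (Spec.map r ≫ t) ≫
      (Over.homMk (Spec.map r) : Over.mk (Spec.map r ≫ t) ⟶ Over.mk t) := by
    ext1
    change Spec.map ρ ≫ Spec.map (CommRingCat.ofHom (Polynomial.C : R →+* R[X])) =
      Spec.map (CommRingCat.ofHom (Polynomial.C : R' →+* R'[X])) ≫ Spec.map r
    rw [← Spec.map_comp, hC, Spec.map_comp]
  have hcoord : pull ψ (lineCoord t) = lineCoord (Spec.map r ≫ t) := by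
    have h := congrArg (fun g => g.hom (Polynomial.X : R[X])) (Scheme.ΓSpecIso_inv_naturality ρ)
    refine h.symm.trans ?_
    exact congrArg (Scheme.ΓSpecIso (.of R'[X])).inv (Polynomial.map_X r.hom)
  have h := congrArg (fun g => g.hom (value f (lineCoord t • 1 - lineHom t ≫ a)))
    (Scheme.ΓSpecIso_naturality ρ)
  refine Eq.trans (congrArg (Scheme.ΓSpecIso (.of R'[X])).hom ?_) h
  change value f (lineCoord (Spec.map r ≫ t) • 1 - lineHom (Spec.map r ≫ t) ≫
    (Over.homMk (Spec.map r) : Over.mk (Spec.map r ≫ t) ⟶ Over.mk t) ≫ a) =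
      pull ψ (value f (lineCoord t • 1 - lineHom t ≫ a))
  rw [← value_comp, comp_sub, comp_smul', A.comp_one, hcoord]
  exact congrArg (fun b => value f (lineCoord (Spec.map r ≫ t) • 1 - b))
    ((Category.assoc _ _ _).symm.trans ((congrArg (· ≫ a) hψ.symm).trans (Category.assoc _ _ _)))

/-- The polynomial with coefficients in the functions associated with a point of `A` with values
in an affine scheme. -/
def charPolyΓ (f : Γ(A.X.left, ⊤)) {R : CommRingCat.{u}} {t : Spec R ⟶ S}
    (a : Over.mk t ⟶ A.X) : Γ((Over.mk t).left, ⊤)[X] :=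
  (charPoly f a).map (Scheme.ΓSpecIso R).inv.hom

lemma charPolyΓ_comp (f : Γ(A.X.left, ⊤)) {R R' : CommRingCat.{u}} {t : Spec R ⟶ S}
    {t' : Spec R' ⟶ S} (φ : Over.mk t' ⟶ Over.mk t) (a : Over.mk t ⟶ A.X) :
    charPolyΓ f (φ ≫ a) = (charPolyΓ f a).map (pull φ) := by
  obtain ⟨r, hr⟩ : ∃ r, Spec.map r = φ.left := ⟨_, Spec.map_preimage _⟩
  have hw : Spec.map r ≫ t = t' := by
    rw [hr]
    exact Over.w φ
  subst hw
  obtain rfl : φ = Over.homMk (Spec.map r) := by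
    ext1
    exact hr.symm
  rw [charPolyΓ, charPoly_comp_homMk, charPolyΓ]
  refine (Polynomial.map_map _ _ _).trans (Eq.trans ?_ (Polynomial.map_map _ _ _).symm)
  exact congrArg (fun g => (charPoly f a).map g.hom) (Scheme.ΓSpecIso_inv_naturality r)

lemma comp_aeval {T' T : Over S} (φ : T' ⟶ T) (p : Γ(T.left, ⊤)[X]) (a : T ⟶ A.X) :
    φ ≫ Polynomial.aeval a p = Polynomial.aeval (φ ≫ a) (p.map (pull φ)) := by
  induction p using Polynomial.induction_on' with
  | add p q hp hq => rw [map_add, A.comp_add, hp, hq, Polynomial.map_add, map_add]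
  | monomial k c =>
    rw [Polynomial.map_monomial, Polynomial.aeval_monomial, Polynomial.aeval_monomial,
      ← Algebra.smul_def, ← Algebra.smul_def, comp_smul', comp_pow]

end CharPoly

lemma IsDeterminant.isDetFamily {f : Γ(A.X.left, ⊤)} (hf : A.IsDeterminant d f) (T₀ : Over S) :
    IsDetFamily (A := A) (T₀ := T₀) d (fun _ _ a => value f a) where
  natural φ _ a := value_comp f φ a
  smul _ c a := hf.sym.value_smul c a
  one _ := hf.monoid.1 _
  mul _ a b := hf.monoid.2 _ a b
  kills _ a := hf.kills _ _ a

/-- A function which is locally on the base a determinant is a determinant. -/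
lemma HasDimension.isDeterminant_of_locally (hA : A.HasDimension n) {f : Γ(A.X.left, ⊤)}
    (H : ∀ s : S, ∃ U : S.Opens, s ∈ U ∧
      IsDetFamily (A := A) (T₀ := Over.mk U.ι) d (fun _ _ a => value f a)) :
    A.IsDeterminant d f where
  sym := hA.isSymSection fun {T} c a => pull_ext_locally fun x => by
    obtain ⟨U, hxU, hU⟩ := H (T.hom x)
    obtain ⟨R, t, φ, h1, h2, ⟨g⟩⟩ := exists_spec_nhd T x hxU
    refine ⟨_, φ, h1, h2, ?_⟩
    rw [← value_comp, map_mul, map_pow, ← value_comp, comp_smul', hU.smul g]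
  monoid := by
    refine ⟨fun T => pull_ext_locally fun x => ?_, fun T a b => pull_ext_locally fun x => ?_⟩
    · obtain ⟨U, hxU, hU⟩ := H (T.hom x)
      obtain ⟨R, t, φ, h1, h2, ⟨g⟩⟩ := exists_spec_nhd T x hxU
      refine ⟨_, φ, h1, h2, ?_⟩
      rw [← value_comp, A.comp_one, hU.one g, map_one]
    · obtain ⟨U, hxU, hU⟩ := H (T.hom x)
      obtain ⟨R, t, φ, h1, h2, ⟨g⟩⟩ := exists_spec_nhd T x hxU
      refine ⟨_, φ, h1, h2, ?_⟩
      rw [← value_comp, map_mul, ← value_comp, ← value_comp, A.comp_mul, hU.mul g]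
  kills R t a := hom_ext_locally fun x => by
    obtain ⟨U, hxU, hU⟩ := H (t x)
    obtain ⟨R', t', φ, h1, h2, ⟨g⟩⟩ := exists_spec_nhd (Over.mk t) x hxU
    refine ⟨_, φ, h1, h2, ?_⟩
    have h := hU.kills g (φ ≫ a)
    rw [← charPoly_eq_charPolyOf f g] at h
    rw [comp_zero]
    refine (comp_aeval φ _ a).trans (Eq.trans ?_ h)
    exact congrArg _ (charPolyΓ_comp f φ a).symm

/-- Local determinants agree. -/
lemma IsDetFamily.eq_of_hom [IsIntegral S] (hA : A.HasDimension n)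
    (hd : IsLeast {e : ℕ | A.DegreeLE e} d) (hd0 : d ≠ 0) {U U' : S.Opens}
    {v : A.Family (Over.mk U.ι)} {v' : A.Family (Over.mk U'.ι)} (hv : IsDetFamily d v)
    (hv' : IsDetFamily d v') {T : Over S} (g : T ⟶ Over.mk U.ι) (g' : T ⟶ Over.mk U'.ι)
    (a : T ⟶ A.X) : v T g a = v' T g' a := by
  refine pull_ext_locally fun x => ?_
  have hx : T.hom x ∈ U ⊓ U' :=
    ⟨(nonempty_hom_iff.mp ⟨g⟩).ge (trivial : x ∈ (⊤ : T.left.Opens)),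
      (nonempty_hom_iff.mp ⟨g'⟩).ge (trivial : x ∈ (⊤ : T.left.Opens))⟩
  obtain ⟨W, hW, hxW, hWU, ⟨F⟩⟩ := hA.exists_frame hx
  have : IsAffine W := hW
  have : Nonempty W := ⟨⟨_, hxW⟩⟩
  obtain ⟨R, t, φ, h1, h2, ⟨h⟩⟩ := exists_spec_nhd T x hxW
  refine ⟨_, φ, h1, h2, ?_⟩
  -- Both families restrict to a small affine open with a frame inside `U ⊓ U'`, where rigidity
  -- applies.
  have heq := IsDetFamily.unique F (hA.isIndependent hd hd0 F)
    (hv.restrict (inclusion (hWU.trans inf_le_left)))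
    (hv'.restrict (inclusion (hWU.trans inf_le_right)))
  rw [← hv.natural, ← hv'.natural,
    Subsingleton.elim (φ ≫ g) (h ≫ inclusion (hWU.trans inf_le_left)),
    Subsingleton.elim (φ ≫ g') (h ≫ inclusion (hWU.trans inf_le_right))]
  exact congrFun (congrFun (congrFun heq _) h) _

lemma IsDeterminant.eq [IsIntegral S] (hA : A.HasDimension n)
    (hd : IsLeast {e : ℕ | A.DegreeLE e} d) (hd0 : d ≠ 0) {f f' : Γ(A.X.left, ⊤)}
    (hf : A.IsDeterminant d f) (hf' : A.IsDeterminant d f') : f = f' := by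
  refine eq_of_value_eq fun T a => ?_
  obtain ⟨g⟩ : Nonempty (T ⟶ Over.mk (⊤ : S.Opens).ι) := nonempty_hom_iff.mpr rfl
  exact IsDetFamily.eq_of_hom hA hd hd0 (hf.isDetFamily _) (hf'.isDetFamily _) g g a

/-- Existence of the determinant over a normal integral base. -/
lemma HasDimension.exists_isDeterminant [IsIntegral S] (hS : S.IsNormalScheme)
    (hA : A.HasDimension n) (hd : IsLeast {e : ℕ | A.DegreeLE e} d) (hd0 : d ≠ 0) :
    ∃ f : Γ(A.X.left, ⊤), A.IsDeterminant d f := by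
  have hloc (s : S) : ∃ (U : S.Opens) (v : A.Family (Over.mk U.ι)), s ∈ U ∧ IsDetFamily d v := by
    obtain ⟨U, hU, hsU, -, ⟨F⟩⟩ := hA.exists_frame (V := ⊤) (s := s) trivial
    have : IsAffine U := hU
    have : Nonempty U := ⟨⟨_, hsU⟩⟩
    have : IsIntegrallyClosed Γ((Over.mk U.ι).left, ⊤) :=
      IsAffineOpen.isIntegrallyClosed hS (U := U) hU
    obtain ⟨v, hv⟩ := F.exists_isDetFamily hd.1 (hA.isIndependent hd hd0 F)
    exact ⟨U, v, hsU, hv⟩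
  choose U v hsU hv using hloc
  have g (s : S) := (nonempty_hom_iff.mpr (taut_preimage A (U s))).some
  -- The function is glued on `A` itself from the values of the local determinants at the
  -- tautological points over the charts.
  obtain ⟨f, hf⟩ := exists_pull_glue (fun s => A.taut (U s)) (fun s => inferInstance)
    (fun x => ⟨A.X.hom x, by
      change x ∈ Set.range (Scheme.Opens.ι _)
      rw [Scheme.Opens.range_ι]
      exact hsU _⟩)
    (fun s => v s _ (g s) (A.taut (U s))) fun s s' Z α β h => by
      rw [← (hv s).natural, ← (hv s').natural, h]
      exact IsDetFamily.eq_of_hom hA hd hd0 (hv s) (hv s') _ _ _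
  refine ⟨f, hA.isDeterminant_of_locally fun s => ⟨U s, hsU s, ?_⟩⟩
  have : (fun _ _ a => value f a) = v s := by
    funext T h a
    obtain ⟨ψ, rfl⟩ := exists_comp_taut (nonempty_hom_iff.mp ⟨h⟩) a
    rw [value_comp, value_eq_pull, hf, ← (hv s).natural]
    congr 1
    exact Subsingleton.elim _ _
  rw [this]
  exact hv s

end GaAlgebraScheme


/-! ### Units -/

namespace GaAlgebraScheme

variable {S : Scheme.{u}} {A : GaAlgebraScheme S} {n d : ℕ}

section Units

/-- The zero section of the affine line pulls `X·1 - a` back to `-a` and evaluates polynomials at `X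
= 0`. -/
lemma coeff_zero_charPolyΓ (f : Γ(A.X.left, ⊤)) {R : CommRingCat.{u}} {t : Spec R ⟶ S}
    (a : Over.mk t ⟶ A.X) : (charPolyΓ f a).coeff 0 = value f (-a) := by
  let ε : CommRingCat.of R[X] ⟶ R := CommRingCat.ofHom (Polynomial.evalRingHom 0)
  have hC : CommRingCat.ofHom (Polynomial.C : R →+* R[X]) ≫ ε = 𝟙 R := by
    ext1
    exact RingHom.ext fun c => Polynomial.eval_C
  have hid : Spec.map ε ≫ Spec.map (CommRingCat.ofHom (Polynomial.C : R →+* R[X])) = 𝟙 _ :=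
    (Spec.map_comp _ _).symm.trans ((congrArg Spec.map hC).trans (Spec.map_id R))
  let σ : Over.mk t ⟶ line t := Over.homMk (Spec.map ε) (by
    change Spec.map ε ≫ Spec.map (CommRingCat.ofHom (Polynomial.C : R →+* R[X])) ≫ t = t
    exact (Category.assoc _ _ _).symm.trans ((congrArg (· ≫ t) hid).trans (Category.id_comp t)))
  have hσ : σ ≫ lineHom t = 𝟙 _ := by
    ext1
    exact hid
  have hcoord : pull σ (lineCoord t) = 0 := by
    have h := congrArg (fun g => g.hom (Polynomial.X : R[X])) (Scheme.ΓSpecIso_inv_naturality ε)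
    refine h.symm.trans ?_
    exact (congrArg (Scheme.ΓSpecIso R).inv.hom Polynomial.eval_X).trans (map_zero _)
  have h1 : σ ≫ (lineCoord t • 1 - lineHom t ≫ a) = -a := by
    rw [comp_sub, comp_smul', hcoord, zero_smul, zero_sub]
    exact congrArg (-·) ((Category.assoc _ _ _).symm.trans
      ((congrArg (· ≫ a) hσ).trans (Category.id_comp a)))
  rw [← h1, value_comp, charPolyΓ, Polynomial.coeff_map, Polynomial.coeff_zero_eq_eval_zero]
  have h2 := congrArg (fun g => g.hom (value f (lineCoord t • 1 - lineHom t ≫ a)))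
    (Scheme.ΓSpecIso_naturality ε)
  refine (congrArg (Scheme.ΓSpecIso R).inv.hom h2.symm).trans ?_
  exact congrArg (fun g => g.hom (pull σ (value f (lineCoord t • 1 - lineHom t ≫ a))))
    (Scheme.ΓSpecIso R).hom_inv_id

/-- A determinant as a homomorphism of monoids. -/
def IsMonoidMorphism.toMonoidHom {f : Γ(A.X.left, ⊤)} (hf : IsMonoidMorphism f) (T : Over S) :
    (T ⟶ A.X) →* Γ(T.left, ⊤) where
  toFun a := value f a
  map_one' := hf.1 T
  map_mul' := hf.2 T

/-- Points whose restrictions to an open cover are invertible are invertible. -/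
lemma isUnit_of_locally {T : Over S} {a : T ⟶ A.X}
    (H : ∀ x : T.left, ∃ (T' : Over S) (φ : T' ⟶ T), IsOpenImmersion φ.left ∧
      x ∈ Set.range φ.left ∧ IsUnit (φ ≫ a)) : IsUnit a := by
  choose T' φ hφ hx b hb using H
  have hmul (x) : (φ x ≫ a) * ↑(b x)⁻¹ = 1 := by rw [← hb, Units.mul_inv]
  have hmul' (x) : ↑(b x)⁻¹ * (φ x ≫ a) = 1 := by rw [← hb, Units.inv_mul]
  obtain ⟨c, hc⟩ := exists_hom_glue φ hφ (fun x => ⟨x, hx x⟩)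
    (fun x => (↑(b x)⁻¹ : T' x ⟶ A.X)) fun x y Z α β h => by
      -- Two-sided inverses are unique, so the local inverses agree on overlaps and glue.
      refine left_inv_eq_right_inv (a := α ≫ φ x ≫ a) ?_ ?_
      · rw [← A.comp_mul, hmul', A.comp_one]
      · rw [← Category.assoc, h, Category.assoc, ← A.comp_mul, hmul, A.comp_one]
  have h1 : a * c = 1 := hom_ext_locally fun x =>
    ⟨_, φ x, hφ x, hx x, by rw [A.comp_mul, hc, hmul, A.comp_one]⟩
  have h2 : c * a = 1 := hom_ext_locally fun x =>
    ⟨_, φ x, hφ x, hx x, by rw [A.comp_mul, hc, hmul', A.comp_one]⟩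
  exact ⟨⟨a, c, h1, h2⟩, rfl⟩

/-- Writing `P = X Q + P(0)`, Cayley-Hamilton gives `Q(a) a = -P(0)`, where `P(0) = det(-a) =
det(-1) det(a)` is invertible. As `Q(a)` commutes with `a`, both are units. -/
lemma IsDeterminant.isUnit_spec {f : Γ(A.X.left, ⊤)} (hf : A.IsDeterminant d f)
    {R : CommRingCat.{u}} {t : Spec R ⟶ S} {a : Over.mk t ⟶ A.X} (h : IsUnit (value f a)) :
    IsUnit a := by
  have h0 : IsUnit ((charPolyΓ f a).coeff 0) := by
    have h1 : value f (-1 * a) = value f (-1) * value f a := hf.monoid.2 _ _ _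
    rw [coeff_zero_charPolyΓ, ← neg_one_mul, h1]
    exact (isUnit_one.neg.map (hf.monoid.toMonoidHom _)).mul h
  have hk : Polynomial.aeval a (charPolyΓ f a) = 0 := hf.kills R t a
  rw [← Polynomial.divX_mul_X_add (charPolyΓ f a), map_add, map_mul, Polynomial.aeval_X,
    Polynomial.aeval_C, add_eq_zero_iff_eq_neg] at hk
  have hcomm : Commute (Polynomial.aeval a (charPolyΓ f a).divX) a := by
    have := (Commute.all (charPolyΓ f a).divX Polynomial.X).map (Polynomial.aeval a)
    rwa [Polynomial.aeval_X] at this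
  refine (hcomm.isUnit_mul_iff.mp ?_).2
  rw [hk]
  exact (h0.map (algebraMap _ _)).neg

/-- The units of `A` are the points with invertible determinant. -/
lemma IsDeterminant.isUnit_iff {f : Γ(A.X.left, ⊤)} (hf : A.IsDeterminant d f)
    {T : Over S} (a : T ⟶ A.X) : IsUnit a ↔ IsUnit (value f a) := by
  refine ⟨fun h => h.map (hf.monoid.toMonoidHom T), fun h => isUnit_of_locally fun x => ?_⟩
  obtain ⟨R, t, φ, h1, h2, -⟩ := exists_spec_nhd T x (U := ⊤) trivial
  refine ⟨_, φ, h1, h2, hf.isUnit_spec ?_⟩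
  rw [value_comp]
  exact h.map (pull φ)

end Units

end GaAlgebraScheme


/-! ### Base change -/

lemma Module.Basis.exists_of_semilinear {ι R R' M M' : Type*} [CommRing R] [CommRing R']
    [AddCommGroup M] [AddCommGroup M'] [Module R M] [Module R' M'] (φ : R' ≃+* R) (ψ : M' ≃+ M)
    (hψ : ∀ (r : R') (m : M'), ψ (r • m) = φ r • ψ m) (b : Module.Basis ι R M) :
    ∃ b' : Module.Basis ι R' M', ∀ i, ψ (b' i) = b i := by
  let : Module R' M := Module.compHom M φ.toRingHom
  let b₁ : Module.Basis ι R' M := b.mapCoeffs φ.symm fun c x => by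
    change φ (φ.symm c) • x = c • x
    rw [RingEquiv.apply_symm_apply]
  let ψ' : M' ≃ₗ[R'] M := { ψ with map_smul' := hψ }
  refine ⟨b₁.map ψ'.symm, fun i => ?_⟩
  have h : ψ' (b₁.map ψ'.symm i) = b i := by simp [b₁]
  exact h

lemma Polynomial.map_aeval_of_semilinear {R R' M M' : Type*} [CommRing R] [CommRing R'] [Ring M]
    [Ring M'] [Algebra R M] [Algebra R' M'] (φ : R →+* R') (ψ : M →+* M')
    (hψ : ∀ (r : R) (m : M), ψ (r • m) = φ r • ψ m) (p : R[X]) (a : M) :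
    ψ (Polynomial.aeval a p) = Polynomial.aeval (ψ a) (p.map φ) := by
  induction p using Polynomial.induction_on' with
  | add p q hp hq => rw [map_add, map_add, hp, hq, Polynomial.map_add, map_add]
  | monomial k c =>
    rw [Polynomial.map_monomial, Polynomial.aeval_monomial, Polynomial.aeval_monomial,
      ← Algebra.smul_def, ← Algebra.smul_def, hψ, map_pow]

namespace GaAlgebraScheme

variable {S S' : Scheme.{u}} {A : GaAlgebraScheme S} {n d : ℕ} (g : S' ⟶ S)

section BaseChange

variable (A) in
/-- The points of a base change. -/
def baseChangePoints (T : Over S') : (T ⟶ (A.baseChange g).X) ≃+* ((Over.map g).obj T ⟶ A.X) :=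
  Equiv.ringEquiv (pullbackPoints A.X g T)

/-- The functions on an `S'`-scheme do not depend on the base. -/
def functionsMap (T : Over S') : Γ(T.left, ⊤) ≃+* Γ(((Over.map g).obj T).left, ⊤) :=
  RingEquiv.refl Γ(T.left, ⊤)

lemma baseChangePoints_smul {T : Over S'} (c : Γ(T.left, ⊤)) (a : T ⟶ (A.baseChange g).X) :
    A.baseChangePoints g T (c • a) = functionsMap g T c • A.baseChangePoints g T a :=
  Equiv.apply_symm_apply (pullbackPoints A.X g T) _

lemma baseChangePoints_symm_smul {T : Over S'} (c : Γ(((Over.map g).obj T).left, ⊤))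
    (a : (Over.map g).obj T ⟶ A.X) : (A.baseChangePoints g T).symm (c • a) =
      (functionsMap g T).symm c • (A.baseChangePoints g T).symm a := by
  apply (A.baseChangePoints g T).injective
  rw [baseChangePoints_smul, RingEquiv.apply_symm_apply, RingEquiv.apply_symm_apply,
    RingEquiv.apply_symm_apply]

lemma baseChangePoints_comp {T' T : Over S'} (φ : T' ⟶ T) (a : T ⟶ (A.baseChange g).X) :
    A.baseChangePoints g T' (φ ≫ a) = (Over.map g).map φ ≫ A.baseChangePoints g T a :=
  pullbackPoints_comp A.X g φ a

lemma value_pullbackFunction (f : Γ(A.X.left, ⊤)) {T : Over S'} (a : T ⟶ (A.baseChange g).X) :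
    functionsMap g T (value (A.pullbackFunction g f) a) = value f (A.baseChangePoints g T a) := by
  exact (congrArg (fun r => r.hom f)
    (Scheme.Hom.comp_appTop (Y := (A.baseChange g).X.left) a.left
      (Limits.pullback.fst A.X.hom g))).symm

lemma HasDimension.baseChange (hA : A.HasDimension n) : (A.baseChange g).HasDimension n := by
  intro s
  obtain ⟨U, hU, e, he⟩ := hA (g s)
  let j : (Over.map g).obj (Over.mk (g ⁻¹ᵁ U).ι) ⟶ Over.mk U.ι :=
    Over.homMk (g.resLE U (g ⁻¹ᵁ U) le_rfl) (Scheme.Hom.resLE_comp_ι _ _)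
  refine ⟨g ⁻¹ᵁ U, hU, fun i => (A.baseChangePoints g _).symm (j ≫ e i), fun T h => ?_⟩
  obtain ⟨b, hb⟩ := he _ ((Over.map g).map h ≫ j)
  obtain ⟨b', hb'⟩ := b.exists_of_semilinear (functionsMap g T)
    (A.baseChangePoints g T).toAddEquiv (baseChangePoints_smul g)
  refine ⟨b', fun i => (A.baseChangePoints g T).injective ?_⟩
  rw [baseChangePoints_comp, RingEquiv.apply_symm_apply]
  exact (hb' i).trans ((hb i).trans (Category.assoc _ _ _))

lemma baseChange_ιMulti_eq_zero_iff {e : ℕ} {T : Over S'} (a : T ⟶ (A.baseChange g).X) :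
    exteriorPower.ιMulti Γ(T.left, ⊤) e (fun i : Fin e => a ^ (i : ℕ)) = 0 ↔
      exteriorPower.ιMulti Γ(((Over.map g).obj T).left, ⊤) e
        (fun i : Fin e => A.baseChangePoints g T a ^ (i : ℕ)) = 0 := by
  constructor
  · intro h
    have := ιMulti_eq_zero_of_semilinear (functionsMap g T).toRingHom
      (A.baseChangePoints g T).toAddEquiv.toAddMonoidHom (baseChangePoints_smul g) h
    refine Eq.trans (congrArg _ (funext fun i => ?_)) this
    exact (map_pow (A.baseChangePoints g T) a i).symm
  · intro h
    have := ιMulti_eq_zero_of_semilinear (functionsMap g T).symm.toRingHom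
      (A.baseChangePoints g T).symm.toAddEquiv.toAddMonoidHom (baseChangePoints_symm_smul g) h
    refine Eq.trans (congrArg _ (funext fun i => ?_)) this
    apply (A.baseChangePoints g T).injective
    refine (map_pow (A.baseChangePoints g T) a i).trans ?_
    exact ((A.baseChangePoints g T).apply_symm_apply _).symm

lemma DegreeLE.baseChange {e : ℕ} (h : A.DegreeLE e) : (A.baseChange g).DegreeLE e :=
  fun T hT a => (baseChange_ιMulti_eq_zero_iff g a).mpr (h ((Over.map g).obj T) hT _)

/-- If `e < d`, then `1, …, ξ^e` are independent over a chart of `S`. Flatness makes functions on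
that chart inject into functions on a chart of `S'`, so the generic point over the latter still has
nonzero exterior product of these powers; but it is a point of the base change. -/
lemma HasDimension.le_of_degreeLE_baseChange [IsIntegral S] [IsIntegral S'] [Flat g]
    (hA : A.HasDimension n) (hd : IsLeast {e : ℕ | A.DegreeLE e} d) {e : ℕ}
    (he : (A.baseChange g).DegreeLE e) : d ≤ e := by
  by_contra! hlt
  obtain ⟨s⟩ := (inferInstance : Nonempty S')
  obtain ⟨U, hU, hsU, -, ⟨F⟩⟩ := hA.exists_frame (V := ⊤) (s := g s) trivial
  obtain ⟨W, hW, hsW, hWU⟩ := exists_affine_subset (show s ∈ g ⁻¹ᵁ U from hsU)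
  have : IsAffine U := hU
  have : IsAffine W := hW
  have : Nonempty U := ⟨⟨_, hsU⟩⟩
  have : Nonempty W := ⟨⟨_, hsW⟩⟩
  let T₁ : Over S := (Over.map g).obj (Over.mk W.ι)
  have : IsAffine T₁.left := hW
  let h : T₁ ⟶ Over.mk U.ι := Over.homMk (g.resLE U W hWU) (Scheme.Hom.resLE_comp_ι _ _)
  have hinj : Function.Injective (pull h) := by
    have hnt : Nontrivial Γ(T₁.left, ⊤) := inferInstanceAs (Nontrivial Γ(W, ⊤))
    exact RingHom.Flat.injective_of_isDomain (Scheme.Hom.flat_appTop (g.resLE U W hWU))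
  have hF : F.IsIndependent (e + 1) :=
    (hA.isIndependent hd (by omega) F).comp (Fin.castLE hlt) (Fin.castLE_injective hlt)
  -- The affine space over `W`, built as an `S`-scheme, is given its structure over `S'`; `k` and
  -- `k'` are identities on underlying schemes reconciling the two structure morphisms to `S`.
  let T' : Over S' := Over.mk ((genericHom n T₁).left ≫ W.ι)
  have hw : T'.hom ≫ g = (genericOver n T₁).hom :=
    (Category.assoc _ _ _).trans (Over.w (genericHom n T₁))
  let k : (Over.map g).obj T' ⟶ genericOver n T₁ :=
    Over.homMk (𝟙 _) ((Category.id_comp _).trans hw.symm)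
  let k' : genericOver n T₁ ⟶ (Over.map g).obj T' :=
    Over.homMk (𝟙 _) ((Category.id_comp _).trans hw)
  have hk : k' ≫ k = 𝟙 _ := by
    ext1
    exact Category.id_comp _
  refine hF.restrict_ιMulti_ne_zero h hinj ?_
  have h0 := (baseChange_ιMulti_eq_zero_iff g _).mp (he T' (isAffine_genericOver (T₀ := T₁))
    ((A.baseChangePoints g T').symm (k ≫ (F.restrict h).genericPoint)))
  rw [RingEquiv.apply_symm_apply] at h0
  have h1 := ιMulti_comp k' h0
  simpa only [comp_pow, ← Category.assoc, hk, Category.id_comp] using h1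

/-- The affine lines over `Spec R` formed over `S'` and over `S` have the same underlying scheme and
coordinate; `k` records that identification. -/
lemma charPoly_pullbackFunction (f : Γ(A.X.left, ⊤)) {R : CommRingCat.{u}} {t : Spec R ⟶ S'}
    (a : Over.mk t ⟶ (A.baseChange g).X) : charPoly (A.pullbackFunction g f) a =
      charPoly (t := t ≫ g) f (A.baseChangePoints g _ a) := by
  let k : (Over.map g).obj (line t) ⟶ line (t ≫ g) := Over.homMk (𝟙 _)
    ((Category.id_comp _).trans (Category.assoc _ _ _).symm)
  refine congrArg (Scheme.ΓSpecIso (.of R[X])).hom ?_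
  change value (A.pullbackFunction g f) (lineCoord t • 1 - lineHom t ≫ a) =
    value f (lineCoord (t ≫ g) • 1 - lineHom (t ≫ g) ≫ A.baseChangePoints g _ a)
  refine (value_pullbackFunction g f (lineCoord t • 1 - lineHom t ≫ a)).trans ?_
  have h1 : A.baseChangePoints g (line t) (lineCoord t • 1 - lineHom t ≫ a) =
      k ≫ (lineCoord (t ≫ g) • 1 - lineHom (t ≫ g) ≫ A.baseChangePoints g _ a) := by
    rw [map_sub, baseChangePoints_smul, map_one, baseChangePoints_comp, comp_sub, comp_smul',
      A.comp_one]
    congr 1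
  rw [h1, value_comp]
  exact congrArg (fun r => r.hom (value f (lineCoord (t ≫ g) • 1 -
    lineHom (t ≫ g) ≫ A.baseChangePoints g _ a))) (Scheme.Hom.id_appTop (X := (line t).left))

/-- Points of the base change are points of `A`, with the same functions and the same values, so
every property expressed by values transfers; the symmetric power condition is one of them by
`HasDimension.isSymSection`. -/
lemma IsDeterminant.baseChange {f : Γ(A.X.left, ⊤)} (hf : A.IsDeterminant d f)
    (hA : A.HasDimension n) : (A.baseChange g).IsDeterminant d (A.pullbackFunction g f) where
  sym := (hA.baseChange g).isSymSection fun {T} c a => (functionsMap g T).injective (by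
    rw [map_mul, map_pow, value_pullbackFunction, value_pullbackFunction, baseChangePoints_smul,
      hf.sym.value_smul])
  monoid := by
    refine ⟨fun T => (functionsMap g T).injective ?_, fun T a b => (functionsMap g T).injective ?_⟩
    · rw [value_pullbackFunction, map_one, map_one]
      exact hf.monoid.1 _
    · rw [map_mul, value_pullbackFunction, value_pullbackFunction, value_pullbackFunction, map_mul]
      exact hf.monoid.2 _ _ _
  kills R t a := by
    apply (A.baseChangePoints g (Over.mk t)).injective
    rw [map_zero]
    refine (Polynomial.map_aeval_of_semilinear (functionsMap g (Over.mk t)).toRingHom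
      (A.baseChangePoints g (Over.mk t)).toRingHom (baseChangePoints_smul g) _ a).trans ?_
    rw [charPoly_pullbackFunction]
    refine Eq.trans ?_ (hf.kills R (t ≫ g) (A.baseChangePoints g _ a))
    exact congrArg _ (Polynomial.map_id)

end BaseChange

end GaAlgebraScheme

end

theorem theorem3p1 {S : Scheme.{u}} [IsIntegral S] (hS : S.IsNormalScheme)
    (A : GaAlgebraScheme S) (n : ℕ) (hA : A.HasDimension n)
    (d : ℕ) (hd : 2 ≤ d) (hdeg : IsLeast {e : ℕ | A.DegreeLE e} d) :
    ∃ det : Γ(A.X.left, ⊤),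
      A.IsDeterminant d det ∧
      (∀ f : Γ(A.X.left, ⊤), A.IsDeterminant d f → f = det) ∧
      (∀ (T : Over S) (a : T ⟶ A.X), IsUnit a ↔ IsUnit (GaAlgebraScheme.value det a)) ∧
      (∀ (S' : Scheme.{u}) [IsIntegral S'] (_ : S'.IsNormalScheme) (g : S' ⟶ S) [Flat g],
        IsLeast {e : ℕ | (A.baseChange g).DegreeLE e} d ∧
        (A.baseChange g).IsDeterminant d (A.pullbackFunction g det) ∧
        ∀ f : Γ((A.baseChange g).X.left, ⊤),
          (A.baseChange g).IsDeterminant d f → f = A.pullbackFunction g det) := by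
  obtain ⟨det, hdet⟩ := hA.exists_isDeterminant hS hdeg (by omega)
  refine ⟨det, hdet, fun f hf => hf.eq hA hdeg (by omega) hdet, fun T a => hdet.isUnit_iff a, ?_⟩
  intro S' _ _ g _
  -- Once the least degree over `S'` is known to be `d`, the pulled back determinant is
  -- characterized by the same uniqueness argument as over `S`.
  have hdeg' : IsLeast {e : ℕ | (A.baseChange g).DegreeLE e} d :=
    ⟨hdeg.1.baseChange g, fun e he => hA.le_of_degreeLE_baseChange g hdeg he⟩
  exact ⟨hdeg', hdet.baseChange g hA, fun f hf =>
    hf.eq (hA.baseChange g) hdeg' (by omega) (hdet.baseChange g hA)⟩
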